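/- **Setting.** All quantities depend on a security parameter $\lambda$; "negligible" means smaller than every inverse polynomial in $\lambda$. Write $f=\widetilde O(g)$ if $f=O(g\log^c g)$ for some $c$. Parameters: $n=\Theta(\lambda)$; $\ell\ge1$ polynomially bounded; $\kappa=\omega(\log\lambda)$ polynomially bounded; $q$ a prime power with $q=\widetilde O(\ell^2n^4)$ and $\ell^2n^4=\widetilde O(q)$; $m=2n\lceil\log_2 q\rceil$; $s>0$ with $s=\widetilde O(\sqrt m)$; $B=\widetilde O(\sqrt n)$; $\chi$ a distribution on $\mathbb Z$ with $|e|\le B$ except with negligible probability for $e\hookleftarrow\chi$; an arbitrary map $H:\mathbb Z_q^n\to\mathbb Z_q^{n\times n}$ (for instance a full-rank difference map); identities and (ordered) time periods are vectors of $\mathbb Z_q^n$. $G=[I_n\otimes(1,2,4,\dots,2^{\lceil\log_2q\rceil-1})\mid 0]\in\mathbb Z_q^{n\times m}$, and $G^{-1}(U)\in\{0,1\}^{m\times m}$ is the binary decomposition of $U\in\mathbb Z_q^{n\times m}$, so $G\,G^{-1}(U)=U$. $\mathsf{encode}(b)=(b,0,\dots,0)\in\{0,1\}^\kappa$. $\mathsf{TrapGen}$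 is any sampler of pairs $(A,T_A)$ with $A$ statistically close to uniform on $\mathbb Z_q^{n\times m}$ and, except with negligible probability, $T_A$ a basis of $\Lambda_q^\perp(A)$ with $\|\widetilde{T_A}\|\le c_0\sqrt{n\log q}$, $\|T_A\|\le c_0n\log q$, for a constant $c_0$. $\mathsf{SampleLeft}(A,M,T_A,u,s)$ is any sampler whose output is statistically close (with a common negligible bound) to the discrete Gaussian $D_{\Lambda_q^u([A\mid M]),s}$ whenever $A$ has full rank, $T_A$ is a basis of $\Lambda^\perp_q(A)$ and $s\ge\|\widetilde{T_A}\|\cdot w$; here $w\ge 0$ is a fixed function with $w=\omega(\sqrt{\log 2m})$ and $s\ge c_0\sqrt{n\log q}\cdot w$ for large $\lambda$. For a matrix in place of $u$ it is applied to the columns independently. **Scheme.** Users (at most $N$) sit at distinct leaves of a complete binary tree with at least $N$ leaves; $\mathsf{Path}(id)$ is the set of nodes from the leaf of $id$ to the root. A revocation list $RL$ is a finite set of pairs (identity, time); $id$ is revoked at $t$ if $(id,t')\in RL$ for some $t'\le t$. $\mathsf{KUNodes}(RL,t)$ is the set of children outside $X$ of nodes in $X$, where $X$ is the union of the paths of the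 users revoked at $t$ (and it is $\{\mathrm{root}\}$ if there are no such children). * *Setup*: $(A,T_A),(\mathbf B,T_{\mathbf B})\leftarrow\mathsf{TrapGen}$ independently; $V\in\mathbb Z_q^{n\times\kappa}$, $C,D,A_i,\mathbf B_i\in\mathbb Z_q^{n\times m}$ ($i\le\ell$) uniform. For $x\in\mathbb Z_q^\ell$ put $A_x=\sum A_iG^{-1}(x_iG)$, $\mathbf B_x=\sum \mathbf B_iG^{-1}(x_iG)$, and $D_{id}=D+H(id)G$, $C_t=C+H(t)G$. * *UserKG*: $Z\leftarrow\mathsf{SampleLeft}(\mathbf B,[\mathbf B_x\mid D_{id}],T_{\mathbf B},V,s)\in\mathbb Z^{3m\times\kappa}$. * *Token*: for $\theta\in\mathsf{Path}(id)$ choose $U_\theta\in\mathbb Z_q^{n\times m}$ uniformly if it is not yet defined in the state; $Z_{1,\theta}\leftarrow\mathsf{SampleLeft}(A,A_x,T_A,D_{id}-U_\theta,s)$. * *UpdKG*: for $\theta\in\mathsf{KUNodes}(RL,t)$ with $U_\theta$ defined, $Z_{2,\theta}\leftarrow\mathsf{SampleLeft}(A,C_t,T_A,U_\theta,s)$. *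 *TranKG*: $(Z_1,Z_2)=(Z_{1,\theta},Z_{2,\theta})$ for some node $\theta$ that occurs in both (and $\bot$ if there is none). * *Enc*$(y,t,M)$, $y\in\mathbb Z_q^\ell$, $M\in\{0,1\}$: $\mathbf s\in\mathbb Z_q^n$ uniform, $e\hookleftarrow\chi^\kappa$, $e_1,e_2\hookleftarrow\chi^m$, $\bar R,R_i,S_i\in\{-1,1\}^{m\times m}$ uniform; $c=V^\top\mathbf s+e+\lfloor q/2\rfloor\mathsf{encode}(M)$, $c_1=A^\top\mathbf s+e_1$, $c_{1,i}=(A_i+y_iG)^\top\mathbf s+R_i^\top e_1$, $c_{1,0}=C_t^\top\mathbf s+\bar R^\top e_1$, $c_2=\mathbf B^\top\mathbf s+e_2$, $c_{2,i}=(\mathbf B_i+y_iG)^\top\mathbf s+S_i^\top e_2$. * *Transform*: $\bar c=Z_1^\top[c_1\mid c_{1,x}]+Z_2^\top[c_1\mid c_{1,0}]$, where $c_{j,x}=\sum_i(G^{-1}(x_iG))^\top c_{j,i}$; output $(c,c_2,\{c_{2,i}\},\bar c)$. * *Dec*: $d=c-Z^\top[c_2\mid c_{2,x}\mid\bar c]\in\mathbb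 Z_q^\kappa$; output $M'$ if $\lfloor\frac2q d\rceil=\mathsf{encode}(M')$ in $\mathbb Z_2^\kappa$ (coordinatewise rounding to the nearest integer, $\lfloor c\rceil=\lceil c-\frac12\rceil$, taken modulo 2), otherwise $\bot$. Put $R_x=\sum R_iG^{-1}(x_iG)$, $S_x=\sum S_iG^{-1}(x_iG)$, $\mathsf{error}'=Z_1^\top[e_1\mid R_x^\top e_1]+Z_2^\top[e_1\mid\bar R^\top e_1]$ and $\mathsf{error}=e-Z^\top[e_2\mid S_x^\top e_2\mid\mathsf{error}']\in\mathbb Z^\kappa$. **Theorem (correctness).** There are a function $g\ge0$ with $g=\omega(\log n)$, $s\ell m^2B\,g=\widetilde O(\ell^2n^3)$ and $s\ell m^2B\,g<q/5$ for all large $\lambda$, and a negligible function $\varepsilon$, such that for every $\lambda$, every state, every revocation list, every registered identity $id$ and time $t$ at which $id$ is not revoked, all $x,y\in\mathbb Z_q^\ell$ and every $M\in\{0,1\}$, the following holds when all parties follow the algorithms. 1. If $\langle x,y\rangle=0$, then with probability at least $1-\varepsilon(\lambda)$ TranKG does not output $\bot$, $d=\lfloor q/2\rfloor\,\mathsf{encode}(M)+\mathsf{error}\bmod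 q$, $\|\mathsf{error}\|_\infty\le s\ell m^2B\,g$, and Transform followed by Dec outputs $M$. 2. If $\langle x,y\rangle\ne0$, then $G\cdot Z^2\bmod q$, where $Z^2\in\mathbb Z^{m\times\kappa}$ is the middle block of rows of $Z$, is within statistical distance $\varepsilon(\lambda)$ of uniform on $\mathbb Z_q^{n\times\kappa}$, and with probability at least $1-\varepsilon(\lambda)$ TranKG does not output $\bot$ and Transform followed by Dec outputs $\bot$. -/

import Mathlib

open Filter Asymptotics Matrix
open scoped ENNReal

noncomputable section

namespace SRPE

/-! ## Probability and asymptotics -/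

/-- Total mass of a finite product of mass functions. -/
theorem tsum_prod_eq_one {ι : Type} [Fintype ι] {α : ι → Type} (p : ∀ i, PMF (α i)) :
    ∑' f : (∀ i, α i), ∏ i, p i (f i) = 1 := by
  refine Fintype.induction_empty_option (P := fun ι _ => ∀ (α : ι → Type) (p : ∀ i, PMF (α i)),
    ∑' f : (∀ i, α i), ∏ i, p i (f i) = 1) ?_ ?_ ?_ ι α p
  · intro α' β' _ e ih α p
    let _ : Fintype α' := Fintype.ofEquiv β' e.symm
    rw [← (Equiv.piCongrLeft α e).tsum_eq, ← ih (fun a => α (e a)) (fun a => p (e a))]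
    refine tsum_congr fun f => ?_
    rw [← e.prod_comp]
    refine Finset.prod_congr rfl fun a _ => ?_
    rw [Equiv.piCongrLeft_apply_apply]
  · intro α p
    simp
  · intro ι' _ ih α p
    rw [← (Equiv.piOptionEquivProd (β := α)).symm.tsum_eq, ENNReal.tsum_prod']
    simp only [Fintype.prod_option]
    have h1 : ∀ (a : α none) (f : ∀ i, α (some i)),
        p none ((Equiv.piOptionEquivProd (β := α)).symm (a, f) none) *
          ∏ i, p (some i) ((Equiv.piOptionEquivProd (β := α)).symm (a, f) (some i)) =
        p none a * ∏ i, p (some i) (f i) := fun a f => rfl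
    simp only [h1, ENNReal.tsum_mul_left, ih _ (fun i => p (some i)), mul_one]
    exact (p none).tsum_coe

/-- Independent sampling: the product of finitely many distributions. -/
def indep {ι : Type} [Fintype ι] {α : ι → Type} (p : ∀ i, PMF (α i)) : PMF (∀ i, α i) :=
  ⟨fun f => ∏ i, p i (f i), by
    have h := tsum_prod_eq_one p
    exact h ▸ ENNReal.summable.hasSum⟩

/-- The probability that a sample of `p` lies in `S`. -/
def prob {α : Type} (p : PMF α) (S : Set α) : ℝ := (p.toOuterMeasure S).toReal

/-- Statistical distance of two (discrete) mass functions, `½ ∑ |f - g|`; in `ℝ≥0∞` the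
subtraction is truncated, so `|f - g| = (f - g) + (g - f)`. -/
def statDist {α : Type} (f g : α → ℝ≥0∞) : ℝ :=
  ((∑' a, ((f a - g a) + (g a - f a))) / 2).toReal

/-- Negligible functions of the security parameter. -/
def Negligible (ε : ℕ → ℝ) : Prop := SuperpolynomialDecay atTop (fun k : ℕ => (k : ℝ)) ε

/-- `f = Õ(g)`: `f = O(g · log^c g)` for some `c`. -/
def SoftO (f g : ℕ → ℝ) : Prop :=
  ∃ c : ℕ, f =O[atTop] fun k => g k * Real.log (g k) ^ c

/-- `f` is polynomially bounded. -/
def PolyBounded (f : ℕ → ℝ) : Prop := ∃ c : ℕ, f =O[atTop] fun k : ℕ => (k : ℝ) ^ c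

/-! ## Lattices modulo `q` -/

/-- Reduction modulo `q` of an integer matrix. -/
def modQ (q : ℕ) {a b : Type} (Z : Matrix a b ℤ) : Matrix a b (ZMod q) :=
  Z.map (Int.cast : ℤ → ZMod q)

/-- Reduction modulo `q` of an integer vector. -/
def vecModQ (q : ℕ) {a : Type} (z : a → ℤ) : a → ZMod q := fun i => (z i : ZMod q)

/-- The coset `Λ_q^u(F) = {z ∈ ℤ^ι : F z = u mod q}`; for `u = 0` it is the lattice `Λ_q^⊥(F)`. -/
def latCoset {q n : ℕ} {ι : Type} [Fintype ι] (F : Matrix (Fin n) ι (ZMod q))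
    (u : Fin n → ZMod q) : Set (ι → ℤ) :=
  {z | F *ᵥ vecModQ q z = u}

/-- The columns of `T` form a `ℤ`-basis of the lattice `Λ_q^⊥(A)`. -/
def IsLatticeBasis {q n m : ℕ} (A : Matrix (Fin n) (Fin m) (ZMod q))
    (T : Matrix (Fin m) (Fin m) ℤ) : Prop :=
  T.det ≠ 0 ∧ ∀ z : Fin m → ℤ, z ∈ latCoset A 0 ↔ ∃ c : Fin m → ℤ, z = T *ᵥ c

/-- The `j`-th column of an integer matrix as a Euclidean vector. -/
def euclCol {m : ℕ} (T : Matrix (Fin m) (Fin m) ℤ) (j : Fin m) : EuclideanSpace ℝ (Fin m) :=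
  WithLp.toLp 2 fun i => (T i j : ℝ)

/-- `‖T‖`: the length of the longest column. -/
def colNorm {m : ℕ} (T : Matrix (Fin m) (Fin m) ℤ) : ℝ := ⨆ j, ‖euclCol T j‖

/-- `‖T̃‖`: the length of the longest Gram-Schmidt vector of the columns of `T`. -/
def gsNorm {m : ℕ} (T : Matrix (Fin m) (Fin m) ℤ) : ℝ :=
  ⨆ j, ‖InnerProductSpace.gramSchmidt ℝ (euclCol T) j‖

/-- `A` has full rank over `ℤ_q`: its columns generate `ℤ_q^n`. -/
def FullRank {q n m : ℕ} (A : Matrix (Fin n) (Fin m) (ZMod q)) : Prop :=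
  Function.Surjective fun v : Fin m → ZMod q => A *ᵥ v

/-- The Gaussian weight `ρ_s(z) = exp(-π ‖z‖² / s²)`. -/
def gaussWeight {ι : Type} [Fintype ι] (s : ℝ) (z : ι → ℤ) : ℝ≥0∞ :=
  ENNReal.ofReal (Real.exp (-Real.pi * (∑ i, (z i : ℝ) ^ 2) / s ^ 2))

open Classical in
/-- The mass function of the discrete Gaussian `D_{Λ_q^u(F), s}`. -/
def gaussMass {q n : ℕ} {ι : Type} [Fintype ι] (F : Matrix (Fin n) ι (ZMod q))
    (u : Fin n → ZMod q) (s : ℝ) (z : ι → ℤ) : ℝ≥0∞ :=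
  if z ∈ latCoset F u then gaussWeight s z / ∑' z' : latCoset F u, gaussWeight s z'.1 else 0

/-- The primitive matrix `G = [I_n ⊗ (1, 2, 4, …, 2^(K-1)) | 0]` with `K = ⌈log₂ q⌉`. -/
def gadget (n m q : ℕ) : Matrix (Fin n) (Fin m) (ZMod q) :=
  Matrix.of fun i j =>
    if j.val / Nat.clog 2 q = i.val then (2 : ZMod q) ^ (j.val % Nat.clog 2 q) else 0

/-- The binary decomposition `G⁻¹(U) ∈ {0,1}^(m × m)`. -/
def gadgetInv (n m q : ℕ) (U : Matrix (Fin n) (Fin m) (ZMod q)) : Matrix (Fin m) (Fin m) ℤ :=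
  Matrix.of fun j c =>
    if h : j.val / Nat.clog 2 q < n then
      if (U ⟨j.val / Nat.clog 2 q, h⟩ c).val.testBit (j.val % Nat.clog 2 q) then 1 else 0
    else 0

/-! ## System parameters (for one value of the security parameter) -/

/-- The output of `Sys`. Identities and time periods are encoded as distinct vectors of `ℤ_q^n`;
time periods are ordered. The correctness of the scheme does not need any property of `H`. -/
structure Params where
  n : ℕ
  /-- maximal number of users -/
  N : ℕ
  /-- depth of the complete binary tree, which has `2 ^ depth` leaves -/
  depth : ℕ
  N_le : N ≤ 2 ^ depth
  ℓ : ℕ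
  κ : ℕ
  q : ℕ
  q_primePow : IsPrimePow q
  s : ℝ
  s_pos : 0 < s
  B : ℝ
  χ : PMF ℤ
  H : (Fin n → ZMod q) → Matrix (Fin n) (Fin n) (ZMod q)
  Ident : Type
  idVec : Ident ↪ (Fin n → ZMod q)
  Time : Type
  timeOrder : LinearOrder Time
  timeVec : Time ↪ (Fin n → ZMod q)

instance (p : Params) : NeZero p.q := ⟨p.q_primePow.pos.ne'⟩

instance (p : Params) : LinearOrder p.Time := p.timeOrder

/-- `m = 2 n ⌈log₂ q⌉`. -/
def Params.m (p : Params) : ℕ := 2 * p.n * Nat.clog 2 p.q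

/-- `ℤ_q^{n × m}`. -/
abbrev Params.Mat (p : Params) : Type := Matrix (Fin p.n) (Fin p.m) (ZMod p.q)

/-- Index set of two blocks of length `m`. -/
abbrev Params.I2 (p : Params) : Type := Fin p.m ⊕ Fin p.m

/-- Index set of three blocks of length `m`. -/
abbrev Params.I3 (p : Params) : Type := Fin p.m ⊕ (Fin p.m ⊕ Fin p.m)

/-- The primitive matrix for the given parameters. -/
def Params.G (p : Params) : p.Mat := gadget p.n p.m p.q

/-- `G⁻¹(c · G)`. -/
def Params.Ginv (p : Params) (c : ZMod p.q) : Matrix (Fin p.m) (Fin p.m) ℤ :=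
  gadgetInv p.n p.m p.q (c • p.G)

/-! ## Trapdoor generation and preimage sampling -/

/-- The interface of an algorithm `SampleLeft(A, M, T_A, u, s)`, with `M` having columns `ι`. -/
abbrev Sampler (p : Params) (ι : Type) : Type :=
  p.Mat → Matrix (Fin p.n) ι (ZMod p.q) → Matrix (Fin p.m) (Fin p.m) ℤ → (Fin p.n → ZMod p.q) →
    PMF (Fin p.m ⊕ ι → ℤ)

/-- The randomized subroutines called by the scheme; `sampleLeft₂` is `SampleLeft` for
matrices `M` that consist of two `n × m` blocks. -/
structure Subroutines (p : Params) where
  trapGen : PMF (p.Mat × Matrix (Fin p.m) (Fin p.m) ℤ)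
  sampleLeft₁ : Sampler p (Fin p.m)
  sampleLeft₂ : Sampler p (Fin p.m ⊕ Fin p.m)

/-- `TrapGen` with constant `C`: `A` is statistically close to uniform, and with all but
negligible probability `T_A` is a basis of `Λ_q^⊥(A)` with `‖T̃_A‖ ≤ C √(n log q)` and
`‖T_A‖ ≤ C n log q`. -/
def IsTrapGen (P : ℕ → Params) (C : ℝ)
    (tg : ∀ k, PMF ((P k).Mat × Matrix (Fin (P k).m) (Fin (P k).m) ℤ)) : Prop :=
  ∃ ε : ℕ → ℝ, Negligible ε ∧ ∀ k,
    statDist ((tg k).map Prod.fst) (PMF.uniformOfFintype (P k).Mat) ≤ ε k ∧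
    1 - ε k ≤ prob (tg k) {AT | IsLatticeBasis AT.1 AT.2 ∧
      gsNorm AT.2 ≤ C * √((P k).n * Real.logb 2 (P k).q) ∧
      colNorm AT.2 ≤ C * ((P k).n * Real.logb 2 (P k).q)}

/-- `SampleLeft` with width factor `w`: on every full-rank `A`, every `M`, every basis `T` of
`Λ_q^⊥(A)` with `s ≥ ‖T̃‖ · w` and every `u`, the output is statistically close to
`D_{Λ_q^u([A | M]), s}`. -/
def IsSampleLeft (P : ℕ → Params) (w : ℕ → ℝ) {ι : ℕ → Type} [∀ k, Fintype (ι k)]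
    (sl : ∀ k, Sampler (P k) (ι k)) : Prop :=
  ∃ ε : ℕ → ℝ, Negligible ε ∧ ∀ k A M T u,
    FullRank A → IsLatticeBasis A T → gsNorm T * w k ≤ (P k).s →
      statDist (sl k A M T u) (gaussMass (Matrix.fromCols A M) u (P k).s) ≤ ε k

/-- Sampling a matrix of preimages, column by column. -/
def sampleMatrix {p : Params} {ι : Type} {c : ℕ} (sl : Sampler p ι) (A : p.Mat)
    (M : Matrix (Fin p.n) ι (ZMod p.q)) (T : Matrix (Fin p.m) (Fin p.m) ℤ)
    (U : Matrix (Fin p.n) (Fin c) (ZMod p.q)) : PMF (Matrix (Fin p.m ⊕ ι) (Fin c) ℤ) :=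
  (indep fun j : Fin c => sl A M T fun i => U i j).map fun f => Matrix.of fun i j => f j i

/-! ## The complete subtree method -/

/-- Nodes of the binary tree: the list of turns on the way from the root. -/
abbrev Node : Type := List Bool

/-- Leaves of the complete binary tree. -/
abbrev Params.Leaf (p : Params) : Type := Fin p.depth → Bool

/-- `Path(ν)`: the nodes from the leaf `ν` to the root, both included. -/
def path {d : ℕ} (ν : Fin d → Bool) : Finset Node := (List.ofFn ν).inits.toFinset

/-- The state: the leaves assigned to the registered users (at most `N`), and the matrices
`U_θ` defined so far. -/
structure State (p : Params) where
  leaf : p.Ident → Option p.Leaf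
  leaf_inj : ∀ i j ν, leaf i = some ν → leaf j = some ν → i = j
  card_le : {i | (leaf i).isSome}.encard ≤ p.N
  U : Node → Option p.Mat

/-- Revocation lists. -/
abbrev RevList (p : Params) : Type := Finset (p.Ident × p.Time)

/-- `id` is revoked at time `t`. -/
def Revoked {p : Params} (RL : RevList p) (id : p.Ident) (t : p.Time) : Prop :=
  ∃ t', (id, t') ∈ RL ∧ t' ≤ t

open Classical in
/-- The marked set `X` of `KUNodes`. -/
def kuX {p : Params} (st : State p) (RL : RevList p) (t : p.Time) : Finset Node :=
  (RL.filter fun e => e.2 ≤ t).biUnion fun e =>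
    match st.leaf e.1 with
    | some ν => path ν
    | none => ∅

/-- The set `Y` of `KUNodes` before the treatment of the case `Y = ∅`. -/
def kuY {p : Params} (st : State p) (RL : RevList p) (t : p.Time) : Finset Node :=
  (((kuX st RL t).filter fun θ => θ.length < p.depth).biUnion
    fun θ => {θ ++ [false], θ ++ [true]}).filter fun θ => θ ∉ kuX st RL t

/-- `KUNodes(BT, RL, t)`. -/
def kuNodes {p : Params} (st : State p) (RL : RevList p) (t : p.Time) : Finset Node :=
  if kuY st RL t = ∅ then {[]} else kuY st RL t

open Classical in
/-- `Revoke`. -/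
def revoke {p : Params} (id : p.Ident) (t : p.Time) (RL : RevList p) : RevList p :=
  insert (id, t) RL

/-! ## The scheme -/

/-- Public parameters. -/
structure PublicParams (p : Params) where
  A : p.Mat
  B : p.Mat
  C : p.Mat
  D : p.Mat
  As : Fin p.ℓ → p.Mat
  Bs : Fin p.ℓ → p.Mat
  V : Matrix (Fin p.n) (Fin p.κ) (ZMod p.q)

/-- Master secret key. -/
structure MasterKey (p : Params) where
  TA : Matrix (Fin p.m) (Fin p.m) ℤ
  TB : Matrix (Fin p.m) (Fin p.m) ℤ

/-- `Setup` (the revocation list is initially empty, the state has no `U_θ` yet). -/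
def setup {p : Params} (sub : Subroutines p) : PMF (PublicParams p × MasterKey p) := do
  let AT ← sub.trapGen
  let BT ← sub.trapGen
  let V ← PMF.uniformOfFintype (Matrix (Fin p.n) (Fin p.κ) (ZMod p.q))
  let C ← PMF.uniformOfFintype p.Mat
  let D ← PMF.uniformOfFintype p.Mat
  let As ← PMF.uniformOfFintype (Fin p.ℓ → p.Mat)
  let Bs ← PMF.uniformOfFintype (Fin p.ℓ → p.Mat)
  pure (⟨AT.1, BT.1, C, D, As, Bs, V⟩, ⟨AT.2, BT.2⟩)

/-- `∑ i, A_i G⁻¹(x_i G)`. -/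
def predMat {p : Params} (As : Fin p.ℓ → p.Mat) (x : Fin p.ℓ → ZMod p.q) : p.Mat :=
  ∑ i, As i * modQ p.q (p.Ginv (x i))

/-- `D_id = D + H(id) G`. -/
def idMat {p : Params} (pp : PublicParams p) (id : p.Ident) : p.Mat :=
  pp.D + p.H (p.idVec id) * p.G

/-- `C_t = C + H(t) G`. -/
def timeMat {p : Params} (pp : PublicParams p) (t : p.Time) : p.Mat :=
  pp.C + p.H (p.timeVec t) * p.G

/-- `UserKG`. -/
def userKG {p : Params} (sub : Subroutines p) (pp : PublicParams p) (msk : MasterKey p)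
    (id : p.Ident) (x : Fin p.ℓ → ZMod p.q) : PMF (Matrix p.I3 (Fin p.κ) ℤ) :=
  sampleMatrix sub.sampleLeft₂ pp.B (Matrix.fromCols (predMat pp.Bs x) (idMat pp id)) msk.TB pp.V

/-- Tokens and update keys: sets of nodes, each with a short matrix. -/
abbrev NodeKeys (p : Params) : Type := Node → Option (Matrix p.I2 (Fin p.m) ℤ)

/-- `Token`, for an identity registered at the leaf `ν`: it defines the undefined `U_θ` on the
path of `ν`, and outputs the token and the updated state. -/
def token {p : Params} (sub : Subroutines p) (pp : PublicParams p) (msk : MasterKey p)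
    (id : p.Ident) (ν : p.Leaf) (x : Fin p.ℓ → ZMod p.q) (st : State p) :
    PMF (NodeKeys p × State p) := do
  let fresh ← PMF.uniformOfFintype (path ν → p.Mat)
  let U : path ν → p.Mat := fun θ => (st.U θ.1).getD (fresh θ)
  let Z ← indep fun θ : path ν =>
    sampleMatrix sub.sampleLeft₁ pp.A (predMat pp.As x) msk.TA (idMat pp id - U θ)
  pure (fun θ => if h : θ ∈ path ν then some (Z ⟨θ, h⟩) else none,
    { st with U := fun θ => if h : θ ∈ path ν then some (U ⟨θ, h⟩) else st.U θ })

/-- `UpdKG`; nodes without a matrix `U_θ` get no key. -/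
def updKG {p : Params} (sub : Subroutines p) (pp : PublicParams p) (msk : MasterKey p)
    (t : p.Time) (RL : RevList p) (st : State p) : PMF (NodeKeys p) := do
  let Z ← indep fun θ : kuNodes st RL t =>
    match st.U θ.1 with
    | some U => (sampleMatrix sub.sampleLeft₁ pp.A (timeMat pp t) msk.TA U).map some
    | none => PMF.pure none
  pure fun θ => if h : θ ∈ kuNodes st RL t then Z ⟨θ, h⟩ else none

/-- A transformation key. -/
abbrev TransKey (p : Params) : Type :=
  Matrix p.I2 (Fin p.m) ℤ × Matrix p.I2 (Fin p.m) ℤ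

open Classical in
/-- `TranKG`: choose a node that carries a key both in the token and in the update key, and
output these keys; `none` stands for `⊥`. -/
def tranKG {p : Params} (τ uk : NodeKeys p) : Option (TransKey p) :=
  if h : ∃ tk : TransKey p, ∃ θ, τ θ = some tk.1 ∧ uk θ = some tk.2 then some h.choose else none

/-- `encode(b) = (b, 0, …, 0)`. -/
def encode (κ : ℕ) (b : Bool) : Fin κ → ℤ := fun i => if i.val = 0 ∧ b = true then 1 else 0

/-- The randomness of `Enc`; matrices over `{-1, 1}` are matrices of units of `ℤ`. -/
structure EncRand (p : Params) where
  s : Fin p.n → ZMod p.q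
  e : Fin p.κ → ℤ
  e₁ : Fin p.m → ℤ
  e₂ : Fin p.m → ℤ
  Rbar : Matrix (Fin p.m) (Fin p.m) ℤˣ
  R : Fin p.ℓ → Matrix (Fin p.m) (Fin p.m) ℤˣ
  S : Fin p.ℓ → Matrix (Fin p.m) (Fin p.m) ℤˣ

/-- Sampling the randomness of `Enc`. -/
def encRand (p : Params) : PMF (EncRand p) := do
  let s ← PMF.uniformOfFintype (Fin p.n → ZMod p.q)
  let e ← indep fun _ : Fin p.κ => p.χ
  let e₁ ← indep fun _ : Fin p.m => p.χ
  let e₂ ← indep fun _ : Fin p.m => p.χ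
  let Rbar ← PMF.uniformOfFintype (Matrix (Fin p.m) (Fin p.m) ℤˣ)
  let R ← PMF.uniformOfFintype (Fin p.ℓ → Matrix (Fin p.m) (Fin p.m) ℤˣ)
  let S ← PMF.uniformOfFintype (Fin p.ℓ → Matrix (Fin p.m) (Fin p.m) ℤˣ)
  pure ⟨s, e, e₁, e₂, Rbar, R, S⟩

/-- A sign matrix as an integer matrix. -/
def signMat {a b : Type} (R : Matrix a b ℤˣ) : Matrix a b ℤ := R.map fun u => (u : ℤ)

/-- Ciphertexts. -/
structure Ciphertext (p : Params) where
  c : Fin p.κ → ZMod p.q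
  c₁ : Fin p.m → ZMod p.q
  c₁i : Fin p.ℓ → Fin p.m → ZMod p.q
  c₁₀ : Fin p.m → ZMod p.q
  c₂ : Fin p.m → ZMod p.q
  c₂i : Fin p.ℓ → Fin p.m → ZMod p.q

/-- `Enc(y, t, M)` with randomness `r`. -/
def enc {p : Params} (pp : PublicParams p) (y : Fin p.ℓ → ZMod p.q) (t : p.Time) (M : Bool)
    (r : EncRand p) : Ciphertext p where
  c := pp.Vᵀ *ᵥ r.s + vecModQ p.q r.e + ((p.q / 2 : ℕ) : ZMod p.q) • vecModQ p.q (encode p.κ M)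
  c₁ := pp.Aᵀ *ᵥ r.s + vecModQ p.q r.e₁
  c₁i := fun i => (pp.As i + y i • p.G)ᵀ *ᵥ r.s + vecModQ p.q ((signMat (r.R i))ᵀ *ᵥ r.e₁)
  c₁₀ := (timeMat pp t)ᵀ *ᵥ r.s + vecModQ p.q ((signMat r.Rbar)ᵀ *ᵥ r.e₁)
  c₂ := pp.Bᵀ *ᵥ r.s + vecModQ p.q r.e₂
  c₂i := fun i => (pp.Bs i + y i • p.G)ᵀ *ᵥ r.s + vecModQ p.q ((signMat (r.S i))ᵀ *ᵥ r.e₂)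

/-- Partially decrypted ciphertexts. -/
structure PartialCiphertext (p : Params) where
  c : Fin p.κ → ZMod p.q
  c₂ : Fin p.m → ZMod p.q
  c₂i : Fin p.ℓ → Fin p.m → ZMod p.q
  cbar : Fin p.m → ZMod p.q

/-- `∑ i, (G⁻¹(x_i G))ᵀ c_i`. -/
def predVec {p : Params} (x : Fin p.ℓ → ZMod p.q) (ci : Fin p.ℓ → Fin p.m → ZMod p.q) :
    Fin p.m → ZMod p.q :=
  ∑ i, (modQ p.q (p.Ginv (x i)))ᵀ *ᵥ ci i

/-- `Transform` (for a user with predicate vector `x`). -/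
def transform {p : Params} (x : Fin p.ℓ → ZMod p.q) (ct : Ciphertext p) (tk : TransKey p) :
    PartialCiphertext p where
  c := ct.c
  c₂ := ct.c₂
  c₂i := ct.c₂i
  cbar := (modQ p.q tk.1)ᵀ *ᵥ Sum.elim ct.c₁ (predVec x ct.c₁i) +
    (modQ p.q tk.2)ᵀ *ᵥ Sum.elim ct.c₁ ct.c₁₀

/-- The vector `d` computed in `Dec`. -/
def decVec {p : Params} (x : Fin p.ℓ → ZMod p.q) (ct : PartialCiphertext p)
    (sk : Matrix p.I3 (Fin p.κ) ℤ) : Fin p.κ → ZMod p.q :=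
  ct.c - (modQ p.q sk)ᵀ *ᵥ Sum.elim ct.c₂ (Sum.elim (predVec x ct.c₂i) ct.cbar)

/-- The rounding `⌊(2/q) · d⌉`, with `⌊c⌉ = ⌈c - 1/2⌉`. The representative of `d` is determined
modulo `q` only, hence the result modulo `2`. -/
def roundTwo {q : ℕ} (d : ZMod q) : ZMod 2 :=
  ((⌈(2 / (q : ℝ)) * (d.val : ℝ) - 1 / 2⌉ : ℤ) : ZMod 2)

open Classical in
/-- `Dec`; `none` stands for `⊥`. -/
def dec {p : Params} (x : Fin p.ℓ → ZMod p.q) (ct : PartialCiphertext p)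
    (sk : Matrix p.I3 (Fin p.κ) ℤ) : Option Bool :=
  if h : ∃ M : Bool, (fun i => roundTwo (decVec x ct sk i)) = vecModQ 2 (encode p.κ M) then
    some h.choose
  else none

/-! ## The honest execution -/

/-- What remains of an honest execution: public parameters, the private key, the transformation
key (or `⊥`) and the randomness of `Enc`. -/
structure Transcript (p : Params) where
  pp : PublicParams p
  sk : Matrix p.I3 (Fin p.κ) ℤ
  tk : Option (TransKey p)
  r : EncRand p

/-- All parties follow the prescribed algorithms for the user `id` with predicate vector `x`, at
time `t`, starting from the state `st`, with revocation list `RL`. -/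
def honestRun {p : Params} (sub : Subroutines p) (st : State p) (RL : RevList p) (id : p.Ident)
    (ν : p.Leaf) (x : Fin p.ℓ → ZMod p.q) (t : p.Time) : PMF (Transcript p) := do
  let keys ← setup sub
  let sk ← userKG sub keys.1 keys.2 id x
  let tok ← token sub keys.1 keys.2 id ν x st
  let uk ← updKG sub keys.1 keys.2 t RL tok.2
  let r ← encRand p
  pure ⟨keys.1, sk, tranKG tok.1 uk, r⟩

/-- The partially decrypted ciphertext of the message `M` under the attribute `y`. -/
def Transcript.partialCt {p : Params} (τ : Transcript p) (x y : Fin p.ℓ → ZMod p.q) (t : p.Time)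
    (M : Bool) (tk : TransKey p) : PartialCiphertext p :=
  transform x (enc τ.pp y t M τ.r) tk

/-- `∑ i, R_i G⁻¹(x_i G)`, over the integers. -/
def signPred {p : Params} (R : Fin p.ℓ → Matrix (Fin p.m) (Fin p.m) ℤˣ)
    (x : Fin p.ℓ → ZMod p.q) : Matrix (Fin p.m) (Fin p.m) ℤ :=
  ∑ i, signMat (R i) * p.Ginv (x i)

/-- `error' = Z₁ᵀ [e₁ ; R_xᵀ e₁] + Z₂ᵀ [e₁ ; R̄ᵀ e₁]`. -/
def errorPrime {p : Params} (x : Fin p.ℓ → ZMod p.q) (tk : TransKey p) (r : EncRand p) :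
    Fin p.m → ℤ :=
  tk.1ᵀ *ᵥ Sum.elim r.e₁ ((signPred r.R x)ᵀ *ᵥ r.e₁) +
    tk.2ᵀ *ᵥ Sum.elim r.e₁ ((signMat r.Rbar)ᵀ *ᵥ r.e₁)

/-- `error = e - Zᵀ [e₂ ; S_xᵀ e₂ ; error']`. -/
def errorTerm {p : Params} (x : Fin p.ℓ → ZMod p.q) (sk : Matrix p.I3 (Fin p.κ) ℤ)
    (tk : TransKey p) (r : EncRand p) : Fin p.κ → ℤ :=
  r.e - skᵀ *ᵥ Sum.elim r.e₂ (Sum.elim ((signPred r.S x)ᵀ *ᵥ r.e₂) (errorPrime x tk r))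

/-- The middle part `Z²` of a private key. -/
def middle {p : Params} (sk : Matrix p.I3 (Fin p.κ) ℤ) : Matrix (Fin p.m) (Fin p.κ) ℤ :=
  sk.submatrix (fun j => Sum.inr (Sum.inl j)) id

/-! ## The asymptotic choice of parameters -/

/-- The parameter setting, as functions of the security parameter `k`; `C` is the constant of
`TrapGen` and `w` the factor `ω(√log m)` required by `SampleLeft`. -/
structure ParamSetting (P : ℕ → Params) (C : ℝ) (w : ℕ → ℝ) : Prop where
  /-- `n` is linear in the security parameter -/
  n_linear : (fun k => ((P k).n : ℝ)) =Θ[atTop] fun k => (k : ℝ)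
  ℓ_pos : ∀ k, 1 ≤ (P k).ℓ
  ℓ_poly : PolyBounded fun k => ((P k).ℓ : ℝ)
  /-- `κ = ω(log k)` -/
  κ_large : (fun k : ℕ => Real.log k) =o[atTop] fun k => ((P k).κ : ℝ)
  κ_poly : PolyBounded fun k => ((P k).κ : ℝ)
  /-- `q` is `ℓ² n⁴` up to polylogarithmic factors -/
  q_le : SoftO (fun k => ((P k).q : ℝ)) fun k => (P k).ℓ ^ 2 * (P k).n ^ 4
  q_ge : SoftO (fun k => (P k).ℓ ^ 2 * (P k).n ^ 4) fun k => ((P k).q : ℝ)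
  /-- `s = Õ(√m)` -/
  s_le : SoftO (fun k => (P k).s) fun k => √(P k).m
  w_nonneg : ∀ k, 0 ≤ w k
  w_large : (fun k => √(Real.log (2 * (P k).m))) =o[atTop] w
  /-- `s` is wide enough for the trapdoors produced by `TrapGen` -/
  s_ge : ∀ᶠ k in atTop, C * √((P k).n * Real.logb 2 (P k).q) * w k ≤ (P k).s
  /-- `B = Õ(√n)` -/
  B_le : SoftO (fun k => (P k).B) fun k => √(P k).n
  /-- `χ` is `B`-bounded -/
  χ_bounded : ∃ ε : ℕ → ℝ, Negligible ε ∧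
    ∀ k, 1 - ε k ≤ prob (P k).χ {e | |(e : ℝ)| ≤ (P k).B}

/-- `s ℓ m² B · g`. -/
def errorBound (P : ℕ → Params) (g : ℕ → ℝ) (k : ℕ) : ℝ :=
  (P k).s * (P k).ℓ * (P k).m ^ 2 * (P k).B * g k

end SRPE

end

/-! Given the setup, the private key `Z`, the transformation key `(Z₁, Z₂)` and the encryption
randomness are independent. The congruences `[B | B_x | D_id] Z = V`, `[A | A_x] Z₁ = D_id - U` and
`[A | C_t] Z₂ = U` cancel all terms in the secret `s` except multiples of `⟨x, y⟩`. So `d = ⌊q/2⌋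
encode(M) + error - mask`, where coordinate `j` of the mask is the inner product of `⟨x, y⟩ s` with
`G z₂ + G Z₁' z₃`; here `z₂`, `z₃` are the middle and last blocks of column `j` of `Z`, and `Z₁'` is
the lower half of `Z₁` (`decVec_eq`). It remains to see that the error is small, and that the mask
is random when `⟨x, y⟩ ≠ 0`.

Both rest on smoothness (`IsSmooth`): all shifts of all cosets of a lattice have the same Gaussian
sum up to a factor close to `1`. On a line this is Poisson summation (`exists_gauss_line_bounds`),
and Gram-Schmidt coordinates reduce a lattice to lines (`exists_lattice_bounds`). Completing the
square then bounds the moment generating function of a discrete Gaussian (`tsum_gauss_mul_exp_le`),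
which gives Chernoff bounds. Smoothness of `A` and of `G` together makes `G z₂` nearly uniform, even
after adding a function of `z₃` (`prob_gauss_middle_le`).

Error. Entrywise triangle inequalities would lose a factor of order `m`. Three savings give `s ℓ m²
B` up to logarithms: `Rᵀ e₁` has size `B √m` because the signs are random; `G⁻¹(x_i G)` has at most
`⌈log₂ q⌉` nonzero entries per column; and the bilinear form `(Z₁ z₃) · v` is subgaussian in `Z₁`
once `z₃` and `v` are fixed (`prob_sampleMatrix_bilinear_le`). One factor `s` is then traded for
`√m` up to logarithms. As `q` is `ℓ² n⁴` up to logarithms, the bound is `o(q)`.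

Mask. If `⟨x, y⟩ ≠ 0`, then `⟨x, y⟩ s ≠ 0` outside probability `2⁻ⁿ`, and pairing with it is a
nontrivial character of `ℤ_q^n`. Such a character has real part below `-1/8` on at least an eighth
of the group (`card_char_re_le`), whereas successful decryption forces the real part to be at least
`-1/8` in every coordinate but the first (`stdAddChar_re_ge`). The columns of `Z` are independent
and `κ = ω(log λ)`, so this has negligible probability.

Two further facts are needed. A user that is not revoked shares exactly one node with `KUNodes`
(`exists_common_node`), so the choice in `TranKG` introduces no bias. Trapdoor matrices, being close
to uniform, have full rank with overwhelming probability (`prob_not_fullRank_le`). -/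

noncomputable section

namespace SRPE

/-! ## Elementary probability -/

section Prob

variable {α β : Type}

theorem ofReal_prob (p : PMF α) (S : Set α) : ENNReal.ofReal (prob p S) = p.toOuterMeasure S := by
  refine ENNReal.ofReal_toReal (ne_top_of_le_ne_top ENNReal.one_ne_top ?_)
  rw [PMF.toOuterMeasure_apply, ← p.tsum_coe]
  exact ENNReal.tsum_le_tsum fun a => Set.indicator_le_self _ _ _

theorem prob_nonneg (p : PMF α) (S : Set α) : 0 ≤ prob p S := ENNReal.toReal_nonneg

theorem prob_le_iff {p : PMF α} {S : Set α} {b : ℝ} (hb : 0 ≤ b) :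
    prob p S ≤ b ↔ p.toOuterMeasure S ≤ ENNReal.ofReal b := by
  rw [← ofReal_prob, ENNReal.ofReal_le_ofReal_iff hb]

theorem prob_mono {p : PMF α} {S T : Set α} (h : S ⊆ T) : prob p S ≤ prob p T := by
  rw [prob_le_iff (prob_nonneg _ _), ofReal_prob]
  exact p.toOuterMeasure.mono h

theorem prob_univ (p : PMF α) : prob p Set.univ = 1 := by
  rw [prob, (p.toOuterMeasure_apply_eq_one_iff Set.univ).2 (Set.subset_univ _), ENNReal.toReal_one]

theorem prob_le_one (p : PMF α) (S : Set α) : prob p S ≤ 1 :=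
  prob_univ p ▸ prob_mono (Set.subset_univ S)

theorem prob_union_le (p : PMF α) (S T : Set α) : prob p (S ∪ T) ≤ prob p S + prob p T := by
  rw [prob_le_iff (add_nonneg (prob_nonneg _ _) (prob_nonneg _ _)),
    ENNReal.ofReal_add (prob_nonneg _ _) (prob_nonneg _ _), ofReal_prob, ofReal_prob]
  exact MeasureTheory.measure_union_le S T

theorem prob_le_add {p : PMF α} {S T U : Set α} {a b : ℝ} (h : S ⊆ T ∪ U) (hT : prob p T ≤ a)
    (hU : prob p U ≤ b) : prob p S ≤ a + b :=
  (prob_mono h).trans ((prob_union_le p T U).trans (add_le_add hT hU))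

theorem prob_compl (p : PMF α) (S : Set α) : prob p Sᶜ = 1 - prob p S := by
  have h : p.toOuterMeasure S + p.toOuterMeasure Sᶜ = 1 := by
    rw [PMF.toOuterMeasure_apply, PMF.toOuterMeasure_apply, ← ENNReal.tsum_add, ← p.tsum_coe]
    refine tsum_congr fun a => ?_
    exact congrFun (Set.indicator_self_add_compl S p) a
  rw [← ofReal_prob, ← ofReal_prob, ← ENNReal.ofReal_add (prob_nonneg _ _) (prob_nonneg _ _),
    ENNReal.ofReal_eq_one] at h
  linarith

theorem one_sub_le_prob {p : PMF α} {S : Set α} {b : ℝ} (h : prob p Sᶜ ≤ b) : 1 - b ≤ prob p S := by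
  rw [prob_compl] at h
  linarith

theorem prob_exists_le {ι : Type} [Fintype ι] (p : PMF α) (S : ι → Set α) {b : ℝ}
    (h : ∀ i, prob p (S i) ≤ b) : prob p {a | ∃ i, a ∈ S i} ≤ Fintype.card ι * b := by
  -- For empty `ι` the number `b` may be negative; the claim is then `0 ≤ 0`.
  rcases isEmpty_or_nonempty ι with hι | ⟨⟨i₀⟩⟩
  · have : {a | ∃ i, a ∈ S i} = ∅ := by ext; simp
    rw [this]
    simp [prob]
  · have hb : 0 ≤ b := (prob_nonneg _ _).trans (h i₀)
    rw [prob_le_iff (by positivity)]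
    have h1 : {a | ∃ i, a ∈ S i} = ⋃ i, S i := by ext; simp
    rw [h1]
    refine (MeasureTheory.measure_iUnion_fintype_le _ _).trans ?_
    refine (Finset.sum_le_sum fun i _ => (prob_le_iff hb).1 (h i)).trans ?_
    rw [Finset.sum_const, nsmul_eq_mul, ENNReal.ofReal_mul (by positivity), ENNReal.ofReal_natCast,
      Finset.card_univ]

theorem prob_map (p : PMF α) (f : α → β) (S : Set β) : prob (p.map f) S = prob p (f ⁻¹' S) := by
  rw [prob, PMF.toOuterMeasure_map_apply, prob]

open Classical in
theorem prob_pure (a : α) (S : Set α) : prob (PMF.pure a) S = if a ∈ S then 1 else 0 := by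
  rw [prob, PMF.toOuterMeasure_pure_apply]
  split_ifs <;> simp

/-- Failure probabilities are added up along the protocol in this form: a bad set `T` of the first
sample is charged in full, and off `T` a uniform conditional bound is enough. -/
theorem prob_bind_le {p : PMF α} {f : α → PMF β} {S : Set β} (T : Set α) {b : ℝ} (hb : 0 ≤ b)
    (h : ∀ a, a ∉ T → prob (f a) S ≤ b) : prob (p.bind f) S ≤ prob p T + b := by
  rw [prob_le_iff (add_nonneg (prob_nonneg _ _) hb), ENNReal.ofReal_add (prob_nonneg _ _) hb,
    ofReal_prob, PMF.toOuterMeasure_bind_apply, PMF.toOuterMeasure_apply]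
  calc ∑' a, p a * (f a).toOuterMeasure S
      ≤ ∑' a, (T.indicator p a + p a * ENNReal.ofReal b) := by
        refine ENNReal.tsum_le_tsum fun a => ?_
        by_cases ha : a ∈ T
        · rw [Set.indicator_of_mem ha]
          refine le_add_right ?_
          rw [← ofReal_prob]
          exact mul_le_of_le_one_right zero_le
            (ENNReal.ofReal_le_one.2 (prob_le_one _ _))
        · rw [Set.indicator_of_notMem ha, zero_add]
          exact mul_le_mul_right ((prob_le_iff hb).1 (h a ha)) _
    _ = _ := by rw [ENNReal.tsum_add, ENNReal.tsum_mul_right, p.tsum_coe, one_mul]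

theorem prob_bind_le_of_forall {p : PMF α} {f : α → PMF β} {S : Set β} {b : ℝ}
    (h : ∀ a, prob (f a) S ≤ b) : prob (p.bind f) S ≤ b := by
  obtain ⟨a, -⟩ := p.support_nonempty
  have hb : 0 ≤ b := (prob_nonneg _ _).trans (h a)
  refine (prob_bind_le ∅ hb fun a _ => h a).trans ?_
  simp [prob]

theorem prob_uniform [Fintype α] [Nonempty α] (S : Set α) :
    prob (PMF.uniformOfFintype α) S = (Nat.card S : ℝ) / Fintype.card α := by
  classical
  rw [prob, PMF.toOuterMeasure_uniformOfFintype_apply, ENNReal.toReal_div, Nat.card_eq_fintype_card]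
  simp

end Prob

/-! ## Statistical distance -/

section StatDist

variable {α : Type}

/-- A one-sided inequality suffices. The sum of the truncated differences `f - g` is the excess of
`f` on the event `g < f`; the other sum is handled by applying the hypothesis to the complement of
`f < g`. -/
theorem statDist_le_of_prob_le (f g : PMF α) {d : ℝ} (h : ∀ S, prob f S ≤ prob g S + d) :
    statDist f g ≤ d := by
  have hd : 0 ≤ d := by
    have := h ∅
    simpa [prob] using this
  have key : ∀ f g : PMF α, (∑' a, (f a - g a)) + g.toOuterMeasure {a | g a < f a} =
      f.toOuterMeasure {a | g a < f a} := by
    intro f g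
    rw [PMF.toOuterMeasure_apply, PMF.toOuterMeasure_apply, ← ENNReal.tsum_add]
    refine tsum_congr fun a => ?_
    by_cases ha : a ∈ {a | g a < f a}
    · rw [Set.indicator_of_mem ha, Set.indicator_of_mem ha, tsub_add_cancel_of_le (le_of_lt ha)]
    · rw [Set.indicator_of_notMem ha, Set.indicator_of_notMem ha,
        tsub_eq_zero_of_le (not_lt.1 ha), add_zero]
  have h1 : ∑' a, (f a - g a) ≤ ENNReal.ofReal d := by
    have h2 := key f g
    rw [← ofReal_prob, ← ofReal_prob f] at h2
    have h3 := ENNReal.ofReal_le_ofReal (h {a | g a < f a})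
    rw [← h2, ENNReal.ofReal_add (prob_nonneg _ _) hd, add_comm] at h3
    exact (ENNReal.add_le_add_iff_left ENNReal.ofReal_ne_top).1 h3
  have h4 : ∑' a, (g a - f a) ≤ ENNReal.ofReal d := by
    have h2 := key g f
    rw [← ofReal_prob, ← ofReal_prob g] at h2
    have h5 := h {a | f a < g a}ᶜ
    rw [prob_compl, prob_compl] at h5
    have h3 := ENNReal.ofReal_le_ofReal
      (show prob g {a | f a < g a} ≤ prob f {a | f a < g a} + d by linarith)
    rw [← h2, ENNReal.ofReal_add (prob_nonneg _ _) hd, add_comm] at h3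
    exact (ENNReal.add_le_add_iff_left ENNReal.ofReal_ne_top).1 h3
  rw [statDist, ENNReal.tsum_add]
  refine ENNReal.toReal_le_of_le_ofReal hd ?_
  refine ENNReal.div_le_of_le_mul ?_
  rw [mul_two]
  exact add_le_add h1 h4

theorem statDist_le_one (f g : PMF α) : statDist f g ≤ 1 :=
  statDist_le_of_prob_le f g fun S => (prob_le_one f S).trans (by linarith [prob_nonneg g S])

theorem statDist_nonneg (f g : α → ℝ≥0∞) : 0 ≤ statDist f g := ENNReal.toReal_nonneg

/-- One truncated sum is estimated by both together, which costs a harmless factor `2`. Finiteness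
of the sum has to be checked because `toReal` sends `∞` to `0`. -/
theorem tsum_sub_le_of_statDist_le {f g : PMF α} {d : ℝ} (h : statDist f g ≤ d) :
    ∑' a, (f a - g a) ≤ ENNReal.ofReal (2 * d) := by
  have h1 : ∑' a, ((f a - g a) + (g a - f a)) ≤ 2 := by
    calc ∑' a, ((f a - g a) + (g a - f a)) ≤ ∑' a, (f a + g a) :=
          ENNReal.tsum_le_tsum fun a => add_le_add tsub_le_self tsub_le_self
      _ = 2 := by rw [ENNReal.tsum_add, f.tsum_coe, g.tsum_coe, one_add_one_eq_two]
  have h2 : (∑' a, ((f a - g a) + (g a - f a))) ≠ ∞ := ne_top_of_le_ne_top (by simp) h1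
  have h3 : (∑' a, ((f a - g a) + (g a - f a))).toReal ≤ 2 * d := by
    rw [statDist, ENNReal.toReal_div, ENNReal.toReal_ofNat] at h
    linarith
  calc ∑' a, (f a - g a) ≤ ∑' a, ((f a - g a) + (g a - f a)) :=
        ENNReal.tsum_le_tsum fun a => le_self_add
    _ = ENNReal.ofReal (∑' a, ((f a - g a) + (g a - f a))).toReal := (ENNReal.ofReal_toReal h2).symm
    _ ≤ _ := ENNReal.ofReal_le_ofReal h3

theorem prob_le_of_statDist_le {f g : PMF α} {d : ℝ} (h : statDist f g ≤ d) (S : Set α) :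
    prob f S ≤ prob g S + 2 * d := by
  have hd : 0 ≤ d := (statDist_nonneg _ _).trans h
  rw [prob_le_iff (add_nonneg (prob_nonneg _ _) (by linarith)),
    ENNReal.ofReal_add (prob_nonneg _ _) (by linarith), ofReal_prob,
    PMF.toOuterMeasure_apply, PMF.toOuterMeasure_apply]
  calc ∑' a, S.indicator f a ≤ ∑' a, (S.indicator g a + (f a - g a)) := by
        refine ENNReal.tsum_le_tsum fun a => ?_
        by_cases ha : a ∈ S
        · rw [Set.indicator_of_mem ha, Set.indicator_of_mem ha]
          exact le_add_tsub
        · rw [Set.indicator_of_notMem ha]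
          exact zero_le
    _ ≤ _ := by
        rw [ENNReal.tsum_add]
        exact add_le_add le_rfl (tsum_sub_le_of_statDist_le h)

end StatDist

/-! ## Independent samples -/

section Indep

variable {ι : Type} [Fintype ι] {α : ι → Type}

theorem tsum_pi_prod (f : ∀ i, α i → ℝ≥0∞) :
    ∑' x : (∀ i, α i), ∏ i, f i (x i) = ∏ i, ∑' a, f i a := by
  refine Fintype.induction_empty_option (P := fun ι _ => ∀ (α : ι → Type)
    (f : ∀ i, α i → ℝ≥0∞), ∑' x : (∀ i, α i), ∏ i, f i (x i) = ∏ i, ∑' a, f i a) ?_ ?_ ?_ ι α f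
  · intro α' β' _ e ih α f
    let _ : Fintype α' := Fintype.ofEquiv β' e.symm
    rw [← (Equiv.piCongrLeft α e).tsum_eq, ← e.prod_comp, ← ih (fun a => α (e a)) (fun a => f (e a))]
    refine tsum_congr fun x => ?_
    rw [← e.prod_comp]
    refine Finset.prod_congr rfl fun a _ => ?_
    rw [Equiv.piCongrLeft_apply_apply]
  · intro α f
    simp
  · intro ι' _ ih α f
    rw [← (Equiv.piOptionEquivProd (β := α)).symm.tsum_eq, ENNReal.tsum_prod']
    simp only [Fintype.prod_option]
    have h1 : ∀ (a : α none) (x : ∀ i, α (some i)),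
        f none ((Equiv.piOptionEquivProd (β := α)).symm (a, x) none) *
          ∏ i, f (some i) ((Equiv.piOptionEquivProd (β := α)).symm (a, x) (some i)) =
        f none a * ∏ i, f (some i) (x i) := fun a x => rfl
    simp only [h1, ENNReal.tsum_mul_left, ih _ (fun i => f (some i)), ENNReal.tsum_mul_right]

theorem indep_apply (p : ∀ i, PMF (α i)) (f : ∀ i, α i) : indep p f = ∏ i, p i (f i) := rfl

theorem prob_indep_pi (p : ∀ i, PMF (α i)) (S : ∀ i, Set (α i)) :
    prob (indep p) {f | ∀ i, f i ∈ S i} = ∏ i, prob (p i) (S i) := by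
  have h : (indep p).toOuterMeasure {f | ∀ i, f i ∈ S i} = ∏ i, (p i).toOuterMeasure (S i) := by
    simp only [PMF.toOuterMeasure_apply]
    rw [← tsum_pi_prod]
    refine tsum_congr fun f => ?_
    by_cases hf : ∀ i, f i ∈ S i
    · rw [Set.indicator_of_mem (show f ∈ {f | ∀ i, f i ∈ S i} from hf), indep_apply]
      exact Finset.prod_congr rfl fun i _ => (Set.indicator_of_mem (hf i) _).symm
    · rw [Set.indicator_of_notMem (show f ∉ {f | ∀ i, f i ∈ S i} from hf)]
      push Not at hf
      obtain ⟨i, hi⟩ := hf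
      exact (Finset.prod_eq_zero (Finset.mem_univ i) (Set.indicator_of_notMem hi _)).symm
  rw [prob, h, ENNReal.toReal_prod]
  rfl

theorem prob_indep_eval (p : ∀ i, PMF (α i)) (i : ι) (S : Set (α i)) :
    prob (indep p) {f | f i ∈ S} = prob (p i) S := by
  classical
  have h : {f : ∀ i, α i | f i ∈ S} =
      {f | ∀ j, f j ∈ (Function.update (fun _ => Set.univ) i S : ∀ j, Set (α j)) j} := by
    ext f
    simp only [Set.mem_ofPred_eq]
    constructor
    · intro hf j
      rcases eq_or_ne j i with rfl | hj
      · simpa using hf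
      · simp [hj]
    · intro hf
      simpa using hf i
  rw [h, prob_indep_pi, Finset.prod_eq_single i]
  · simp
  · intro j _ hj
    simp [hj, prob_univ]
  · simp

/-- Independent samples from statistically close distributions. -/
theorem prob_indep_le_of_statDist_le (p g : ∀ i, PMF (α i)) {d : ℝ}
    (h : ∀ i, statDist (p i) (g i) ≤ d) (S : Set (∀ i, α i)) (hd : 0 ≤ d) :
    prob (indep p) S ≤ prob (indep g) S + ((1 + 2 * d) ^ Fintype.card ι - 1) := by
  -- `m i` is the pointwise maximum of `p i` and `g i`, of total mass at most `1 + 2 * d`. The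
  -- product of these maxima dominates both product laws; it is used for `p` on `S` and for `g` on
  -- the complement, in place of a hybrid argument.
  set m : ∀ i, α i → ℝ≥0∞ := fun i a => g i a + (p i a - g i a) with hm
  have hsum : ∑' x : (∀ i, α i), ∏ i, m i (x i) ≤
      ENNReal.ofReal ((1 + 2 * d) ^ Fintype.card ι) := by
    rw [tsum_pi_prod, ENNReal.ofReal_pow (by positivity), ← Finset.card_univ, ← Finset.prod_const]
    refine Finset.prod_le_prod' fun i _ => ?_
    rw [hm, ENNReal.tsum_add, (g i).tsum_coe, ENNReal.ofReal_add zero_le_one (by positivity),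
      ENNReal.ofReal_one]
    exact add_le_add le_rfl (tsum_sub_le_of_statDist_le (h i))
  have hp : (indep p).toOuterMeasure S ≤ ∑' x, S.indicator (fun x => ∏ i, m i (x i)) x := by
    rw [PMF.toOuterMeasure_apply]
    refine ENNReal.tsum_le_tsum fun x => Set.indicator_le_indicator ?_
    exact Finset.prod_le_prod' fun i _ => le_add_tsub
  have hg : (indep g).toOuterMeasure Sᶜ ≤ ∑' x, Sᶜ.indicator (fun x => ∏ i, m i (x i)) x := by
    rw [PMF.toOuterMeasure_apply]
    refine ENNReal.tsum_le_tsum fun x => Set.indicator_le_indicator ?_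
    exact Finset.prod_le_prod' fun i _ => le_self_add
  have hadd : (indep p).toOuterMeasure S + (indep g).toOuterMeasure Sᶜ ≤
      ENNReal.ofReal ((1 + 2 * d) ^ Fintype.card ι) := by
    refine (add_le_add hp hg).trans (le_trans (le_of_eq ?_) hsum)
    rw [← ENNReal.tsum_add]
    exact tsum_congr fun a => congrFun (Set.indicator_self_add_compl S _) a
  rw [← ofReal_prob, ← ofReal_prob, ← ENNReal.ofReal_add (prob_nonneg _ _) (prob_nonneg _ _),
    ENNReal.ofReal_le_ofReal_iff (by positivity), prob_compl] at hadd
  linarith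

theorem uniformOfFintype_pi [∀ i, Fintype (α i)] [∀ i, Nonempty (α i)] [DecidableEq ι] :
    PMF.uniformOfFintype (∀ i, α i) = indep fun i => PMF.uniformOfFintype (α i) := by
  ext f
  rw [indep_apply]
  simp only [PMF.uniformOfFintype_apply, Fintype.card_pi]
  rw [Nat.cast_prod, ENNReal.prod_inv_distrib]
  exact fun i _ j _ _ => Or.inl (by simp)

/-- A Chernoff bound for sums of independent sub-Gaussian variables. -/
theorem prob_indep_sum_gt_le (p : ∀ i, PMF (α i)) (X : ∀ i, α i → ℝ) (a : ι → ℝ) {R N τ : ℝ}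
    (hX : ∀ i l, ∑' x, p i x * ENNReal.ofReal (Real.exp (l * X i x)) ≤
      ENNReal.ofReal (R * Real.exp (l ^ 2 * a i)))
    (hR : 0 ≤ R) (hN : 0 < N) (hτ : 0 ≤ τ) (ha : ∑ i, a i ≤ N ^ 2) :
    prob (indep p) {f | 2 * τ * N < ∑ i, X i (f i)} ≤
      R ^ Fintype.card ι * Real.exp (-τ ^ 2) := by
  rw [prob_le_iff (by positivity), PMF.toOuterMeasure_apply]
  -- The choice that minimizes the exponent `l² N² - 2 τ l N`; the minimum is `-τ²`.
  set l := τ / N with hl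
  have hlN : l * N = τ := by rw [hl]; field_simp
  have hl0 : 0 ≤ l := by positivity
  calc ∑' f, {f : ∀ i, α i | 2 * τ * N < ∑ i, X i (f i)}.indicator (indep p) f
      ≤ ∑' f : (∀ i, α i), ENNReal.ofReal (Real.exp (-(2 * τ ^ 2))) *
          ∏ i, (p i (f i) * ENNReal.ofReal (Real.exp (l * X i (f i)))) := by
        refine ENNReal.tsum_le_tsum fun f => ?_
        by_cases hf : f ∈ {f : ∀ i, α i | 2 * τ * N < ∑ i, X i (f i)}
        · rw [Set.indicator_of_mem hf, Finset.prod_mul_distrib, ← indep_apply, mul_left_comm,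
            ← ENNReal.ofReal_prod_of_nonneg (fun _ _ => (Real.exp_pos _).le), ← Real.exp_sum,
            ← ENNReal.ofReal_mul (Real.exp_pos _).le, ← Real.exp_add]
          refine le_mul_of_one_le_right zero_le (ENNReal.one_le_ofReal.2 (Real.one_le_exp ?_))
          rw [← Finset.mul_sum]
          have h1 : l * (2 * τ * N) ≤ l * ∑ i, X i (f i) := mul_le_mul_of_nonneg_left hf.le hl0
          have h2 : l * (2 * τ * N) = 2 * τ ^ 2 := by
            calc l * (2 * τ * N) = 2 * τ * (l * N) := by ring
              _ = _ := by rw [hlN]; ring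
          linarith
        · rw [Set.indicator_of_notMem hf]
          exact zero_le
    _ = ENNReal.ofReal (Real.exp (-(2 * τ ^ 2))) *
          ∏ i, ∑' x, p i x * ENNReal.ofReal (Real.exp (l * X i x)) := by
        rw [ENNReal.tsum_mul_left, tsum_pi_prod
          (f := fun i x => p i x * ENNReal.ofReal (Real.exp (l * X i x)))]
    _ ≤ ENNReal.ofReal (Real.exp (-(2 * τ ^ 2))) *
          ∏ i, ENNReal.ofReal (R * Real.exp (l ^ 2 * a i)) :=
        mul_le_mul_right (Finset.prod_le_prod' fun i _ => hX i l) _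
    _ ≤ _ := by
        rw [← ENNReal.ofReal_prod_of_nonneg (fun _ _ => by positivity),
          ← ENNReal.ofReal_mul (Real.exp_pos _).le]
        refine ENNReal.ofReal_le_ofReal ?_
        rw [Finset.prod_mul_distrib, Finset.prod_const, Finset.card_univ, ← Real.exp_sum,
          ← Finset.mul_sum, mul_left_comm, ← Real.exp_add]
        refine mul_le_mul_of_nonneg_left (Real.exp_le_exp.2 ?_) (by positivity)
        have h3 : l ^ 2 * ∑ i, a i ≤ l ^ 2 * N ^ 2 := mul_le_mul_of_nonneg_left ha (sq_nonneg _)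
        rw [← mul_pow, hlN] at h3
        linarith

end Indep

/-! ## Gaussian sums over cosets of `ℤ` -/

/-- The dominating series for a Gaussian sum without its central term, since `n² ≥ |n|`. -/
theorem hasSum_int_ne_zero_pow_natAbs {x : ℝ} (h0 : 0 ≤ x) (h1 : x < 1) :
    HasSum (fun n : ℤ => if n = 0 then 0 else x ^ n.natAbs) (x * (1 - x)⁻¹ + x * (1 - x)⁻¹) := by
  refine HasSum.of_nat_of_neg_add_one ?_ ?_
  · have h := (hasSum_geometric_of_lt_one h0 h1).mul_left x
    rw [hasSum_nat_add_iff' 1 |>.symm]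
    simp only [Finset.range_one, Finset.sum_singleton, Nat.cast_zero, if_true, sub_zero]
    refine h.congr_fun ?_ |> fun h => h
    intro n
    have : ((n + 1 : ℕ) : ℤ) ≠ 0 := by positivity
    rw [if_neg this, Int.natAbs_natCast, pow_succ']
  · have h := (hasSum_geometric_of_lt_one h0 h1).mul_left x
    refine h.congr_fun ?_ |> fun h => h
    intro n
    have : (-((n : ℤ) + 1)) ≠ 0 := by omega
    have h2 : (-((n : ℤ) + 1)).natAbs = n + 1 := by omega
    rw [if_neg this, h2, pow_succ']

/-- Poisson summation turns the shift `t` into phases of modulus one. The term at `0` of the dual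
sum is `1`, and the others add up to at most `2 x / (1 - x) ≤ 4 x` with `x = exp (-π / a)`. The
bound is therefore uniform in `t`. -/
theorem abs_sqrt_mul_tsum_gauss_sub_one_le {a : ℝ} (ha : 0 < a)
    (hx : Real.exp (-Real.pi / a) ≤ 1 / 2) (t : ℝ) :
    |√a * ∑' k : ℤ, Real.exp (-Real.pi * a * (k + t) ^ 2) - 1| ≤ 4 * Real.exp (-Real.pi / a) := by
  set x := Real.exp (-Real.pi / a) with hxdef
  have hx0 : 0 ≤ x := (Real.exp_pos _).le
  -- With parameter `1 / a` and linear term `-I t`, the Gaussian shifted by the real number `t` is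
  -- the right-hand side of the formula, and the sum with phases the left-hand side.
  have hP := Complex.tsum_exp_neg_quadratic (a := ((1 / a : ℝ) : ℂ))
    (by rw [Complex.ofReal_re]; positivity) (-Complex.I * t)
  set F : ℤ → ℂ := fun n => Complex.exp (-Real.pi * ((1 / a : ℝ) : ℂ) * n ^ 2 +
    2 * Real.pi * (-Complex.I * t) * n) with hF
  have hR : ∀ n : ℤ, Complex.exp (-Real.pi / ((1 / a : ℝ) : ℂ) *
      (n + Complex.I * (-Complex.I * t)) ^ 2) =
      ((Real.exp (-Real.pi * a * (n + t) ^ 2) : ℝ) : ℂ) := by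
    intro n
    rw [Complex.ofReal_exp]
    congr 1
    have h1 : Complex.I * (-Complex.I * t) = t := by
      rw [← mul_assoc, mul_neg, Complex.I_mul_I, neg_neg, one_mul]
    rw [h1]
    push_cast
    have : (a : ℂ) ≠ 0 := by exact_mod_cast ha.ne'
    field_simp
  have hnorm : ∀ n : ℤ, ‖F n‖ = Real.exp (-Real.pi / a * n ^ 2) := by
    intro n
    rw [hF, Complex.norm_exp]
    congr 1
    have : (-Real.pi * ((1 / a : ℝ) : ℂ) * n ^ 2 + 2 * Real.pi * (-Complex.I * t) * n : ℂ) =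
      ((-Real.pi / a * n ^ 2 : ℝ) : ℂ) + ((-(2 * Real.pi * t * n) : ℝ) : ℂ) * Complex.I := by
      push_cast
      ring
    rw [this, Complex.add_re, Complex.ofReal_re, Complex.re_ofReal_mul, Complex.I_re, mul_zero,
      add_zero]
  have hle : ∀ n : ℤ, n ≠ 0 → ‖F n‖ ≤ x ^ n.natAbs := by
    intro n hn
    rw [hnorm, hxdef, ← Real.exp_nat_mul]
    refine Real.exp_le_exp.2 ?_
    have h1 : (1 : ℝ) ≤ n.natAbs := by exact_mod_cast Int.natAbs_pos.2 hn
    have h2 : ((n : ℝ)) ^ 2 = (n.natAbs : ℝ) ^ 2 := by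
      rw [Nat.cast_natAbs, Int.cast_abs, sq_abs]
    rw [h2, mul_comm]
    have h3 : (n.natAbs : ℝ) ≤ (n.natAbs : ℝ) ^ 2 := by nlinarith
    have h4 : -Real.pi / a ≤ 0 := by
      rw [neg_div]
      exact neg_nonpos.2 (by positivity)
    exact mul_le_mul_of_nonpos_right h3 h4
  have hgeo := hasSum_int_ne_zero_pow_natAbs hx0 (by linarith)
  set F' : ℤ → ℂ := fun n => if n = 0 then 0 else F n with hF'
  have hF'le : ∀ n, ‖F' n‖ ≤ if n = 0 then 0 else x ^ n.natAbs := by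
    intro n
    by_cases hn : n = 0
    · simp [hF', hn]
    · simpa [hF', hn] using hle n hn
  have hF's : Summable F' := Summable.of_norm_bounded hgeo.summable hF'le
  have hF'n : ‖∑' n, F' n‖ ≤ 4 * x := by
    refine (tsum_of_norm_bounded hgeo hF'le).trans ?_
    have h5 : (1 - x)⁻¹ ≤ 2 := by
      rw [inv_le_comm₀ (by linarith) (by norm_num)]
      linarith
    nlinarith
  have hFsum : ∑' n, F n = 1 + ∑' n, F' n := by
    have h6 : ∀ n, F n = (if n = 0 then 1 else 0) + F' n := by
      intro n
      by_cases hn : n = 0 <;> simp [hF', hF, hn]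
    have h7 : HasSum (fun n : ℤ => if n = 0 then (1 : ℂ) else 0) 1 := hasSum_ite_eq 0 1
    rw [tsum_congr h6, h7.summable.tsum_add hF's, h7.tsum_eq]
  have hcpow : (1 : ℂ) / (((1 / a : ℝ) : ℂ)) ^ (1 / 2 : ℂ) = ((√a : ℝ) : ℂ) := by
    have h8 : (1 / 2 : ℂ) = ((1 / 2 : ℝ) : ℂ) := by push_cast; rfl
    rw [h8, ← Complex.ofReal_cpow (by positivity), ← Real.sqrt_eq_rpow, Real.sqrt_div zero_le_one,
      Real.sqrt_one]
    push_cast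
    rw [one_div_one_div]
  have hfin : ((√a * ∑' k : ℤ, Real.exp (-Real.pi * a * (k + t) ^ 2) - 1 : ℝ) : ℂ) =
      ∑' n, F' n := by
    have h9 : ∑' n, F n = ((√a : ℝ) : ℂ) *
        ∑' n : ℤ, ((Real.exp (-Real.pi * a * (n + t) ^ 2) : ℝ) : ℂ) := by
      rw [← hcpow, ← tsum_congr hR]
      exact hP
    rw [hFsum, ← Complex.ofReal_tsum] at h9
    push_cast at h9 ⊢
    rw [← h9]
    ring
  rw [← Real.norm_eq_abs, ← Complex.norm_real, hfin]
  exact hF'n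

/-- If the family were not summable, its `tsum` would be the default value `0`, and the preceding
bound would read `1 ≤ 4 · 1/8`. -/
theorem summable_gauss_int {a : ℝ} (ha : 0 < a)
    (hx : Real.exp (-Real.pi / a) ≤ 1 / 8) (t : ℝ) :
    Summable fun k : ℤ => Real.exp (-Real.pi * a * (k + t) ^ 2) := by
  by_contra h
  have := abs_sqrt_mul_tsum_gauss_sub_one_le ha (hx.trans (by norm_num)) t
  rw [tsum_eq_zero_of_not_summable h] at this
  norm_num at this
  linarith

/-- The relative error of Gaussian sums over cosets, when the width exceeds the Gram-Schmidt
norms by a factor `w`. -/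
def smoothErr (w : ℝ) : ℝ := 16 * Real.exp (-(Real.pi * w ^ 2))

theorem smoothErr_nonneg (w : ℝ) : 0 ≤ smoothErr w := by
  unfold smoothErr
  positivity

/-- With `a = b² / s²` and `d = 4 exp (-π w²)`, every shifted sum lies between `(1 - d) / √a` and
`(1 + d) / √a`. The lower value is the common `M`. -/
theorem exists_gauss_line_bounds {b s w : ℝ} (hb : 0 < b) (hw : 1 ≤ w) (h : b * w ≤ s) :
    ∃ M : ℝ≥0∞, M ≠ ∞ ∧ ∀ t : ℝ,
      M ≤ ∑' k : ℤ, ENNReal.ofReal (Real.exp (-Real.pi * (b * (k + t)) ^ 2 / s ^ 2)) ∧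
      ∑' k : ℤ, ENNReal.ofReal (Real.exp (-Real.pi * (b * (k + t)) ^ 2 / s ^ 2)) ≤
        ENNReal.ofReal (Real.exp (smoothErr w)) * M := by
  have hs : 0 < s := (by positivity : 0 < b * w).trans_le h
  set a := b ^ 2 / s ^ 2 with ha
  have ha0 : 0 < a := by positivity
  have haw : w ^ 2 ≤ 1 / a := by
    rw [ha, one_div_div, le_div_iff₀ (by positivity), ← mul_pow, mul_comm]
    exact pow_le_pow_left₀ (by positivity) h 2
  have hxw : Real.exp (-Real.pi / a) ≤ Real.exp (-(Real.pi * w ^ 2)) := by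
    refine Real.exp_le_exp.2 ?_
    have : -Real.pi / a = -(Real.pi * (1 / a)) := by ring
    rw [this]
    exact neg_le_neg (mul_le_mul_of_nonneg_left haw Real.pi_pos.le)
  -- It makes `d ≤ 1/2`, through `exp (-3) ≤ (1/2)³`.
  have hx8 : Real.exp (-(Real.pi * w ^ 2)) ≤ 1 / 8 := by
    have h1 : Real.exp (-(Real.pi * w ^ 2)) ≤ Real.exp (-3) := by
      refine Real.exp_le_exp.2 (neg_le_neg ?_)
      nlinarith [Real.pi_gt_three]
    have h2 : Real.exp (-3) = (Real.exp 1)⁻¹ ^ 3 := by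
      rw [← Real.exp_neg, ← Real.exp_nat_mul]
      norm_num
    have h3 : (Real.exp 1)⁻¹ ≤ 1 / 2 := by
      rw [inv_le_comm₀ (Real.exp_pos _) (by norm_num)]
      have := Real.add_one_le_exp 1
      norm_num at this ⊢
      exact this
    calc _ ≤ _ := h1
      _ = (Real.exp 1)⁻¹ ^ 3 := h2
      _ ≤ (1 / 2) ^ 3 := pow_le_pow_left₀ (by positivity) h3 3
      _ = 1 / 8 := by norm_num
  set d := 4 * Real.exp (-(Real.pi * w ^ 2)) with hd
  have hd0 : 0 ≤ d := by positivity
  have hsum : ∀ t, ∑' k : ℤ, ENNReal.ofReal (Real.exp (-Real.pi * (b * (k + t)) ^ 2 / s ^ 2)) =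
      ENNReal.ofReal (∑' k : ℤ, Real.exp (-Real.pi * a * (k + t) ^ 2)) := by
    intro t
    rw [ENNReal.ofReal_tsum_of_nonneg (fun _ => (Real.exp_pos _).le)
      (summable_gauss_int ha0 (hxw.trans hx8) t)]
    refine tsum_congr fun k => ?_
    congr 2
    rw [ha]
    ring
  clear_value a
  refine ⟨ENNReal.ofReal ((1 - d) / √a), ENNReal.ofReal_ne_top, fun t => ?_⟩
  have hsq : 0 < √a := Real.sqrt_pos.2 ha0
  have habs := abs_le.1 ((abs_sqrt_mul_tsum_gauss_sub_one_le ha0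
    ((hxw.trans hx8).trans (by norm_num)) t).trans (mul_le_mul_of_nonneg_left hxw (by norm_num)))
  rw [hsum]
  constructor
  · refine ENNReal.ofReal_le_ofReal ?_
    rw [div_le_iff₀ hsq]
    linarith [habs.1]
  · rw [← ENNReal.ofReal_mul (Real.exp_pos _).le]
    refine ENNReal.ofReal_le_ofReal ?_
    rw [mul_div_assoc', le_div_iff₀ hsq]
    have h4 : smoothErr w = 4 * d := by rw [hd, smoothErr]; ring
    have h5 : 4 * d + 1 ≤ Real.exp (smoothErr w) := h4 ▸ Real.add_one_le_exp _
    -- The point is `1 + d ≤ (1 + 4 d) (1 - d)`, valid for `0 ≤ d ≤ 1/2`.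
    have h6 : (4 * d + 1) * (1 - d) ≤ Real.exp (smoothErr w) * (1 - d) :=
      mul_le_mul_of_nonneg_right h5 (by linarith)
    nlinarith [habs.2]

/-! ## Gaussian sums over cosets of lattices -/

/-- A sum over `ℤ^m` of a product whose `i`-th factor is shifted by a function of the later
coordinates. -/
theorem tsum_triangular_bounds {m : ℕ} (φ : Fin m → ℝ → ℝ≥0∞) (M : Fin m → ℝ≥0∞) (E : ℝ≥0∞)
    (hφ : ∀ i t, M i ≤ ∑' k : ℤ, φ i (k + t) ∧ ∑' k : ℤ, φ i (k + t) ≤ E * M i)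
    (t : Fin m → (Fin m → ℤ) → ℝ) (ht : ∀ i a a', (∀ j, i < j → a j = a' j) → t i a = t i a') :
    ∏ i, M i ≤ ∑' a : Fin m → ℤ, ∏ i, φ i (a i + t i a) ∧
      ∑' a : Fin m → ℤ, ∏ i, φ i (a i + t i a) ≤ E ^ m * ∏ i, M i := by
  induction m with
  | zero => simp
  | succ m ih =>
    -- No other shift depends on coordinate `0`, so it is summed innermost, with the remaining
    -- coordinates fixed.
    have h1 : ∑' a : Fin (m + 1) → ℤ, ∏ i, φ i (a i + t i a) =
        ∑' a : Fin m → ℤ, (∑' k : ℤ, φ 0 (k + t 0 (Fin.cons 0 a))) *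
          ∏ i : Fin m, φ i.succ (a i + t i.succ (Fin.cons 0 a)) := by
      rw [← (Fin.consEquiv fun _ : Fin (m + 1) => ℤ).tsum_eq, ENNReal.tsum_prod',
        ENNReal.tsum_comm]
      refine tsum_congr fun a => ?_
      rw [← ENNReal.tsum_mul_right]
      refine tsum_congr fun k => ?_
      rw [Fin.prod_univ_succ]
      simp only [Fin.consEquiv_apply, Fin.cons_zero, Fin.cons_succ]
      congr 1
      · rw [ht 0 ((Fin.consEquiv fun _ => ℤ) (k, a)) (Fin.cons 0 a)]
        intro j hj
        obtain ⟨j, rfl⟩ := Fin.exists_succ_eq.2 hj.ne'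
        simp
      · refine Finset.prod_congr rfl fun i _ => ?_
        rw [ht i.succ ((Fin.consEquiv fun _ => ℤ) (k, a)) (Fin.cons 0 a)]
        intro j hj
        obtain ⟨j, rfl⟩ := Fin.exists_succ_eq.2 (lt_of_le_of_lt (Fin.zero_le _) hj).ne'
        simp
    have h2 := ih (fun i => φ i.succ) (fun i => M i.succ) (fun i => hφ i.succ)
      (fun i a => t i.succ (Fin.cons 0 a)) (by
        intro i a a' h
        refine ht _ _ _ fun j hj => ?_
        obtain ⟨j, rfl⟩ := Fin.exists_succ_eq.2 (lt_of_le_of_lt (Fin.zero_le _) hj).ne'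
        simpa using h j (Fin.succ_lt_succ_iff.1 hj))
    rw [h1, Fin.prod_univ_succ]
    constructor
    · refine (mul_le_mul_right h2.1 _).trans ?_
      rw [← ENNReal.tsum_mul_left]
      exact ENNReal.tsum_le_tsum fun a => mul_le_mul_left (hφ 0 _).1 _
    · calc _ ≤ ∑' a : Fin m → ℤ, (E * M 0) *
            ∏ i : Fin m, φ i.succ (a i + t i.succ (Fin.cons 0 a)) :=
          ENNReal.tsum_le_tsum fun a => mul_le_mul_left (hφ 0 _).2 _
        _ ≤ (E * M 0) * (E ^ m * ∏ i : Fin m, M i.succ) := by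
          rw [ENNReal.tsum_mul_left]
          exact mul_le_mul_right h2.2 _
        _ = _ := by ring

/-- The Gaussian weight of `z + c`. -/
def shiftWeight {ι : Type} [Fintype ι] (s : ℝ) (c : ι → ℝ) (z : ι → ℤ) : ℝ≥0∞ :=
  ENNReal.ofReal (Real.exp (-Real.pi * (∑ i, (z i + c i) ^ 2) / s ^ 2))

theorem gaussWeight_eq {ι : Type} [Fintype ι] (s : ℝ) (z : ι → ℤ) :
    gaussWeight s z = shiftWeight s 0 z := by
  simp [gaussWeight, shiftWeight]

theorem shiftWeight_eq_prod {ι : Type} [Fintype ι] (s : ℝ) (c : ι → ℝ) (z : ι → ℤ) :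
    shiftWeight s c z = ∏ i, ENNReal.ofReal (Real.exp (-Real.pi * (1 * (z i + c i)) ^ 2 / s ^ 2)) := by
  rw [shiftWeight, ← ENNReal.ofReal_prod_of_nonneg (fun _ _ => (Real.exp_pos _).le),
    ← Real.exp_sum, Finset.mul_sum, Finset.sum_div]
  simp

theorem shiftWeight_sum_elim {ι κ : Type} [Fintype ι] [Fintype κ] (s : ℝ) (c : ι ⊕ κ → ℝ)
    (z : ι → ℤ) (z' : κ → ℤ) : shiftWeight s c (Sum.elim z z') =
      shiftWeight s (c ∘ Sum.inl) z * shiftWeight s (c ∘ Sum.inr) z' := by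
  simp [shiftWeight_eq_prod]

theorem tsum_shiftWeight_le {ι : Type} [Fintype ι] {s w : ℝ} (hw : 1 ≤ w) (h : w ≤ s)
    (c c' : ι → ℝ) : ∑' z : ι → ℤ, shiftWeight s c z ≤
      ENNReal.ofReal (Real.exp (smoothErr w)) ^ Fintype.card ι * ∑' z, shiftWeight s c' z := by
  obtain ⟨M, hMtop, hM⟩ := exists_gauss_line_bounds (b := 1) (s := s) zero_lt_one hw (by simpa using h)
  simp only [shiftWeight_eq_prod]
  rw [tsum_pi_prod (f := fun i (k : ℤ) =>
      ENNReal.ofReal (Real.exp (-Real.pi * (1 * (k + c i)) ^ 2 / s ^ 2))),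
    tsum_pi_prod (f := fun i (k : ℤ) =>
      ENNReal.ofReal (Real.exp (-Real.pi * (1 * (k + c' i)) ^ 2 / s ^ 2))),
    ← Finset.card_univ, ← Finset.prod_const, ← Finset.prod_mul_distrib]
  refine Finset.prod_le_prod' fun i _ => (hM (c i)).2.trans ?_
  exact mul_le_mul_right (hM (c' i)).1 _

theorem tsum_shiftWeight_ne_top {ι : Type} [Fintype ι] {s w : ℝ} (hw : 1 ≤ w) (h : w ≤ s)
    (c : ι → ℝ) : ∑' z : ι → ℤ, shiftWeight s c z ≠ ∞ := by
  simp only [shiftWeight_eq_prod]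
  rw [tsum_pi_prod (f := fun i (k : ℤ) =>
      ENNReal.ofReal (Real.exp (-Real.pi * (1 * (k + c i)) ^ 2 / s ^ 2)))]
  refine ENNReal.prod_ne_top fun i _ => ?_
  obtain ⟨M, hMtop, hM⟩ := exists_gauss_line_bounds (b := 1) (s := s) zero_lt_one hw
    (by simpa using h)
  exact ne_top_of_le_ne_top (ENNReal.mul_ne_top ENNReal.ofReal_ne_top hMtop) (hM (c i)).2

theorem euclCol_linearIndependent {m : ℕ} {T : Matrix (Fin m) (Fin m) ℤ} (hT : T.det ≠ 0) :
    LinearIndependent ℝ (euclCol T) := by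
  have h1 : (T.map (Int.cast : ℤ → ℝ)).det ≠ 0 := by
    have : (T.map (Int.cast : ℤ → ℝ)).det = ((T.det : ℤ) : ℝ) := by
      simpa using (RingHom.map_det (Int.castRingHom ℝ) T).symm
    rw [this]
    exact_mod_cast hT
  have h2 : LinearIndependent ℝ (T.map (Int.cast : ℤ → ℝ)).col :=
    Matrix.linearIndependent_cols_iff_isUnit.2
      ((Matrix.isUnit_iff_isUnit_det _).2 (isUnit_iff_ne_zero.2 h1))
  have h3 := h2.map' (WithLp.linearEquiv 2 ℝ (Fin m → ℝ)).symm.toLinearMap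
    (LinearEquiv.ker _)
  exact h3

/-- In the Gram-Schmidt orthonormal basis, coordinate `i` of `T a + c` is `b i` times `a i` plus a
shift that involves `c` and the later `a j` only. By Parseval the Gaussian weight is a triangular
product, whose factors are sums over lines with spacing `b i` and `b i * w ≤ s`. The shift is
immaterial on each line, so `M` does not depend on `c`. -/
theorem exists_lattice_bounds {m : ℕ} {T : Matrix (Fin m) (Fin m) ℤ} (hT : T.det ≠ 0) {s w : ℝ}
    (hw : 1 ≤ w) (h : ∀ j, ‖InnerProductSpace.gramSchmidt ℝ (euclCol T) j‖ * w ≤ s) :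
    ∃ M : ℝ≥0∞, ∀ c : Fin m → ℝ,
      M ≤ ∑' a : Fin m → ℤ, shiftWeight s c (T *ᵥ a) ∧
      ∑' a : Fin m → ℤ, shiftWeight s c (T *ᵥ a) ≤
        ENNReal.ofReal (Real.exp (smoothErr w)) ^ m * M := by
  have hli := euclCol_linearIndependent hT
  set b : Fin m → ℝ := fun j => ‖InnerProductSpace.gramSchmidt ℝ (euclCol T) j‖ with hb
  have hb0 : ∀ j, 0 < b j := fun j => norm_pos_iff.2 (InnerProductSpace.gramSchmidt_ne_zero j hli)
  choose M hMtop hM using fun j => exists_gauss_line_bounds (hb0 j) hw (h j)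
  refine ⟨∏ i, M i, fun c => ?_⟩
  have hcard : Module.finrank ℝ (EuclideanSpace ℝ (Fin m)) = Fintype.card (Fin m) := by simp
  set e := InnerProductSpace.gramSchmidtOrthonormalBasis hcard (euclCol T) with he
  set C : EuclideanSpace ℝ (Fin m) := WithLp.toLp 2 c with hC
  have hne : ∀ j, InnerProductSpace.gramSchmidtNormed ℝ (euclCol T) j ≠ 0 := by
    intro j h0
    have := InnerProductSpace.gramSchmidtNormed_unit_length j hli
    rw [h0, norm_zero] at this
    exact zero_ne_one this
  have hdiag : ∀ i, inner ℝ (e i) (euclCol T i) = b i := by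
    intro i
    rw [he, InnerProductSpace.gramSchmidtOrthonormalBasis_apply hcard (hne i),
      InnerProductSpace.gramSchmidtNormed, inner_smul_left,
      InnerProductSpace.gramSchmidt_def'' ℝ (euclCol T) i, inner_add_right, inner_sum,
      Finset.sum_eq_zero, add_zero, real_inner_self_eq_norm_sq]
    · simp only [RCLike.ofReal_real_eq_id, id_eq, map_inv₀, conj_trivial]
      change (b i)⁻¹ * b i ^ 2 = b i
      have := (hb0 i).ne'
      field_simp
    · intro j hj
      rw [inner_smul_right, InnerProductSpace.gramSchmidt_orthogonal ℝ (euclCol T)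
        (Finset.mem_Iio.1 hj).ne', mul_zero]
  have hlow : ∀ i j, j < i → inner ℝ (e i) (euclCol T j) = 0 := fun i j hij =>
    InnerProductSpace.gramSchmidtOrthonormalBasis_inv_triangular hcard (euclCol T) hij
  have hmain := tsum_triangular_bounds
    (fun i x => ENNReal.ofReal (Real.exp (-Real.pi * (b i * x) ^ 2 / s ^ 2))) M
    (ENNReal.ofReal (Real.exp (smoothErr w))) hM
    (fun i a => ((∑ j, if i < j then (a j : ℝ) * inner ℝ (e i) (euclCol T j) else 0) +
      inner ℝ (e i) C) / b i) (by
      intro i a a' haa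
      congr 2
      refine Finset.sum_congr rfl fun j _ => ?_
      split_ifs with hij
      · rw [haa j hij]
      · rfl)
  have hkey : ∀ a : Fin m → ℤ, shiftWeight s c (T *ᵥ a) =
      ∏ i, ENNReal.ofReal (Real.exp (-Real.pi * (b i * (a i +
        ((∑ j, if i < j then (a j : ℝ) * inner ℝ (e i) (euclCol T j) else 0) +
      inner ℝ (e i) C) / b i)) ^ 2 / s ^ 2)) := by
    intro a
    rw [shiftWeight, ← ENNReal.ofReal_prod_of_nonneg (fun _ _ => (Real.exp_pos _).le),
      ← Real.exp_sum, ← Finset.sum_div, ← Finset.mul_sum]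
    congr 4
    set v : EuclideanSpace ℝ (Fin m) := (∑ j, (a j : ℝ) • euclCol T j) + C with hv
    have hvn : ‖v‖ ^ 2 = ∑ i, (((T *ᵥ a) i : ℤ) + c i : ℝ) ^ 2 := by
      rw [EuclideanSpace.norm_sq_eq]
      refine Finset.sum_congr rfl fun i _ => ?_
      rw [Real.norm_eq_abs, sq_abs]
      congr 1
      simp only [hv, hC, PiLp.add_apply, WithLp.ofLp_sum, Finset.sum_apply,
        euclCol, smul_eq_mul, Matrix.mulVec, dotProduct, WithLp.ofLp_smul, Pi.smul_apply]
      push_cast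
      congr 1
      exact Finset.sum_congr rfl fun j _ => mul_comm _ _
    rw [← hvn, ← e.sum_sq_norm_inner_right v]
    refine Finset.sum_congr rfl fun i _ => ?_
    rw [Real.norm_eq_abs, sq_abs]
    congr 1
    rw [mul_add, mul_div_cancel₀ _ (hb0 i).ne', hv, inner_add_right, inner_sum, ← add_assoc]
    congr 1
    rw [← Finset.add_sum_erase _ _ (Finset.mem_univ i), inner_smul_right, hdiag, mul_comm]
    congr 1
    rw [← Finset.add_sum_erase _ _ (Finset.mem_univ i), if_neg (lt_irrefl i), zero_add]
    refine Finset.sum_congr rfl fun j hj => ?_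
    rw [inner_smul_right]
    split_ifs with hij
    · rfl
    · rw [hlow i j (lt_of_le_of_ne (not_lt.1 hij) (Finset.ne_of_mem_erase hj)), mul_zero]
  rw [tsum_congr hkey]
  exact hmain

/-! ## Gaussian sums over cosets of `q`-ary lattices -/

section Coset

variable {q n m : ℕ}

theorem vecModQ_add {ι : Type} (z z' : ι → ℤ) :
    vecModQ q (z + z') = vecModQ q z + vecModQ q z' := by
  ext i
  simp [vecModQ]

theorem vecModQ_sum_elim {ι κ : Type} (z : ι → ℤ) (z' : κ → ℤ) :
    vecModQ q (Sum.elim z z') = Sum.elim (vecModQ q z) (vecModQ q z') := by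
  ext i
  cases i <;> rfl

variable {ι κ : Type} [Fintype ι] [Fintype κ]

/-- The Gaussian sum over a coset of a `q`-ary lattice, shifted by `c`. -/
def cosetSum (F : Matrix (Fin n) ι (ZMod q)) (u : Fin n → ZMod q) (s : ℝ) (c : ι → ℝ) : ℝ≥0∞ :=
  ∑' z, (latCoset F u).indicator (shiftWeight s c) z

/-- All shifts of all cosets have the same Gaussian sum, up to a factor `R`. -/
def IsSmooth (F : Matrix (Fin n) ι (ZMod q)) (s : ℝ) (R : ℝ≥0∞) : Prop :=
  ∀ u u' c c', cosetSum F u s c ≤ R * cosetSum F u' s c'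

theorem exists_mem_latCoset [NeZero q] {F : Matrix (Fin n) (Fin m) (ZMod q)} (hF : FullRank F)
    (u : Fin n → ZMod q) : ∃ z, z ∈ latCoset F u := by
  obtain ⟨v, hv⟩ := hF u
  refine ⟨fun i => ((v i).val : ℤ), ?_⟩
  have : vecModQ q (fun i => ((v i).val : ℤ)) = v := by
    ext i
    simp [vecModQ]
  change F *ᵥ vecModQ q _ = u
  rw [this]
  exact hv

/-- Translation by `z₀` trades a syndrome for a displacement of the centre. Smoothness therefore
needs a proof for the zero syndrome only, provided that all shifts are allowed. -/
theorem cosetSum_add {F : Matrix (Fin n) ι (ZMod q)} {u v : Fin n → ZMod q} {z₀ : ι → ℤ}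
    (hz : z₀ ∈ latCoset F v) (s : ℝ) (c : ι → ℝ) :
    cosetSum F (u + v) s c = cosetSum F u s (fun i => z₀ i + c i) := by
  rw [cosetSum, ← (Equiv.addRight z₀).tsum_eq]
  refine tsum_congr fun z => ?_
  have h1 : z + z₀ ∈ latCoset F (u + v) ↔ z ∈ latCoset F u := by
    change F *ᵥ _ = _ ↔ F *ᵥ _ = _
    rw [vecModQ_add, Matrix.mulVec_add, show F *ᵥ vecModQ q z₀ = v from hz, add_left_inj]
  have h2 : shiftWeight s c (z + z₀) = shiftWeight s (fun i => z₀ i + c i) z := by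
    simp [shiftWeight, add_assoc]
  simp only [Equiv.coe_addRight]
  by_cases h : z ∈ latCoset F u
  · rw [Set.indicator_of_mem h, Set.indicator_of_mem (h1.2 h), h2]
  · rw [Set.indicator_of_notMem h, Set.indicator_of_notMem (fun h' => h (h1.1 h'))]

/-- The columns of `T` need to be independent vectors of the lattice, not a basis of it: the lattice
is a union of cosets of the sublattice they span, and each of these has the same sum up to the
factor. For the gadget matrix this makes the basis property unnecessary. -/
theorem isSmooth_of_gramSchmidt [NeZero q] {F : Matrix (Fin n) (Fin m) (ZMod q)} (hF : FullRank F)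
    {T : Matrix (Fin m) (Fin m) ℤ} (hT : T.det ≠ 0) (hTF : ∀ a, T *ᵥ a ∈ latCoset F 0) {s w : ℝ}
    (hw : 1 ≤ w) (h : ∀ j, ‖InnerProductSpace.gramSchmidt ℝ (euclCol T) j‖ * w ≤ s) :
    IsSmooth F s (ENNReal.ofReal (Real.exp (smoothErr w)) ^ m) := by
  classical
  obtain ⟨M, hM⟩ := exists_lattice_bounds hT hw h
  set f : (Fin m → ℤ) →+ (Fin m → ℤ) := T.mulVecLin.toAddMonoidHom with hf
  have hfa : ∀ a, f a = T *ᵥ a := fun a => rfl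
  have hinj : ∀ a b, f a = f b → a = b := by
    intro a b hab
    refine sub_eq_zero.1 (Matrix.eq_zero_of_mulVec_eq_zero hT ?_)
    rw [Matrix.mulVec_sub, ← hfa, ← hfa, hab, sub_self]
  -- Representatives of the cosets of the sublattice together with its elements parametrize `ℤ^m`.
  have hbij : Function.Bijective fun p : ((Fin m → ℤ) ⧸ f.range) × (Fin m → ℤ) =>
      p.1.out + f p.2 := by
    have hmk : ∀ (ξ : (Fin m → ℤ) ⧸ f.range) a,
        ((ξ.out + f a : Fin m → ℤ) : (Fin m → ℤ) ⧸ f.range) = ξ := fun ξ a => by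
      rw [QuotientAddGroup.mk_add_of_mem _ (AddMonoidHom.mem_range.2 ⟨a, rfl⟩)]
      exact Quotient.out_eq ξ
    constructor
    · rintro ⟨ξ, a⟩ ⟨ξ', a'⟩ h
      have h' : ξ.out + f a = ξ'.out + f a' := h
      have h1 : ξ = ξ' := by rw [← hmk ξ a, h', hmk]
      subst h1
      rw [hinj a a' (add_left_cancel h')]
    · intro z
      have h1 : ((((z : (Fin m → ℤ) ⧸ f.range)).out : Fin m → ℤ) : (Fin m → ℤ) ⧸ f.range) = z :=
        Quotient.out_eq _
      obtain ⟨a, ha⟩ := QuotientAddGroup.eq.1 h1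
      exact ⟨(z, a), by simp [ha]⟩
  have key : ∀ c, cosetSum F 0 s c = ∑' ξ : (Fin m → ℤ) ⧸ f.range,
      (if ξ.out ∈ latCoset F 0 then 1 else 0) *
        ∑' a, shiftWeight s (fun i => ξ.out i + c i) (T *ᵥ a) := by
    intro c
    rw [cosetSum, ← (Equiv.ofBijective _ hbij).tsum_eq, ENNReal.tsum_prod']
    refine tsum_congr fun ξ => ?_
    rw [← ENNReal.tsum_mul_left]
    refine tsum_congr fun a => ?_
    have h0 : Equiv.ofBijective _ hbij (ξ, a) = ξ.out + T *ᵥ a := rfl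
    have h1 : ξ.out + T *ᵥ a ∈ latCoset F 0 ↔ ξ.out ∈ latCoset F 0 := by
      change F *ᵥ _ = _ ↔ F *ᵥ _ = _
      rw [vecModQ_add, Matrix.mulVec_add, show F *ᵥ vecModQ q (T *ᵥ a) = 0 from hTF a, add_zero]
    have h2 : shiftWeight s c (ξ.out + T *ᵥ a) =
        shiftWeight s (fun i => ξ.out i + c i) (T *ᵥ a) := by
      rw [add_comm]
      simp [shiftWeight, add_assoc]
    rw [h0]
    by_cases h3 : ξ.out ∈ latCoset F 0
    · rw [Set.indicator_of_mem (h1.2 h3), if_pos h3, one_mul, h2]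
    · rw [Set.indicator_of_notMem (fun h' => h3 (h1.1 h')), if_neg h3, zero_mul]
  have h0 : ∀ c c', cosetSum F 0 s c ≤
      ENNReal.ofReal (Real.exp (smoothErr w)) ^ m * cosetSum F 0 s c' := by
    intro c c'
    rw [key, key, ← ENNReal.tsum_mul_left]
    refine ENNReal.tsum_le_tsum fun ξ => ?_
    rw [mul_left_comm]
    refine mul_le_mul_right ((hM _).2.trans ?_) _
    exact mul_le_mul_right (hM _).1 _
  intro u u' c c'
  obtain ⟨z, hz⟩ := exists_mem_latCoset hF u
  obtain ⟨z', hz'⟩ := exists_mem_latCoset hF u'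
  rw [← zero_add u, ← zero_add u', cosetSum_add hz, cosetSum_add hz']
  exact h0 _ _

/-- Summation over the fibres of the second block: with `z'` fixed, the first block runs through a
coset of the lattice of `A`. -/
theorem tsum_fromCols_indicator (A : Matrix (Fin n) ι (ZMod q)) (M : Matrix (Fin n) κ (ZMod q))
    (u : Fin n → ZMod q) (s : ℝ) (c : ι ⊕ κ → ℝ) (S : Set (κ → ℤ)) :
    ∑' z, (latCoset (Matrix.fromCols A M) u ∩ {z | z ∘ Sum.inr ∈ S}).indicator (shiftWeight s c) z =
      ∑' z' : κ → ℤ, S.indicator (shiftWeight s (c ∘ Sum.inr)) z' *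
        cosetSum A (u - M *ᵥ vecModQ q z') s (c ∘ Sum.inl) := by
  rw [← (Equiv.sumArrowEquivProdArrow ι κ ℤ).symm.tsum_eq, ENNReal.tsum_prod', ENNReal.tsum_comm]
  refine tsum_congr fun z' => ?_
  rw [cosetSum, ← ENNReal.tsum_mul_left]
  refine tsum_congr fun z => ?_
  have h0 : (Equiv.sumArrowEquivProdArrow ι κ ℤ).symm (z, z') = Sum.elim z z' := rfl
  rw [h0]
  have h1 : Sum.elim z z' ∈ latCoset (Matrix.fromCols A M) u ↔
      z ∈ latCoset A (u - M *ᵥ vecModQ q z') := by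
    change _ = _ ↔ _ = _
    rw [vecModQ_sum_elim, Matrix.fromCols_mulVec_sumElim, eq_sub_iff_add_eq]
  have h2 : Sum.elim z z' ∈ {z : ι ⊕ κ → ℤ | z ∘ Sum.inr ∈ S} ↔ z' ∈ S := by
    change Sum.elim z z' ∘ Sum.inr ∈ S ↔ z' ∈ S
    rw [Sum.elim_comp_inr]
  by_cases h3 : z' ∈ S
  · by_cases h4 : z ∈ latCoset A (u - M *ᵥ vecModQ q z')
    · rw [Set.indicator_of_mem (Set.mem_inter (h1.2 h4) (h2.2 h3)), Set.indicator_of_mem h3,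
        Set.indicator_of_mem h4, shiftWeight_sum_elim, mul_comm]
    · rw [Set.indicator_of_notMem (fun h => h4 (h1.1 h.1)), Set.indicator_of_notMem h4, mul_zero]
  · rw [Set.indicator_of_notMem (fun h => h3 (h2.1 h.2)), Set.indicator_of_notMem h3, zero_mul]

theorem cosetSum_fromCols (A : Matrix (Fin n) ι (ZMod q)) (M : Matrix (Fin n) κ (ZMod q))
    (u : Fin n → ZMod q) (s : ℝ) (c : ι ⊕ κ → ℝ) :
    cosetSum (Matrix.fromCols A M) u s c = ∑' z' : κ → ℤ, shiftWeight s (c ∘ Sum.inr) z' *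
        cosetSum A (u - M *ᵥ vecModQ q z') s (c ∘ Sum.inl) := by
  have h := tsum_fromCols_indicator A M u s c Set.univ
  simpa [cosetSum] using h

/-- Smoothness of `A` removes the dependence of the inner sum on `z'`, whatever `M` is; a Gaussian
sum over all of `ℤ^κ` is left. The factor `R` occurs twice, for passing to a reference coset of `A`
and back. -/
theorem IsSmooth.fromCols {A : Matrix (Fin n) ι (ZMod q)} {s w : ℝ} {R : ℝ≥0∞}
    (hA : IsSmooth A s R) (hw : 1 ≤ w) (hs : w ≤ s) (M : Matrix (Fin n) κ (ZMod q)) :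
    IsSmooth (Matrix.fromCols A M) s
      (R * R * ENNReal.ofReal (Real.exp (smoothErr w)) ^ Fintype.card κ) := by
  intro u u' c c'
  rw [cosetSum_fromCols, cosetSum_fromCols]
  calc _ ≤ ∑' z' : κ → ℤ, shiftWeight s (c ∘ Sum.inr) z' * (R * cosetSum A 0 s 0) :=
        ENNReal.tsum_le_tsum fun z => mul_le_mul_right (hA _ _ _ _) _
    _ ≤ (ENNReal.ofReal (Real.exp (smoothErr w)) ^ Fintype.card κ *
          ∑' z' : κ → ℤ, shiftWeight s (c' ∘ Sum.inr) z') * (R * cosetSum A 0 s 0) := by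
        rw [ENNReal.tsum_mul_right]
        exact mul_le_mul_left (tsum_shiftWeight_le hw hs _ _) _
    _ = R * ENNReal.ofReal (Real.exp (smoothErr w)) ^ Fintype.card κ *
          ∑' z' : κ → ℤ, shiftWeight s (c' ∘ Sum.inr) z' * cosetSum A 0 s 0 := by
        rw [ENNReal.tsum_mul_right]
        ring
    _ ≤ R * ENNReal.ofReal (Real.exp (smoothErr w)) ^ Fintype.card κ *
          ∑' z' : κ → ℤ, shiftWeight s (c' ∘ Sum.inr) z' *
            (R * cosetSum A (u' - M *ᵥ vecModQ q z') s (c' ∘ Sum.inl)) :=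
        mul_le_mul_right (ENNReal.tsum_le_tsum fun z => mul_le_mul_right (hA _ _ _ _) _) _
    _ = _ := by
        simp only [mul_left_comm _ R, ENNReal.tsum_mul_left]
        ring

theorem FullRank.fromCols {A : Matrix (Fin n) (Fin m) (ZMod q)} (hA : FullRank A) [NeZero q]
    (M : Matrix (Fin n) κ (ZMod q)) (u : Fin n → ZMod q) :
    ∃ z, z ∈ latCoset (Matrix.fromCols A M) u := by
  obtain ⟨z, hz⟩ := exists_mem_latCoset hA u
  refine ⟨Sum.elim z 0, ?_⟩
  change _ = _
  have h0 : vecModQ q (0 : κ → ℤ) = 0 := by ext; simp [vecModQ]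
  rw [vecModQ_sum_elim, Matrix.fromCols_mulVec_sumElim, h0, Matrix.mulVec_zero, add_zero]
  exact hz

/-! ## The discrete Gaussian -/

theorem shiftWeight_ne_zero (s : ℝ) (c : ι → ℝ) (z : ι → ℤ) : shiftWeight s c z ≠ 0 := by
  rw [shiftWeight]
  exact (ENNReal.ofReal_pos.2 (Real.exp_pos _)).ne'

theorem cosetSum_ne_zero {F : Matrix (Fin n) ι (ZMod q)} {u : Fin n → ZMod q}
    (h : ∃ z, z ∈ latCoset F u) (s : ℝ) (c : ι → ℝ) : cosetSum F u s c ≠ 0 := by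
  obtain ⟨z, hz⟩ := h
  intro h0
  have := ENNReal.tsum_eq_zero.1 h0 z
  rw [Set.indicator_of_mem hz] at this
  exact shiftWeight_ne_zero s c z this

theorem cosetSum_ne_top {F : Matrix (Fin n) ι (ZMod q)} {u : Fin n → ZMod q} {s w : ℝ}
    (hw : 1 ≤ w) (hs : w ≤ s) (c : ι → ℝ) : cosetSum F u s c ≠ ∞ :=
  ne_top_of_le_ne_top (tsum_shiftWeight_ne_top hw hs c)
    (ENNReal.tsum_le_tsum fun _ => Set.indicator_le_self _ _ _)

theorem gaussMass_eq (F : Matrix (Fin n) ι (ZMod q)) (u : Fin n → ZMod q) (s : ℝ) (z : ι → ℤ) :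
    gaussMass F u s z = (latCoset F u).indicator (shiftWeight s 0) z / cosetSum F u s 0 := by
  have h : ∑' z' : latCoset F u, gaussWeight s z'.1 = cosetSum F u s 0 := by
    rw [tsum_subtype (latCoset F u) (fun z => gaussWeight s z), cosetSum]
    exact tsum_congr fun z => by simp only [gaussWeight_eq]
  rw [gaussMass, h, gaussWeight_eq]
  by_cases hz : z ∈ latCoset F u
  · rw [if_pos hz, Set.indicator_of_mem hz]
  · rw [if_neg hz, Set.indicator_of_notMem hz, ENNReal.zero_div]

theorem exists_gaussPMF {F : Matrix (Fin n) ι (ZMod q)} {u : Fin n → ZMod q} {s w : ℝ}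
    (hw : 1 ≤ w) (hs : w ≤ s) (h : ∃ z, z ∈ latCoset F u) :
    ∃ g : PMF (ι → ℤ), ⇑g = gaussMass F u s := by
  refine ⟨⟨gaussMass F u s, ?_⟩, rfl⟩
  have h1 : ∑' z, gaussMass F u s z = 1 := by
    simp only [gaussMass_eq, div_eq_mul_inv]
    rw [ENNReal.tsum_mul_right]
    exact ENNReal.mul_inv_cancel (cosetSum_ne_zero h s 0) (cosetSum_ne_top hw hs 0)
  exact h1 ▸ ENNReal.summable.hasSum

theorem gaussPMF_apply {F : Matrix (Fin n) ι (ZMod q)} {u : Fin n → ZMod q} {s : ℝ}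
    {g : PMF (ι → ℤ)} (hg : ⇑g = gaussMass F u s) (S : Set (ι → ℤ)) :
    g.toOuterMeasure S =
      (∑' z, (latCoset F u ∩ S).indicator (shiftWeight s 0) z) / cosetSum F u s 0 := by
  rw [PMF.toOuterMeasure_apply, div_eq_mul_inv, ← ENNReal.tsum_mul_right]
  refine tsum_congr fun z => ?_
  by_cases hz : z ∈ S
  · rw [Set.indicator_of_mem hz, hg, gaussMass_eq, div_eq_mul_inv, Set.inter_comm,
      ← Set.indicator_indicator, Set.indicator_of_mem hz]
  · rw [Set.indicator_of_notMem hz, Set.indicator_of_notMem (fun h => hz h.2), zero_mul]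

theorem prob_gauss_notMem {F : Matrix (Fin n) ι (ZMod q)} {u : Fin n → ZMod q} {s : ℝ}
    {g : PMF (ι → ℤ)} (hg : ⇑g = gaussMass F u s) : prob g (latCoset F u)ᶜ = 0 := by
  rw [prob, gaussPMF_apply hg, Set.inter_compl_self]
  simp

/-- The moment generating function of a discrete Gaussian. -/
theorem tsum_gauss_mul_exp_le {F : Matrix (Fin n) ι (ZMod q)} {u : Fin n → ZMod q} {s : ℝ}
    {R : ℝ} (hF : IsSmooth F s (ENNReal.ofReal R)) (hs : 0 < s) (hR : 0 ≤ R)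
    (hne : cosetSum F u s 0 ≠ 0)
    (hnt : cosetSum F u s 0 ≠ ∞) {g : PMF (ι → ℤ)} (hg : ⇑g = gaussMass F u s) (v : ι → ℝ)
    (l : ℝ) : ∑' z, g z * ENNReal.ofReal (Real.exp (l * ∑ i, z i * v i)) ≤
      ENNReal.ofReal (R * Real.exp (l ^ 2 * (s ^ 2 * ∑ i, v i ^ 2))) := by
  -- Completing the square in `-π ‖z‖² / s² + l ⟨z, v⟩` displaces the centre by `l s² / (2π)` times
  -- `v` and leaves the constant `b`. Smoothness then compares the displaced sum with the centred
  -- one.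
  set c : ι → ℝ := fun i => -(l * s ^ 2 / (2 * Real.pi)) * v i with hc
  have hpi := Real.pi_pos
  set b : ℝ := l ^ 2 * s ^ 2 / (4 * Real.pi) * ∑ i, v i ^ 2 with hb
  have hble : b ≤ l ^ 2 * (s ^ 2 * ∑ i, v i ^ 2) := by
    rw [hb, ← mul_assoc]
    refine mul_le_mul_of_nonneg_right ?_ (Finset.sum_nonneg fun i _ => sq_nonneg _)
    refine div_le_self (by positivity) ?_
    linarith [Real.pi_gt_three]
  have hz : ∀ z : ι → ℤ, shiftWeight s 0 z * ENNReal.ofReal (Real.exp (l * ∑ i, z i * v i)) =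
      ENNReal.ofReal (Real.exp b) * shiftWeight s c z := by
    intro z
    rw [shiftWeight, shiftWeight, ← ENNReal.ofReal_mul (Real.exp_pos _).le,
      ← ENNReal.ofReal_mul (Real.exp_pos _).le, ← Real.exp_add, ← Real.exp_add]
    congr 2
    rw [hb, Finset.mul_sum, Finset.mul_sum, Finset.mul_sum, Finset.mul_sum, Finset.sum_div,
      Finset.sum_div, ← Finset.sum_add_distrib, ← Finset.sum_add_distrib]
    refine Finset.sum_congr rfl fun i _ => ?_
    simp only [hc, Pi.zero_apply, add_zero]
    field_simp
    ring
  calc ∑' z, g z * ENNReal.ofReal (Real.exp (l * ∑ i, z i * v i))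
      = ∑' z, ENNReal.ofReal (Real.exp b) * ((latCoset F u).indicator (shiftWeight s c) z) *
          (cosetSum F u s 0)⁻¹ := by
        refine tsum_congr fun z => ?_
        rw [hg, gaussMass_eq, div_eq_mul_inv, mul_right_comm]
        congr 1
        by_cases hz' : z ∈ latCoset F u
        · rw [Set.indicator_of_mem hz', Set.indicator_of_mem hz', hz]
        · rw [Set.indicator_of_notMem hz', Set.indicator_of_notMem hz', zero_mul, mul_zero]
    _ = ENNReal.ofReal (Real.exp b) * cosetSum F u s c * (cosetSum F u s 0)⁻¹ := by
        rw [ENNReal.tsum_mul_right, ENNReal.tsum_mul_left]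
        rfl
    _ ≤ ENNReal.ofReal (Real.exp b) * (ENNReal.ofReal R * cosetSum F u s 0) *
          (cosetSum F u s 0)⁻¹ :=
        mul_le_mul_left (mul_le_mul_right (hF _ _ _ _) _) _
    _ = ENNReal.ofReal (R * Real.exp b) := by
        rw [mul_assoc, mul_assoc, ENNReal.mul_inv_cancel hne hnt, mul_one,
          ← ENNReal.ofReal_mul (Real.exp_pos _).le, mul_comm]
    _ ≤ _ := ENNReal.ofReal_le_ofReal
        (mul_le_mul_of_nonneg_left (Real.exp_le_exp.2 hble) hR)

/-- The syndrome of the middle block of a Gaussian preimage is nearly uniform. -/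
theorem prob_gauss_middle_le {A : Matrix (Fin n) ι (ZMod q)} {M : Matrix (Fin n) (κ ⊕ κ) (ZMod q)}
    {G : Matrix (Fin n) κ (ZMod q)} [NeZero q] {u : Fin n → ZMod q} {s R R' : ℝ}
    (hA : IsSmooth A s (ENNReal.ofReal R)) (hG : IsSmooth G s (ENNReal.ofReal R'))
    (hR : 0 ≤ R) (hR' : 0 ≤ R') {g : PMF (ι ⊕ (κ ⊕ κ) → ℤ)}
    (hg : ⇑g = gaussMass (Matrix.fromCols A M) u s) (f : (κ → ℤ) → (Fin n → ZMod q))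
    (T : Finset (Fin n → ZMod q)) :
    prob g {z | G *ᵥ vecModQ q (fun i => z (Sum.inr (Sum.inl i))) +
      f (fun i => z (Sum.inr (Sum.inr i))) ∈ T} ≤
        R * R * R' * (T.card / (q : ℝ) ^ n) := by
  classical
  have hq : (0 : ℝ) < (q : ℝ) ^ n := pow_pos (Nat.cast_pos.2 (NeZero.pos q)) _
  rw [prob_le_iff (by positivity), gaussPMF_apply hg]
  set S : Set (κ ⊕ κ → ℤ) :=
    {z | G *ᵥ vecModQ q (z ∘ Sum.inl) + f (z ∘ Sum.inr) ∈ T} with hS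
  have hset : {z : ι ⊕ (κ ⊕ κ) → ℤ | G *ᵥ vecModQ q (fun i => z (Sum.inr (Sum.inl i))) +
      f (fun i => z (Sum.inr (Sum.inr i))) ∈ T} = {z | z ∘ Sum.inr ∈ S} := rfl
  rw [hset, tsum_fromCols_indicator]
  set W := ∑' z : κ → ℤ, shiftWeight s (0 : κ → ℝ) z with hW
  set X := cosetSum A 0 s 0 with hX
  set ρ := ENNReal.ofReal (T.card / (q : ℝ) ^ n) with hρ
  -- The cosets of the lattice of `G` partition `ℤ^κ`. As their sums agree up to `R'`, each has at
  -- most the share `R' / q^n` of the total.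
  have hWsum : ∑ v, cosetSum G v s 0 = W := by
    simp only [cosetSum]
    refine Eq.trans (Summable.tsum_finsetSum (L := .unconditional _)
      fun v _ => ENNReal.summable).symm (tsum_congr fun z => ?_)
    rw [Finset.sum_eq_single (G *ᵥ vecModQ q z)]
    · exact Set.indicator_of_mem (show z ∈ latCoset G (G *ᵥ vecModQ q z) from rfl) _
    · intro v _ hv
      exact Set.indicator_of_notMem (show z ∉ latCoset G v from fun h => hv h.symm) _
    · simp
  have hpart : ∀ z₃ : κ → ℤ, ∑' z₂ : κ → ℤ,
      (if G *ᵥ vecModQ q z₂ + f z₃ ∈ T then shiftWeight s (0 : κ → ℝ) z₂ else 0) ≤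
        ENNReal.ofReal R' * ρ * W := by
    intro z₃
    have h1 : ∑' z₂ : κ → ℤ,
      (if G *ᵥ vecModQ q z₂ + f z₃ ∈ T then shiftWeight s (0 : κ → ℝ) z₂ else 0) =
        ∑ v ∈ T, cosetSum G (v - f z₃) s 0 := by
      simp only [cosetSum]
      refine Eq.trans (tsum_congr fun z => ?_)
        (Summable.tsum_finsetSum fun v _ => ENNReal.summable)
      have h2 : ∀ v, z ∈ latCoset G (v - f z₃) ↔ G *ᵥ vecModQ q z + f z₃ = v := fun v => by
        change _ = _ ↔ _
        rw [eq_sub_iff_add_eq]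
      simp only [Set.indicator_apply, h2, Finset.sum_ite_eq]
    have h3 : ∀ v ∈ T, cosetSum G (v - f z₃) s 0 * ((q : ℝ≥0∞) ^ n) ≤ ENNReal.ofReal R' * W := by
      intro v _
      have h4 : cosetSum G (v - f z₃) s 0 * ((q : ℝ≥0∞) ^ n) =
          ∑ _v' : Fin n → ZMod q, cosetSum G (v - f z₃) s 0 := by
        rw [Finset.sum_const, nsmul_eq_mul, Finset.card_univ, Fintype.card_pi]
        simp [ZMod.card, mul_comm]
      rw [h4, ← hWsum, Finset.mul_sum]
      exact Finset.sum_le_sum fun v' _ => hG _ _ _ _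
    have hqn : ((q : ℝ≥0∞) ^ n) = ENNReal.ofReal ((q : ℝ) ^ n) := by
      rw [ENNReal.ofReal_pow (Nat.cast_nonneg _), ENNReal.ofReal_natCast]
    rw [h1]
    calc ∑ v ∈ T, cosetSum G (v - f z₃) s 0
        ≤ ∑ v ∈ T, ENNReal.ofReal R' * W / ((q : ℝ≥0∞) ^ n) := by
          refine Finset.sum_le_sum fun v hv => ?_
          rw [ENNReal.le_div_iff_mul_le]
          · exact h3 v hv
          · exact Or.inl (by rw [hqn]; exact (ENNReal.ofReal_pos.2 hq).ne')
          · exact Or.inl (by rw [hqn]; exact ENNReal.ofReal_ne_top)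
      _ = _ := by
          rw [Finset.sum_const, nsmul_eq_mul, hρ, ENNReal.ofReal_div_of_pos hq, ← hqn,
            ENNReal.ofReal_natCast, div_eq_mul_inv, div_eq_mul_inv]
          ring
  have hsplit : ∀ h : (κ → ℤ) → (κ → ℤ) → ℝ≥0∞, ∑' z : κ ⊕ κ → ℤ,
      h (z ∘ Sum.inl) (z ∘ Sum.inr) = ∑' z₃, ∑' z₂, h z₂ z₃ := by
    intro h
    rw [← (Equiv.sumArrowEquivProdArrow κ κ ℤ).symm.tsum_eq, ENNReal.tsum_prod', ENNReal.tsum_comm]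
    rfl
  have hprod : ∀ z : κ ⊕ κ → ℤ, shiftWeight s (0 : κ ⊕ κ → ℝ) z =
      shiftWeight s (0 : κ → ℝ) (z ∘ Sum.inl) * shiftWeight s (0 : κ → ℝ) (z ∘ Sum.inr) := by
    intro z
    have := shiftWeight_sum_elim s (0 : κ ⊕ κ → ℝ) (z ∘ Sum.inl) (z ∘ Sum.inr)
    rw [Sum.elim_comp_inl_inr] at this
    exact this
  -- Replacing the inner sum over the lattice of `A` by the constant `X` costs one factor `R` here
  -- and a second one in the denominator.
  have hnum : ∑' z' : κ ⊕ κ → ℤ, S.indicator (shiftWeight s ((0 : ι ⊕ (κ ⊕ κ) → ℝ) ∘ Sum.inr)) z' *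
        cosetSum A (u - M *ᵥ vecModQ q z') s ((0 : ι ⊕ (κ ⊕ κ) → ℝ) ∘ Sum.inl) ≤
      (ENNReal.ofReal R * X) * (ENNReal.ofReal R' * ρ * W * W) := by
    calc _ ≤ ∑' z' : κ ⊕ κ → ℤ, (ENNReal.ofReal R * X) *
          ((fun z₂ z₃ => (if G *ᵥ vecModQ q z₂ + f z₃ ∈ T then shiftWeight s (0 : κ → ℝ) z₂ else 0) *
            shiftWeight s (0 : κ → ℝ) z₃) (z' ∘ Sum.inl) (z' ∘ Sum.inr)) := by
          refine ENNReal.tsum_le_tsum fun z' => ?_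
          rw [mul_comm]
          refine mul_le_mul' (hA _ _ _ _) ?_
          by_cases hz : z' ∈ S
          · rw [Set.indicator_of_mem hz]
            have hz' : G *ᵥ vecModQ q (z' ∘ Sum.inl) + f (z' ∘ Sum.inr) ∈ T := hz
            simp only [if_pos hz']
            exact (hprod z').le
          · rw [Set.indicator_of_notMem hz]
            exact zero_le
      _ ≤ _ := by
          rw [ENNReal.tsum_mul_left, hsplit (fun z₂ z₃ =>
            (if G *ᵥ vecModQ q z₂ + f z₃ ∈ T then shiftWeight s (0 : κ → ℝ) z₂ else 0) *
              shiftWeight s (0 : κ → ℝ) z₃)]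
          refine mul_le_mul_right ?_ _
          simp only [ENNReal.tsum_mul_right]
          calc _ ≤ ∑' z₃ : κ → ℤ, (ENNReal.ofReal R' * ρ * W) * shiftWeight s (0 : κ → ℝ) z₃ :=
                ENNReal.tsum_le_tsum fun z₃ => mul_le_mul_left (hpart z₃) _
            _ = _ := by rw [ENNReal.tsum_mul_left]
  have hden : X * (W * W) ≤ ENNReal.ofReal R * cosetSum (Matrix.fromCols A M) u s 0 := by
    have h5 : W * W = ∑' z' : κ ⊕ κ → ℤ, shiftWeight s (0 : κ ⊕ κ → ℝ) z' := by
      simp only [hprod]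
      rw [hsplit (fun a b => shiftWeight s (0 : κ → ℝ) a * shiftWeight s (0 : κ → ℝ) b)]
      simp only [ENNReal.tsum_mul_right, ENNReal.tsum_mul_left]
      rfl
    rw [h5, ← ENNReal.tsum_mul_left, cosetSum_fromCols, ← ENNReal.tsum_mul_left]
    refine ENNReal.tsum_le_tsum fun z => ?_
    rw [mul_comm, mul_left_comm]
    exact mul_le_mul_right (hA _ _ _ _) _
  refine ENNReal.div_le_of_le_mul (hnum.trans ?_)
  calc _ = ENNReal.ofReal R * ENNReal.ofReal R' * ρ * (X * (W * W)) := by ring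
    _ ≤ ENNReal.ofReal R * ENNReal.ofReal R' * ρ *
        (ENNReal.ofReal R * cosetSum (Matrix.fromCols A M) u s 0) := mul_le_mul_right hden _
    _ = _ := by
      rw [ENNReal.ofReal_mul (by positivity), ENNReal.ofReal_mul (by positivity),
        ENNReal.ofReal_mul hR]
      ring

end Coset

/-! ## The gadget matrix -/

section Gadget

variable {n m q : ℕ}

theorem block_lt {K : ℕ} (hm : n * K ≤ m) (i : Fin n) (k : Fin K) : i.val * K + k.val < m := by
  have h1 : (i.val + 1) * K ≤ n * K := Nat.mul_le_mul_right _ i.isLt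
  rw [add_mul, one_mul] at h1
  have := k.isLt
  omega

/-- Sums over one block of indices. -/
theorem sum_block {R : Type} [AddCommMonoid R] {K : ℕ} (hK : 0 < K) (hm : n * K ≤ m) (i : Fin n)
    (f : Fin m → R) : ∑ j : Fin m, (if j.val / K = i.val then f j else 0) =
      ∑ k : Fin K, f ⟨i.val * K + k.val, block_lt hm i k⟩ := by
  symm
  refine Finset.sum_of_injOn (fun k : Fin K => (⟨i.val * K + k.val, block_lt hm i k⟩ : Fin m))
    ?_ ?_ ?_ ?_
  · intro a _ b _ hab
    simpa [Fin.ext_iff] using hab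
  · intro a _
    simp
  · intro j _ hj
    rw [if_neg]
    intro hji
    refine hj ⟨⟨j.val % K, Nat.mod_lt _ hK⟩, by simp, ?_⟩
    refine Fin.ext ?_
    change i.val * K + j.val % K = j.val
    rw [← hji, mul_comm]
    exact Nat.div_add_mod _ _
  · intro k _
    rw [if_pos]
    change (i.val * K + k.val) / K = i.val
    rw [mul_comm, Nat.mul_add_div hK, Nat.div_eq_of_lt k.isLt, add_zero]

theorem card_block_le {K : ℕ} (hK : 0 < K) (r : ℕ) :
    (Finset.univ.filter fun j : Fin m => j.val / K = r).card ≤ K := by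
  have h : (Finset.univ.filter fun j : Fin m => j.val / K = r).card ≤ (Finset.range K).card := by
    refine Finset.card_le_card_of_injOn (fun j => j.val % K) ?_ ?_
    · intro j _
      simpa using Nat.mod_lt _ hK
    · intro a ha b hb hab
      have ha' : a.val / K = r := by simpa using ha
      have hb' : b.val / K = r := by simpa using hb
      refine Fin.ext ?_
      rw [← Nat.div_add_mod a.val K, ← Nat.div_add_mod b.val K, ha', hb']
      exact congrArg _ hab
  simpa using h

theorem sum_two_pow_digit (x K : ℕ) : ∑ k ∈ Finset.range K, 2 ^ k * (x / 2 ^ k % 2) = x % 2 ^ K := by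
  induction K with
  | zero => simp [Nat.mod_one]
  | succ K ih => rw [Finset.sum_range_succ, ih, Nat.mod_pow_succ]

theorem block_div_mod {K : ℕ} (i k : ℕ) (hk : k < K) :
    (i * K + k) / K = i ∧ (i * K + k) % K = k := by
  have hK : 0 < K := by omega
  constructor
  · rw [mul_comm, Nat.mul_add_div hK, Nat.div_eq_of_lt hk, add_zero]
  · rw [mul_comm, Nat.mul_add_mod, Nat.mod_eq_of_lt hk]

theorem gadget_mul_gadgetInv [NeZero q] (hq : 1 < q) (hm : n * Nat.clog 2 q ≤ m)
    (U : Matrix (Fin n) (Fin m) (ZMod q)) :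
    gadget n m q * modQ q (gadgetInv n m q U) = U := by
  ext i c
  have h1 : (gadget n m q * modQ q (gadgetInv n m q U)) i c =
      ∑ j : Fin m, (if j.val / Nat.clog 2 q = i.val then
        (2 : ZMod q) ^ (j.val % Nat.clog 2 q) * modQ q (gadgetInv n m q U) j c else 0) := by
    rw [Matrix.mul_apply]
    refine Finset.sum_congr rfl fun j _ => ?_
    rw [gadget, Matrix.of_apply, ite_mul, zero_mul]
  rw [h1, sum_block (Nat.clog_pos one_lt_two hq) hm i]
  have h2 : ∀ k : Fin (Nat.clog 2 q), (2 : ZMod q) ^ ((i.val * Nat.clog 2 q + k.val) % Nat.clog 2 q) *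
      modQ q (gadgetInv n m q U) ⟨i.val * Nat.clog 2 q + k.val, block_lt hm i k⟩ c =
      ((2 ^ k.val * ((U i c).val / 2 ^ k.val % 2) : ℕ) : ZMod q) := by
    intro k
    obtain ⟨h3, h4⟩ := block_div_mod i.val k.val k.isLt
    simp only [modQ, Matrix.map_apply, gadgetInv, Matrix.of_apply, h3, h4, i.isLt, dif_pos]
    rw [← Nat.toNat_testBit]
    rcases h : (U i c).val.testBit k.val <;> simp
  rw [Finset.sum_congr rfl fun k _ => h2 k, ← Nat.cast_sum,
    Fin.sum_univ_eq_sum_range (fun k => 2 ^ k * ((U i c).val / 2 ^ k % 2)), sum_two_pow_digit,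
    Nat.mod_eq_of_lt ((ZMod.val_lt _).trans_le (Nat.le_pow_clog one_lt_two q))]
  simp

theorem fullRank_gadget [NeZero q] (hq : 1 < q) (hm : n * Nat.clog 2 q ≤ m) (hm0 : 0 < m) :
    FullRank (gadget n m q) := by
  intro u
  have h := gadget_mul_gadgetInv hq hm (Matrix.of fun i (_ : Fin m) => u i)
  refine ⟨fun j => modQ q (gadgetInv n m q (Matrix.of fun i (_ : Fin m) => u i)) j ⟨0, hm0⟩, ?_⟩
  ext i
  have := congrFun (congrFun h i) ⟨0, hm0⟩
  rw [Matrix.mul_apply] at this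
  exact this

/-- The gadget matrix over the integers. -/
def gadgetInt (n m K : ℕ) : Matrix (Fin n) (Fin m) ℤ :=
  Matrix.of fun i j => if j.val / K = i.val then 2 ^ (j.val % K) else 0

/-- The binary digits of `q`, with a possibly larger leading digit in position `K - 1`. -/
def leadDigit (q K k : ℕ) : ℤ := if k + 1 < K then ((q / 2 ^ k % 2 : ℕ) : ℤ) else ((q / 2 ^ k : ℕ) : ℤ)

/-- Short linearly independent vectors in the lattice of the gadget matrix. -/
def gadgetBasis (n m q K : ℕ) : Matrix (Fin m) (Fin m) ℤ :=
  Matrix.of fun i j =>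
    if j.val / K < n then
      if j.val % K + 1 < K then if i = j then 2 else if i.val = j.val + 1 then -1 else 0
      else if i.val / K = j.val / K then leadDigit q K (i.val % K) else 0
    else if i = j then 1 else 0

theorem sum_leadDigit {K : ℕ} (hK : 0 < K) :
    ∑ k : Fin K, 2 ^ k.val * leadDigit q K k.val = (q : ℤ) := by
  obtain ⟨K, rfl⟩ := Nat.exists_eq_succ_of_ne_zero hK.ne'
  rw [Fin.sum_univ_eq_sum_range (fun k => 2 ^ k * leadDigit q (K + 1) k), Finset.sum_range_succ]
  have h1 : ∀ k ∈ Finset.range K, (2 : ℤ) ^ k * leadDigit q (K + 1) k =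
      ((2 ^ k * (q / 2 ^ k % 2) : ℕ) : ℤ) := by
    intro k hk
    have : k + 1 < K + 1 := by simpa using hk
    rw [leadDigit, if_pos this]
    push_cast
    rfl
  rw [Finset.sum_congr rfl h1, ← Nat.cast_sum, sum_two_pow_digit, leadDigit,
    if_neg (lt_irrefl _)]
  have := Nat.mod_add_div q (2 ^ K)
  exact_mod_cast this

/-- Inside a block the columns are `2 e_k - e_{k+1}`, which the weights `2^k` annihilate; the last
column of the block carries the digits of `q` and evaluates to `q`. Working over `ℤ` keeps this `q`
visible, as the determinant argument requires. -/
theorem gadgetInt_mul_gadgetBasis {K : ℕ} (hK : 0 < K) (hm : n * K ≤ m) (r : Fin n) (j : Fin m) :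
    (gadgetInt n m K * gadgetBasis n m q K) r j =
      if j.val / K = r.val ∧ ¬ j.val % K + 1 < K then (q : ℤ) else 0 := by
  rw [Matrix.mul_apply]
  by_cases h1 : j.val / K < n
  · by_cases h2 : j.val % K + 1 < K
    · rw [if_neg (fun h => h.2 h2)]
      have hj : j.val = j.val / K * K + j.val % K := by rw [mul_comm]; exact (Nat.div_add_mod _ _).symm
      have hj1 : j.val + 1 = j.val / K * K + (j.val % K + 1) := by omega
      have hlt : j.val + 1 < m := by
        rw [hj1]
        exact block_lt hm ⟨_, h1⟩ ⟨_, h2⟩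
      have h3 : ∀ i : Fin m, gadgetBasis n m q K i j =
          (if i = j then 2 else 0) + (if i = ⟨j.val + 1, hlt⟩ then -1 else 0) := by
        intro i
        simp only [gadgetBasis, Matrix.of_apply, if_pos h1, if_pos h2, Fin.ext_iff]
        split_ifs <;> omega
      simp only [h3, mul_add, mul_ite, mul_zero, Finset.sum_add_distrib, Finset.sum_ite_eq',
        Finset.mem_univ, if_true, gadgetInt, Matrix.of_apply]
      obtain ⟨h4, h5⟩ := block_div_mod (j.val / K) (j.val % K + 1) h2
      rw [hj1, h4, h5]
      split_ifs
      · ring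
      · simp
    · have h3 : ∀ i : Fin m, gadgetInt n m K r i * gadgetBasis n m q K i j =
          if i.val / K = r.val then (if r.val = j.val / K then
            2 ^ (i.val % K) * leadDigit q K (i.val % K) else 0) else 0 := by
        intro i
        simp only [gadgetInt, gadgetBasis, Matrix.of_apply, if_pos h1, if_neg h2]
        split_ifs <;> omega
      rw [Finset.sum_congr rfl fun i _ => h3 i, sum_block hK hm r]
      have h4 : ∀ k : Fin K, (r.val * K + k.val) % K = k.val := fun k =>
        (block_div_mod r.val k.val k.isLt).2
      simp only [h4]
      by_cases h5 : r.val = j.val / K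
      · simp only [if_pos h5, sum_leadDigit hK]
        rw [if_pos ⟨h5.symm, h2⟩]
      · simp only [if_neg h5, Finset.sum_const_zero]
        rw [if_neg fun h => h5 h.1.symm]
  · rw [if_neg fun h => h1 (by rw [h.1]; exact r.isLt)]
    refine Finset.sum_eq_zero fun i _ => ?_
    simp only [gadgetInt, gadgetBasis, Matrix.of_apply, if_neg h1]
    by_cases h2 : i = j
    · subst h2
      rw [if_neg fun h => h1 (by rw [h]; exact r.isLt), zero_mul]
    · rw [if_neg h2, mul_zero]

theorem modQ_mul {a b c : Type} [Fintype b] (X : Matrix a b ℤ) (Y : Matrix b c ℤ) :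
    modQ q (X * Y) = modQ q X * modQ q Y :=
  Matrix.map_mul (f := Int.castRingHom (ZMod q))

theorem vecModQ_mulVec {a b : Type} [Fintype b] (X : Matrix a b ℤ) (v : b → ℤ) :
    vecModQ q (X *ᵥ v) = modQ q X *ᵥ vecModQ q v := by
  ext i
  simp [vecModQ, modQ, Matrix.mulVec, dotProduct]

theorem modQ_gadgetInt : modQ q (gadgetInt n m (Nat.clog 2 q)) = gadget n m q := by
  ext i j
  simp only [modQ, gadgetInt, gadget, Matrix.map_apply, Matrix.of_apply]
  split_ifs <;> simp

theorem gadgetBasis_mem (hK : 0 < Nat.clog 2 q) (hm : n * Nat.clog 2 q ≤ m) (a : Fin m → ℤ) :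
    gadgetBasis n m q (Nat.clog 2 q) *ᵥ a ∈ latCoset (gadget n m q) 0 := by
  change _ *ᵥ _ = _
  rw [vecModQ_mulVec, ← modQ_gadgetInt, Matrix.mulVec_mulVec, ← modQ_mul]
  have h : modQ q (gadgetInt n m (Nat.clog 2 q) * gadgetBasis n m q (Nat.clog 2 q)) = 0 := by
    ext r j
    rw [modQ, Matrix.map_apply, gadgetInt_mul_gadgetBasis hK hm]
    split_ifs <;> simp
  rw [h, Matrix.zero_mulVec]

/-- Let `c` be in the kernel. Applying the integer gadget matrix leaves `q * c j` at the last column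
of each block, so these entries vanish. The other columns are lower triangular with diagonal entries
`2` or `1`, and the remaining entries of `c` vanish by forward substitution. -/
theorem gadgetBasis_det_ne_zero {K : ℕ} (hq : 0 < q) (hK : 0 < K) (hm : n * K ≤ m) :
    (gadgetBasis n m q K).det ≠ 0 := by
  intro h0
  obtain ⟨c, hc0, hc⟩ := Matrix.exists_mulVec_eq_zero_iff.2 h0
  have hlast : ∀ j : Fin m, j.val / K < n → ¬ j.val % K + 1 < K → c j = 0 := by
    intro j h1 h2
    have h3 : ((gadgetInt n m K * gadgetBasis n m q K) *ᵥ c) ⟨_, h1⟩ = 0 := by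
      rw [← Matrix.mulVec_mulVec, hc, Matrix.mulVec_zero]
      rfl
    rw [Matrix.mulVec, dotProduct, Finset.sum_eq_single j] at h3
    · rw [gadgetInt_mul_gadgetBasis hK hm, if_pos ⟨rfl, h2⟩] at h3
      rcases mul_eq_zero.1 h3 with h | h
      · exact absurd h (by positivity)
      · exact h
    · intro i _ hij
      rw [gadgetInt_mul_gadgetBasis hK hm]
      split_ifs with h
      · exfalso
        refine hij (Fin.ext ?_)
        have h4 := Nat.div_add_mod i.val K
        have h5 := Nat.div_add_mod j.val K
        have h6 := Nat.mod_lt i.val hK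
        have h7 := Nat.mod_lt j.val hK
        have h8 : i.val / K = j.val / K := h.1
        rw [h8] at h4
        omega
      · simp
    · simp
  refine hc0 (funext fun i => ?_)
  have key : ∀ N, ∀ i : Fin m, i.val = N → c i = 0 := by
    intro N
    induction N using Nat.strong_induction_on with
    | _ N ih =>
      intro i hi
      by_cases hl : i.val / K < n ∧ ¬ i.val % K + 1 < K
      · exact hlast i hl.1 hl.2
      have h3 : (gadgetBasis n m q K *ᵥ c) i = 0 := by rw [hc]; rfl
      rw [Matrix.mulVec, dotProduct, Finset.sum_eq_single i] at h3
      · rcases mul_eq_zero.1 h3 with h | h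
        · exfalso
          simp only [gadgetBasis, Matrix.of_apply] at h
          split_ifs at h with h4 h5 <;> simp_all
        · exact h
      · intro j _ hji
        rcases lt_or_ge j.val i.val with hlt | hge
        · rw [ih j.val (by omega) j rfl, mul_zero]
        · by_cases hl' : j.val / K < n ∧ ¬ j.val % K + 1 < K
          · rw [hlast j hl'.1 hl'.2, mul_zero]
          · have hne : j.val ≠ i.val := fun h => hji (Fin.ext h)
            have : gadgetBasis n m q K i j = 0 := by
              simp only [gadgetBasis, Matrix.of_apply]
              split_ifs with h4 h5 h6 h7 h8 h9 <;> first | rfl | (exfalso; simp_all; done) | omega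
            rw [this, zero_mul]
      · simp
  exact key _ i rfl

theorem norm_euclCol_gadgetBasis_le {K : ℕ} (hK : 0 < K) (hq : q ≤ 2 ^ K) (j : Fin m) :
    ‖euclCol (gadgetBasis n m q K) j‖ ≤ 2 * √K := by
  -- The leading digit is at most `q / 2^(K-1) ≤ 2`; the value `2` occurs when `q = 2^K`.
  have hd : ∀ k, |leadDigit q K (k % K)| ≤ 2 := by
    intro k
    have hk := Nat.mod_lt k hK
    rw [leadDigit]
    split_ifs with h
    · rw [Nat.abs_cast]
      have := Nat.mod_lt (q / 2 ^ (k % K)) two_pos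
      exact_mod_cast this.le
    · rw [Nat.abs_cast]
      have h1 : k % K + 1 = K := by omega
      have h2 : q / 2 ^ (k % K) ≤ 2 := by
        refine Nat.div_le_of_le_mul ?_
        rw [← pow_succ, h1]
        exact hq
      exact_mod_cast h2
  have hentry : ∀ i, ((gadgetBasis n m q K i j : ℝ)) ^ 2 ≤
      if i.val / K = j.val / K then 4 else 0 := by
    intro i
    by_cases hij : i.val / K = j.val / K
    · rw [if_pos hij]
      have h4 : |gadgetBasis n m q K i j| ≤ 2 := by
        simp only [gadgetBasis, Matrix.of_apply]
        split_ifs <;> first | exact hd _ | norm_num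
      have h5 : |(gadgetBasis n m q K i j : ℝ)| ≤ 2 := by exact_mod_cast h4
      rw [← sq_abs]
      nlinarith [abs_nonneg (gadgetBasis n m q K i j : ℝ)]
    · rw [if_neg hij]
      have : gadgetBasis n m q K i j = 0 := by
        have hne : i ≠ j := fun h => hij (by rw [h])
        have h2 : j.val % K + 1 < K → i.val ≠ j.val + 1 := by
          intro h3 h4
          apply hij
          have hj : j.val = j.val / K * K + j.val % K := by
            rw [mul_comm]; exact (Nat.div_add_mod _ _).symm
          rw [h4, show j.val + 1 = j.val / K * K + (j.val % K + 1) by omega]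
          exact (block_div_mod _ _ h3).1
        simp only [gadgetBasis, Matrix.of_apply, if_neg hne, if_neg hij]
        split_ifs with h5 h6 h7 <;> first | rfl | exact absurd h7 (h2 h6)
      simp [this]
  rw [EuclideanSpace.norm_eq]
  have h1 : ∑ i, ‖euclCol (gadgetBasis n m q K) j i‖ ^ 2 ≤ 4 * K := by
    calc _ ≤ ∑ i : Fin m, (if i.val / K = j.val / K then (4 : ℝ) else 0) := by
          refine Finset.sum_le_sum fun i _ => ?_
          rw [Real.norm_eq_abs, sq_abs]
          exact hentry i
      _ = ((Finset.univ.filter fun i : Fin m => i.val / K = j.val / K).card : ℝ) * 4 := by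
          rw [← Finset.sum_filter, Finset.sum_const, nsmul_eq_mul]
      _ ≤ _ := by
          rw [mul_comm]
          have := card_block_le (m := m) hK (j.val / K)
          exact mul_le_mul_of_nonneg_left (by exact_mod_cast this) (by norm_num)
  calc _ ≤ √(4 * K) := Real.sqrt_le_sqrt h1
    _ = 2 * √K := by
      rw [Real.sqrt_mul (by norm_num), show (4 : ℝ) = 2 ^ 2 by norm_num,
        Real.sqrt_sq (by norm_num)]

theorem norm_gramSchmidt_le {E : Type} [NormedAddCommGroup E] [InnerProductSpace ℝ E]
    (f : Fin m → E) (j : Fin m) : ‖InnerProductSpace.gramSchmidt ℝ f j‖ ≤ ‖f j‖ := by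
  set g := InnerProductSpace.gramSchmidt ℝ f j with hg
  have h1 : inner ℝ g (f j) = ‖g‖ ^ 2 := by
    rw [InnerProductSpace.gramSchmidt_def'' ℝ f j, inner_add_right, inner_sum,
      Finset.sum_eq_zero, add_zero, real_inner_self_eq_norm_sq]
    intro i hi
    rw [inner_smul_right, InnerProductSpace.gramSchmidt_orthogonal ℝ f
      (Finset.mem_Iio.1 hi).ne', mul_zero]
  have h2 := real_inner_le_norm g (f j)
  rw [h1, sq] at h2
  rcases (norm_nonneg g).eq_or_lt with h3 | h3
  · rw [← h3]
    exact norm_nonneg _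
  · exact le_of_mul_le_mul_left h2 h3

theorem isSmooth_gadget [NeZero q] (hq : 1 < q) (hm : n * Nat.clog 2 q ≤ m) (hm0 : 0 < m) {s w : ℝ}
    (hw : 1 ≤ w) (h : 2 * √(Nat.clog 2 q) * w ≤ s) :
    IsSmooth (gadget n m q) s (ENNReal.ofReal (Real.exp (smoothErr w)) ^ m) := by
  have hK : 0 < Nat.clog 2 q := Nat.clog_pos one_lt_two hq
  refine isSmooth_of_gramSchmidt (fullRank_gadget hq hm hm0)
    (gadgetBasis_det_ne_zero (by omega) hK hm) (gadgetBasis_mem hK hm) hw fun j => ?_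
  refine le_trans (mul_le_mul_of_nonneg_right ?_ (by linarith)) h
  exact (norm_gramSchmidt_le _ j).trans
    (norm_euclCol_gadgetBasis_le hK (Nat.le_pow_clog one_lt_two q) j)

end Gadget

/-! ## Uniform elements of finite abelian groups -/

section Uniform

theorem prob_uniform_equiv {α β : Type} [Fintype α] [Nonempty α] [Fintype β] [Nonempty β]
    (e : α ≃ β) (S : Set β) :
    prob (PMF.uniformOfFintype β) S = prob (PMF.uniformOfFintype α) (e ⁻¹' S) := by
  rw [prob_uniform, prob_uniform, Fintype.card_congr e]
  congr 2
  exact Nat.card_congr (e.symm.subtypeEquiv fun b => by simp)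

variable {M : Type} [AddCommGroup M] [Fintype M]

theorem prob_uniform_subgroup_le (H : AddSubgroup M) (hH : H ≠ ⊤) :
    prob (PMF.uniformOfFintype M) (H : Set M) ≤ 1 / 2 := by
  rw [prob_uniform, div_le_iff₀ (by exact_mod_cast Fintype.card_pos)]
  have h1 := H.card_mul_index
  have h2 : H.index ≠ 1 := fun h => hH (AddSubgroup.index_eq_one.1 h)
  have h3 : H.index ≠ 0 := AddSubgroup.index_ne_zero_of_finite
  have h4 : Nat.card H * 2 ≤ Nat.card M := h1 ▸ Nat.mul_le_mul_left _ (by omega)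
  rw [Nat.card_eq_fintype_card (α := M)] at h4
  have h5 : (Nat.card H : ℝ) * 2 ≤ Fintype.card M := by exact_mod_cast h4
  have h6 : Nat.card ((H : Set M) : Type) = Nat.card H := rfl
  rw [h6]
  linarith

theorem prob_uniform_char_le {ψ : AddChar M ℂ} (hψ : ψ ≠ 1) :
    prob (PMF.uniformOfFintype M) {a | ψ a = 1} ≤ 1 / 2 := by
  let H : AddSubgroup M :=
    { carrier := {a | ψ a = 1}
      add_mem' := fun {a b} ha hb => by
        change ψ (a + b) = 1
        rw [AddChar.map_add_eq_mul, show ψ a = 1 from ha, show ψ b = 1 from hb, one_mul]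
      zero_mem' := ψ.map_zero_eq_one
      neg_mem' := fun {a} ha => by
        change ψ (-a) = 1
        rw [AddChar.map_neg_eq_inv, show ψ a = 1 from ha, inv_one] }
  refine prob_uniform_subgroup_le H fun hH => hψ ?_
  ext a
  have : a ∈ H := hH ▸ AddSubgroup.mem_top a
  exact this

theorem exists_char_of_ne_top {H : AddSubgroup M} (hH : H ≠ ⊤) :
    ∃ ψ : AddChar M ℂ, ψ ≠ 1 ∧ ∀ a ∈ H, ψ a = 1 := by
  classical
  obtain ⟨a, ha⟩ : ∃ a, a ∉ H := by
    by_contra h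
    push Not at h
    exact hH ((AddSubgroup.eq_top_iff' H).2 h)
  have h1 : (QuotientAddGroup.mk' H a) ≠ 0 := fun h => ha ((QuotientAddGroup.eq_zero_iff a).1 h)
  have : Fintype (M ⧸ H) := Fintype.ofFinite _
  obtain ⟨φ, hφ⟩ := AddChar.exists_apply_ne_zero.2 h1
  refine ⟨φ.compAddMonoidHom (QuotientAddGroup.mk' H), fun h => hφ ?_, fun b hb => ?_⟩
  · have := DFunLike.congr_fun h a
    simpa using this
  · rw [AddChar.compAddMonoidHom_apply, QuotientAddGroup.mk'_apply,
      (QuotientAddGroup.eq_zero_iff b).2 hb, AddChar.map_zero_eq_one]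

/-- Columns that do not generate `ℤ_q^n` all lie in the kernel of one nontrivial character. There
are `q^n` characters, and each such kernel has index at least `2`. The argument uses subgroups only,
so `q` need not be prime. -/
theorem prob_not_fullRank_le {q n m : ℕ} [NeZero q] :
    prob (PMF.uniformOfFintype (Matrix (Fin n) (Fin m) (ZMod q))) {A | ¬ FullRank A} ≤
      (q : ℝ) ^ n * (1 / 2) ^ m := by
  let e : (Fin m → Fin n → ZMod q) ≃ Matrix (Fin n) (Fin m) (ZMod q) :=
    ⟨fun f => Matrix.of fun i j => f j i, fun A j i => A i j, fun _ => rfl, fun _ => rfl⟩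
  rw [prob_uniform_equiv e]
  have h1 : (e ⁻¹' {A | ¬ FullRank A}) ⊆
      {f | ∃ ψ : AddChar (Fin n → ZMod q) ℂ, f ∈ {f : Fin m → Fin n → ZMod q |
        ψ ≠ 1 ∧ ∀ j, ψ (f j) = 1}} := by
    intro f hf
    have hf' : ¬ FullRank (e f) := hf
    have hr : (e f).mulVecLin.toAddMonoidHom.range ≠ ⊤ := fun h =>
      hf' (AddMonoidHom.range_eq_top.1 h)
    obtain ⟨ψ, hψ, hψ1⟩ := exists_char_of_ne_top hr
    refine ⟨ψ, hψ, fun j => hψ1 _ ⟨Pi.single j 1, ?_⟩⟩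
    change (e f) *ᵥ Pi.single j 1 = f j
    rw [Matrix.mulVec_single_one]
    rfl
  refine (prob_mono h1).trans ((prob_exists_le (b := (1 / 2) ^ m) _ _ fun ψ => ?_).trans ?_)
  · by_cases hψ : ψ = 1
    · have : {f : Fin m → Fin n → ZMod q | ψ ≠ 1 ∧ ∀ j, ψ (f j) = 1} = ∅ := by
        ext f
        simp [hψ]
      rw [this]
      simp [prob]
    · refine (prob_mono (T := {f | ∀ j, f j ∈ {a | ψ a = 1}}) fun f hf => hf.2).trans ?_
      rw [uniformOfFintype_pi, prob_indep_pi, Finset.prod_const, Finset.card_univ, Fintype.card_fin]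
      exact pow_le_pow_left₀ (prob_nonneg _ _) (prob_uniform_char_le hψ) m
  · rw [AddChar.card_eq, Fintype.card_pi]
    simp [ZMod.card]

/-- A nonzero `a` may be a zero divisor. Its annihilator is still a proper subgroup, of density at
most `1/2` in each coordinate. -/
theorem prob_smul_eq_zero_le {q n : ℕ} [NeZero q] {a : ZMod q} (ha : a ≠ 0) :
    prob (PMF.uniformOfFintype (Fin n → ZMod q)) {s | a • s = 0} ≤ (1 / 2) ^ n := by
  let H : AddSubgroup (ZMod q) := (AddMonoidHom.mulLeft a).ker
  have hH : H ≠ ⊤ := fun h => ha (by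
    have : (1 : ZMod q) ∈ H := h ▸ AddSubgroup.mem_top _
    have h1 : a * 1 = 0 := this
    rwa [mul_one] at h1)
  have h1 : {s : Fin n → ZMod q | a • s = 0} = {s | ∀ i, s i ∈ (H : Set (ZMod q))} := by
    ext s
    exact funext_iff
  rw [h1, uniformOfFintype_pi, prob_indep_pi, Finset.prod_const, Finset.card_univ, Fintype.card_fin]
  exact pow_le_pow_left₀ (prob_nonneg _ _) (prob_uniform_subgroup_le H hH) n

/-- A nontrivial character often has a negative real part. -/
theorem card_char_re_le {ψ : AddChar M ℂ} (hψ : ψ ≠ 1) :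
    ((Finset.univ.filter fun a => -(1 / 8) ≤ (ψ a).re).card : ℝ) ≤ 7 / 8 * Fintype.card M := by
  have hs : ∑ a, (ψ a).re = 0 := by
    rw [← Complex.re_sum, AddChar.sum_eq_zero_of_ne_one hψ, Complex.zero_re]
  have hs2 : 0 ≤ ∑ a, ((ψ a) ^ 2).re := by
    have h1 : ∑ a, ((ψ a) ^ 2).re = (∑ a, (ψ * ψ) a).re := by
      rw [Complex.re_sum]
      exact Finset.sum_congr rfl fun a _ => by rw [AddChar.mul_apply, sq]
    rw [h1]
    by_cases h2 : ψ * ψ = 1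
    · rw [h2]
      simp
    · rw [AddChar.sum_eq_zero_of_ne_one h2, Complex.zero_re]
  have hsq : ∀ a, ((ψ a) ^ 2).re = 2 * (ψ a).re ^ 2 - 1 := by
    intro a
    have h1 : (ψ a).re ^ 2 + (ψ a).im ^ 2 = 1 := by
      have := Complex.normSq_eq_norm_sq (ψ a)
      rw [AddChar.norm_apply, Complex.normSq_apply] at this
      nlinarith
    rw [sq, Complex.mul_re]
    nlinarith
  -- Write `t = Re ψ`. The mean of `t` is `0`, and the mean of `t²` is at least `1/2` because `ψ²`
  -- has mean `0` or `1`. Averaging this pointwise inequality on `[-1, 1]` gives the proportion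
  -- `6/7`, hence `7/8`.
  have hpt : ∀ a, (ψ a).re ^ 2 - (ψ a).re ≤
      2 - 7 / 4 * (if -(1 / 8) ≤ (ψ a).re then 1 else 0) := by
    intro a
    have h1 : |(ψ a).re| ≤ 1 := (Complex.abs_re_le_norm _).trans (AddChar.norm_apply ψ a).le
    obtain ⟨h2, h3⟩ := abs_le.1 h1
    split_ifs with h
    · nlinarith
    · nlinarith
  have h := Finset.sum_le_sum fun a (_ : a ∈ Finset.univ) => hpt a
  simp only [hsq, Finset.sum_sub_distrib, ← Finset.mul_sum, Finset.sum_const, Finset.card_univ,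
    nsmul_eq_mul, mul_one, hs] at h hs2
  rw [Finset.sum_boole] at h
  linarith

end Uniform

/-! ## The decryption equation -/

section Decryption

variable {p : Params}

theorem Params.one_lt_q (p : Params) : 1 < p.q := p.q_primePow.one_lt

theorem Params.block_le (p : Params) : p.n * Nat.clog 2 p.q ≤ p.m := by
  unfold Params.m
  rw [mul_assoc]
  omega

theorem Params.G_mul_Ginv (c : ZMod p.q) : p.G * modQ p.q (p.Ginv c) = c • p.G :=
  gadget_mul_gadgetInv p.one_lt_q p.block_le _

theorem modQ_transpose {q : ℕ} {a b : Type} (X : Matrix a b ℤ) : modQ q Xᵀ = (modQ q X)ᵀ := rfl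

theorem vecModQ_sub {q : ℕ} {a : Type} (u v : a → ℤ) :
    vecModQ q (u - v) = vecModQ q u - vecModQ q v := by
  ext i
  simp [vecModQ]

theorem signPred_transpose_mulVec (R : Fin p.ℓ → Matrix (Fin p.m) (Fin p.m) ℤˣ)
    (x : Fin p.ℓ → ZMod p.q) (e : Fin p.m → ℤ) :
    (signPred R x)ᵀ *ᵥ e = ∑ i, (p.Ginv (x i))ᵀ *ᵥ ((signMat (R i))ᵀ *ᵥ e) := by
  rw [signPred, Matrix.transpose_sum, Matrix.sum_mulVec]
  exact Finset.sum_congr rfl fun i _ => by rw [Matrix.transpose_mul, Matrix.mulVec_mulVec]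

theorem vecModQ_sum {q : ℕ} {a ι : Type} [Fintype ι] (v : ι → a → ℤ) :
    vecModQ q (∑ i, v i) = ∑ i, vecModQ q (v i) := by
  ext j
  simp [vecModQ]

/-- Evaluation of the predicate on the ciphertext components. -/
theorem predVec_enc (As : Fin p.ℓ → p.Mat) (x y : Fin p.ℓ → ZMod p.q) (s : Fin p.n → ZMod p.q)
    (R : Fin p.ℓ → Matrix (Fin p.m) (Fin p.m) ℤˣ) (e : Fin p.m → ℤ) :
    predVec x (fun i => (As i + y i • p.G)ᵀ *ᵥ s + vecModQ p.q ((signMat (R i))ᵀ *ᵥ e)) =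
      (predMat As x)ᵀ *ᵥ s + (x ⬝ᵥ y) • (p.Gᵀ *ᵥ s) + vecModQ p.q ((signPred R x)ᵀ *ᵥ e) := by
  have h1 : ∀ i, (modQ p.q (p.Ginv (x i)))ᵀ *ᵥ ((As i + y i • p.G)ᵀ *ᵥ s +
      vecModQ p.q ((signMat (R i))ᵀ *ᵥ e)) = (As i * modQ p.q (p.Ginv (x i)))ᵀ *ᵥ s +
      (x i * y i) • (p.Gᵀ *ᵥ s) + vecModQ p.q ((p.Ginv (x i))ᵀ *ᵥ ((signMat (R i))ᵀ *ᵥ e)) := by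
    intro i
    rw [Matrix.mulVec_add, vecModQ_mulVec (p.Ginv (x i))ᵀ, modQ_transpose, Matrix.mulVec_mulVec,
      ← Matrix.transpose_mul, Matrix.add_mul, Matrix.smul_mul, p.G_mul_Ginv, smul_smul,
      Matrix.transpose_add, Matrix.add_mulVec, Matrix.transpose_smul, Matrix.smul_mulVec,
      mul_comm (y i)]
  rw [predVec, Finset.sum_congr rfl fun i _ => h1 i, Finset.sum_add_distrib,
    Finset.sum_add_distrib, signPred_transpose_mulVec, vecModQ_sum, predMat, Matrix.transpose_sum,
    Matrix.sum_mulVec, dotProduct, Finset.sum_smul]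

/-- The linear form in the encryption secret that survives in `d` when `⟨x, y⟩ ≠ 0`. -/
def residual (sk : Matrix p.I3 (Fin p.κ) ℤ) (tk : TransKey p) (j : Fin p.κ) : Fin p.n → ZMod p.q :=
  p.G *ᵥ vecModQ p.q (fun a => sk (Sum.inr (Sum.inl a)) j) +
    p.G *ᵥ (modQ p.q (tk.1.submatrix Sum.inr fun b => b) *ᵥ
      vecModQ p.q (fun a => sk (Sum.inr (Sum.inr a)) j))

theorem elim_transpose_mulVec {q n : ℕ} {ι κ : Type} (A : Matrix (Fin n) ι (ZMod q))
    (M : Matrix (Fin n) κ (ZMod q)) (s : Fin n → ZMod q) :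
    Sum.elim (Aᵀ *ᵥ s) (Mᵀ *ᵥ s) = (Matrix.fromCols A M)ᵀ *ᵥ s := by
  rw [Matrix.transpose_fromCols, Matrix.fromRows_mulVec]

theorem elim_add {α ι κ : Type} [Add α] (a a' : ι → α) (b b' : κ → α) :
    Sum.elim (a + a') (b + b') = Sum.elim a b + Sum.elim a' b' := by
  ext i
  cases i <;> rfl

/-- The two syndromes `D_id - U` and `U` add up to `D_id`, so the node matrix disappears and `cbar`
acts as the ciphertext component for `D_id`. Only the evaluated component contains `⟨x, y⟩ G`; it is
multiplied by the lower half of `Z₁`. -/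
theorem cbar_eq (pp : PublicParams p) (id : p.Ident) (t : p.Time) (x y : Fin p.ℓ → ZMod p.q)
    (M : Bool) (r : EncRand p) (tk : TransKey p) (U : p.Mat)
    (h1 : Matrix.fromCols pp.A (predMat pp.As x) * modQ p.q tk.1 = idMat pp id - U)
    (h2 : Matrix.fromCols pp.A (timeMat pp t) * modQ p.q tk.2 = U) :
    (transform x (enc pp y t M r) tk).cbar = (idMat pp id)ᵀ *ᵥ r.s +
      (x ⬝ᵥ y) • ((modQ p.q (tk.1.submatrix Sum.inr fun b => b))ᵀ *ᵥ (p.Gᵀ *ᵥ r.s)) +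
        vecModQ p.q (errorPrime x tk r) := by
  simp only [transform, enc]
  rw [predVec_enc, elim_add (pp.Aᵀ *ᵥ r.s) _ ((timeMat pp t)ᵀ *ᵥ r.s),
    add_assoc ((predMat pp.As x)ᵀ *ᵥ r.s), elim_add (pp.Aᵀ *ᵥ r.s), elim_transpose_mulVec,
    elim_transpose_mulVec, Matrix.mulVec_add, Matrix.mulVec_add, Matrix.mulVec_mulVec,
    Matrix.mulVec_mulVec, ← Matrix.transpose_mul, ← Matrix.transpose_mul, h1, h2,
    ← zero_add (vecModQ p.q r.e₁), elim_add, zero_add (vecModQ p.q r.e₁), ← vecModQ_sum_elim,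
    ← vecModQ_sum_elim, errorPrime, vecModQ_add, vecModQ_mulVec, vecModQ_mulVec,
    Matrix.mulVec_add, Matrix.transpose_sub, Matrix.sub_mulVec, modQ_transpose, modQ_transpose]
  have h3 : (modQ p.q tk.1)ᵀ *ᵥ Sum.elim (0 : Fin p.m → ZMod p.q) ((x ⬝ᵥ y) • (p.Gᵀ *ᵥ r.s)) =
      (x ⬝ᵥ y) • ((modQ p.q (tk.1.submatrix Sum.inr fun b => b))ᵀ *ᵥ (p.Gᵀ *ᵥ r.s)) := by
    rw [← Matrix.mulVec_smul (modQ p.q (tk.1.submatrix Sum.inr fun b => b))ᵀ]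
    generalize (x ⬝ᵥ y) • (p.Gᵀ *ᵥ r.s) = v
    ext i
    simp [Matrix.mulVec, dotProduct, modQ]
  rw [h3]
  abel

/-- The congruence for `Z` cancels `Vᵀ s`. What is left of `s` enters through the middle block of
`Z` directly and through its last block by way of `cbar`; `residual` collects both. -/
theorem decVec_eq (pp : PublicParams p) (id : p.Ident) (t : p.Time) (x y : Fin p.ℓ → ZMod p.q)
    (M : Bool) (r : EncRand p) (tk : TransKey p) (sk : Matrix p.I3 (Fin p.κ) ℤ) (U : p.Mat)
    (h0 : Matrix.fromCols pp.B (Matrix.fromCols (predMat pp.Bs x) (idMat pp id)) * modQ p.q sk =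
      pp.V)
    (h1 : Matrix.fromCols pp.A (predMat pp.As x) * modQ p.q tk.1 = idMat pp id - U)
    (h2 : Matrix.fromCols pp.A (timeMat pp t) * modQ p.q tk.2 = U) :
    decVec x (transform x (enc pp y t M r) tk) sk =
      ((p.q / 2 : ℕ) : ZMod p.q) • vecModQ p.q (encode p.κ M) + vecModQ p.q (errorTerm x sk tk r) -
        (fun j => residual sk tk j ⬝ᵥ ((x ⬝ᵥ y) • r.s)) := by
  rw [decVec, cbar_eq pp id t x y M r tk U h1 h2]
  simp only [transform, enc]
  rw [predVec_enc, add_assoc ((predMat pp.Bs x)ᵀ *ᵥ r.s), add_assoc ((idMat pp id)ᵀ *ᵥ r.s),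
    elim_add ((predMat pp.Bs x)ᵀ *ᵥ r.s), elim_transpose_mulVec,
    elim_add (pp.Bᵀ *ᵥ r.s), elim_transpose_mulVec, Matrix.mulVec_add, Matrix.mulVec_mulVec,
    ← Matrix.transpose_mul, h0, elim_add ((x ⬝ᵥ y) • (p.Gᵀ *ᵥ r.s)),
    ← zero_add (vecModQ p.q r.e₂), elim_add, ← vecModQ_sum_elim,
    ← vecModQ_sum_elim, errorTerm, vecModQ_sub, vecModQ_mulVec, Matrix.mulVec_add, modQ_transpose]
  have h3 : (modQ p.q sk)ᵀ *ᵥ Sum.elim (0 : Fin p.m → ZMod p.q)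
      (Sum.elim ((x ⬝ᵥ y) • (p.Gᵀ *ᵥ r.s)) ((x ⬝ᵥ y) •
        ((modQ p.q (tk.1.submatrix Sum.inr fun b => b))ᵀ *ᵥ (p.Gᵀ *ᵥ r.s)))) =
      (fun j => residual sk tk j ⬝ᵥ ((x ⬝ᵥ y) • r.s)) := by
    ext j
    rw [residual, add_dotProduct, ← Matrix.mulVec_smul, ← Matrix.mulVec_smul, ← Matrix.mulVec_smul]
    set S := (x ⬝ᵥ y) • r.s
    have h4 : ∀ v : Fin p.m → ZMod p.q, (p.G *ᵥ v) ⬝ᵥ S = v ⬝ᵥ (p.Gᵀ *ᵥ S) := fun v => by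
      rw [Matrix.mulVec_transpose, dotProduct_comm v, ← Matrix.dotProduct_mulVec, dotProduct_comm]
    rw [h4, h4]
    set X := modQ p.q (tk.1.submatrix Sum.inr fun b => b)
    have h5 : ∀ v w : Fin p.m → ZMod p.q, (X *ᵥ v) ⬝ᵥ w = v ⬝ᵥ (Xᵀ *ᵥ w) := fun v w => by
      rw [Matrix.mulVec_transpose, dotProduct_comm v, ← Matrix.dotProduct_mulVec, dotProduct_comm]
    rw [h5]
    generalize Xᵀ *ᵥ (p.Gᵀ *ᵥ S) = v'
    generalize p.Gᵀ *ᵥ S = v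
    simp [Matrix.mulVec, dotProduct, modQ, vecModQ]
  rw [h3]
  abel

end Decryption

/-! ## Rounding -/

section Rounding

/-- Another representative modulo `q` changes the argument of the rounding by an even integer, which
is invisible modulo `2`. -/
theorem roundTwo_intCast {q : ℕ} [NeZero q] (D : ℤ) :
    roundTwo (D : ZMod q) = ((⌈2 * (D : ℝ) / q - 1 / 2⌉ : ℤ) : ZMod 2) := by
  have hq : (q : ℝ) ≠ 0 := Nat.cast_ne_zero.2 (NeZero.ne q)
  obtain ⟨j, hj⟩ : ∃ j : ℤ, (((D : ZMod q).val : ℕ) : ℤ) = D + q * j := by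
    rw [ZMod.val_intCast]
    refine ⟨-(D / q), ?_⟩
    have := Int.emod_add_mul_ediv D q
    linarith
  have hj' : (((D : ZMod q).val : ℕ) : ℝ) = D + q * j := by exact_mod_cast hj
  rw [roundTwo, hj']
  have h1 : 2 / (q : ℝ) * (D + q * j) - 1 / 2 = (2 * D / q - 1 / 2) + ((2 * j : ℤ) : ℝ) := by
    push_cast
    field_simp
    ring
  rw [h1, Int.ceil_add_intCast]
  push_cast
  have : (2 : ZMod 2) = 0 := rfl
  rw [this, zero_mul, add_zero]

/-- The rounded number differs from `b` by less than `2/5 + 1/q`, the second term being due to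
`⌊q/2⌋`; this is below `1/2` as soon as `q > 10`. -/
theorem roundTwo_encode {q : ℕ} [NeZero q] (hq : 10 < q) (b : ℤ) (hb : b = 0 ∨ b = 1) (E : ℤ)
    (hE : |(E : ℝ)| < q / 5) :
    roundTwo (((q / 2 : ℕ) : ZMod q) * (b : ZMod q) + (E : ZMod q)) = (b : ZMod 2) := by
  have hq0 : (10 : ℝ) < q := by exact_mod_cast hq
  have h1 : ((q / 2 : ℕ) : ZMod q) * (b : ZMod q) + (E : ZMod q) =
      ((((q / 2 : ℕ) : ℤ) * b + E : ℤ) : ZMod q) := by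
    rw [Int.cast_add, Int.cast_mul, Int.cast_natCast]
  rw [h1, roundTwo_intCast]
  congr 1
  obtain ⟨h2, h3⟩ := abs_lt.1 hE
  have h4 : ((q / 2 : ℕ) : ℝ) ≤ q / 2 := Nat.cast_div_le
  have h5 : (q : ℝ) / 2 - 1 / 2 ≤ ((q / 2 : ℕ) : ℝ) := by
    have : q ≤ 2 * (q / 2) + 1 := by omega
    have : (q : ℝ) ≤ 2 * ((q / 2 : ℕ) : ℝ) + 1 := by exact_mod_cast this
    linarith
  clear h1
  generalize q / 2 = Q at h4 h5 ⊢
  rw [Int.ceil_eq_iff]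
  push_cast
  rw [lt_sub_iff_add_lt, sub_le_iff_le_add, div_le_iff₀ (by linarith), lt_div_iff₀ (by linarith)]
  rcases hb with rfl | rfl
  · constructor <;> push_cast <;> nlinarith
  · constructor <;> push_cast <;> nlinarith

theorem encode_mem {κ : ℕ} (M : Bool) (i : Fin κ) : encode κ M i = 0 ∨ encode κ M i = 1 := by
  rw [encode]
  split_ifs <;> simp

/-- Coordinate `0` separates the two encodings, so the choice made in `dec` is forced. -/
theorem dec_eq_some {p : Params} {x : Fin p.ℓ → ZMod p.q} {ct : PartialCiphertext p}
    {sk : Matrix p.I3 (Fin p.κ) ℤ} {M : Bool} (hκ : 0 < p.κ)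
    (h : (fun i => roundTwo (decVec x ct sk i)) = vecModQ 2 (encode p.κ M)) :
    dec x ct sk = some M := by
  have hex : ∃ M : Bool, (fun i => roundTwo (decVec x ct sk i)) = vecModQ 2 (encode p.κ M) := ⟨M, h⟩
  rw [dec, dif_pos hex]
  have h1 := h.symm.trans hex.choose_spec
  have h2 := congrFun h1 ⟨0, hκ⟩
  generalize hex.choose = M' at h2
  cases M <;> cases M' <;> simp [vecModQ, encode] at h2 ⊢

theorem roundTwo_eq_zero_of_dec {p : Params} {x : Fin p.ℓ → ZMod p.q} {ct : PartialCiphertext p}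
    {sk : Matrix p.I3 (Fin p.κ) ℤ} (h : dec x ct sk ≠ none) (i : Fin p.κ) (hi : i.val ≠ 0) :
    roundTwo (decVec x ct sk i) = 0 := by
  by_cases hex : ∃ M : Bool, (fun i => roundTwo (decVec x ct sk i)) = vecModQ 2 (encode p.κ M)
  · obtain ⟨M, hM⟩ := hex
    rw [congrFun hM i]
    simp [vecModQ, encode, hi]
  · exact absurd (dif_neg hex) h

/-- If `D` rounds to `0` and `E` is small, then `D - E` is close to `0` modulo `q`. -/
theorem stdAddChar_re_ge {q : ℕ} [NeZero q] {D w : ZMod q} {E : ℤ} (hD : roundTwo D = 0)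
    (hE : |(E : ℝ)| ≤ q / 100) (hw : w = E - D) : -(1 / 8) ≤ (ZMod.stdAddChar w).re := by
  have hq : (0 : ℝ) < q := Nat.cast_pos.2 (NeZero.pos q)
  have h1 : w = ((E - D.val : ℤ) : ZMod q) := by rw [hw]; simp
  have h2 : (ZMod.stdAddChar w).re = Real.cos (2 * Real.pi * ((E : ℝ) - D.val) / q) := by
    rw [h1, ZMod.stdAddChar_coe]
    have : 2 * (Real.pi : ℂ) * Complex.I * ((E - D.val : ℤ) : ℂ) / (q : ℂ) =
        ((2 * Real.pi * ((E : ℝ) - D.val) / q : ℝ) : ℂ) * Complex.I := by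
      push_cast
      ring
    rw [this, Complex.exp_ofReal_mul_I_re]
  -- Rounding to `0` modulo `2` puts `2 D / q` within `1/2` of an even integer, hence the angle `2π
  -- D / q` within `π/2` of a multiple of `2π`.
  have h3 : 0 ≤ Real.cos (2 * Real.pi * D.val / q) := by
    have h4 := roundTwo_intCast (q := q) (D.val : ℤ)
    rw [Int.cast_natCast, ZMod.natCast_zmod_val, hD] at h4
    obtain ⟨k, hk⟩ := (ZMod.intCast_zmod_eq_zero_iff_dvd _ 2).1 h4.symm
    have h5 := Int.ceil_eq_iff.1 hk
    push_cast at h5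
    have h6 : Real.cos (2 * Real.pi * D.val / q) =
        Real.cos (2 * Real.pi * D.val / q - k * (2 * Real.pi)) :=
      (Real.cos_sub_int_mul_two_pi _ _).symm
    rw [h6]
    have h7 : 2 * Real.pi * D.val / q - k * (2 * Real.pi) =
        Real.pi * (2 * D.val / q - 2 * k) := by ring
    rw [h7]
    refine Real.cos_nonneg_of_neg_pi_div_two_le_of_le ?_ ?_ <;> nlinarith [Real.pi_pos]
  have h8 := abs_le.1 (Real.abs_cos_sub_cos_le (2 * Real.pi * ((E : ℝ) - D.val) / q)
    (-(2 * Real.pi * D.val / q)))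
  have h9 : 2 * Real.pi * ((E : ℝ) - D.val) / q - -(2 * Real.pi * D.val / q) =
      2 * Real.pi * (E / q) := by ring
  -- The error turns the angle by at most `2π / 100 < 1/8`, and the cosine is `1`-Lipschitz.
  have h10 : |2 * Real.pi * (E / q)| ≤ 1 / 8 := by
    rw [abs_mul, abs_div, abs_of_pos hq, abs_of_pos (by positivity)]
    have h11 : |(E : ℝ)| / q ≤ 1 / 100 := by
      rw [div_le_iff₀ hq]
      linarith
    have h12 : 0 ≤ |(E : ℝ)| / q := by positivity
    nlinarith [Real.pi_lt_d2, Real.pi_pos]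
  rw [h9, Real.cos_neg] at h8
  rw [h2]
  linarith [h8.1]

end Rounding

/-! ## The size of the error -/

section Error

variable {p : Params}

/-- A column of `c • G` is supported in a single row, so its binary decomposition occupies one
block. This sparsity replaces a factor `m` by `⌈log₂ q⌉` in the error. -/
theorem Ginv_abs_le (c : ZMod p.q) (j i : Fin p.m) :
    |((p.Ginv c j i : ℤ) : ℝ)| ≤ if j.val / Nat.clog 2 p.q = i.val / Nat.clog 2 p.q then 1 else 0 := by
  simp only [Params.Ginv, gadgetInv, Matrix.of_apply, Matrix.smul_apply, Params.G, gadget,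
    smul_eq_mul]
  by_cases h : j.val / Nat.clog 2 p.q = i.val / Nat.clog 2 p.q
  · rw [if_pos h]
    split_ifs <;> simp
  · rw [if_neg h]
    have h' : ¬ i.val / Nat.clog 2 p.q = j.val / Nat.clog 2 p.q := fun h' => h h'.symm
    simp [h']

theorem signPred_abs_le {R : Fin p.ℓ → Matrix (Fin p.m) (Fin p.m) ℤˣ} {e : Fin p.m → ℤ} {h : ℝ}
    (h0 : 0 ≤ h) (hR : ∀ i j, |((((signMat (R i))ᵀ *ᵥ e) j : ℤ) : ℝ)| ≤ h) (x : Fin p.ℓ → ZMod p.q)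
    (c : Fin p.m) : |((((signPred R x)ᵀ *ᵥ e) c : ℤ) : ℝ)| ≤ p.ℓ * Nat.clog 2 p.q * h := by
  have hK := Nat.clog_pos one_lt_two p.one_lt_q
  rw [signPred_transpose_mulVec, Finset.sum_apply]
  push_cast
  refine (Finset.abs_sum_le_sum_abs _ _).trans ?_
  have h1 : ∀ i, |((((p.Ginv (x i))ᵀ *ᵥ ((signMat (R i))ᵀ *ᵥ e)) c : ℤ) : ℝ)| ≤
      Nat.clog 2 p.q * h := by
    intro i
    rw [Matrix.mulVec, dotProduct]
    push_cast
    refine (Finset.abs_sum_le_sum_abs _ _).trans ?_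
    calc _ ≤ ∑ j : Fin p.m, (if j.val / Nat.clog 2 p.q = c.val / Nat.clog 2 p.q then h else 0) := by
          refine Finset.sum_le_sum fun j _ => ?_
          rw [abs_mul]
          refine (mul_le_mul (Ginv_abs_le (x i) j c) (hR i j) (abs_nonneg _)
            (by split_ifs <;> norm_num)).trans ?_
          split_ifs <;> simp
      _ = ((Finset.univ.filter fun j : Fin p.m =>
            j.val / Nat.clog 2 p.q = c.val / Nat.clog 2 p.q).card : ℝ) * h := by
          rw [← Finset.sum_filter, Finset.sum_const, nsmul_eq_mul]
      _ ≤ _ := mul_le_mul_of_nonneg_right (by exact_mod_cast card_block_le hK _) h0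
  calc _ ≤ ∑ _i : Fin p.ℓ, (Nat.clog 2 p.q * h) := Finset.sum_le_sum fun i _ => h1 i
    _ = _ := by rw [Finset.sum_const, Finset.card_univ, Fintype.card_fin, nsmul_eq_mul, mul_assoc]

theorem abs_dotProduct_le {m : ℕ} {u v : Fin m → ℤ} {a b : ℝ} (ha : 0 ≤ a)
    (hu : ∀ i, |(u i : ℝ)| ≤ a) (hv : ∀ i, |(v i : ℝ)| ≤ b) :
    |((u ⬝ᵥ v : ℤ) : ℝ)| ≤ m * (a * b) := by
  rw [dotProduct]
  push_cast
  refine (Finset.abs_sum_le_sum_abs _ _).trans ?_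
  calc _ ≤ ∑ _i : Fin m, a * b := Finset.sum_le_sum fun i _ => by
        rw [abs_mul]
        exact mul_le_mul (hu i) (hv i) (abs_nonneg _) ha
    _ = _ := by rw [Finset.sum_const, Finset.card_univ, Fintype.card_fin, nsmul_eq_mul]

/-- Transposition brings the share of `error'` into the form `(Z₁ z₃) · v`, linear in the columns of
`Z₁`, to which the bilinear tail bound applies. -/
theorem errorTerm_apply (x : Fin p.ℓ → ZMod p.q) (sk : Matrix p.I3 (Fin p.κ) ℤ) (tk : TransKey p)
    (r : EncRand p) (j : Fin p.κ) : errorTerm x sk tk r j = r.e j -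
      ((fun a => sk (Sum.inl a) j) ⬝ᵥ r.e₂ +
        ((fun a => sk (Sum.inr (Sum.inl a)) j) ⬝ᵥ ((signPred r.S x)ᵀ *ᵥ r.e₂) +
          ((tk.1 *ᵥ fun a => sk (Sum.inr (Sum.inr a)) j) ⬝ᵥ
              Sum.elim r.e₁ ((signPred r.R x)ᵀ *ᵥ r.e₁) +
            (tk.2 *ᵥ fun a => sk (Sum.inr (Sum.inr a)) j) ⬝ᵥ
              Sum.elim r.e₁ ((signMat r.Rbar)ᵀ *ᵥ r.e₁)))) := by
  have h1 : ∀ (X : Matrix p.I2 (Fin p.m) ℤ) (u : Fin p.m → ℤ) (v : p.I2 → ℤ),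
      (X *ᵥ u) ⬝ᵥ v = u ⬝ᵥ (Xᵀ *ᵥ v) := fun X u v => by
    rw [Matrix.mulVec_transpose, dotProduct_comm u, ← Matrix.dotProduct_mulVec, dotProduct_comm]
  rw [h1, h1, ← dotProduct_add, errorTerm, Pi.sub_apply]
  congr 1
  rw [errorPrime, Matrix.mulVec, dotProduct, Fintype.sum_sum_type, Fintype.sum_sum_type]
  rfl

theorem errorTerm_abs_le {x : Fin p.ℓ → ZMod p.q} {sk : Matrix p.I3 (Fin p.κ) ℤ} {tk : TransKey p}
    {r : EncRand p} {b h c T : ℝ} (h0 : 0 ≤ h) (c0 : 0 ≤ c)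
    (he : ∀ i, |(r.e i : ℝ)| ≤ b) (he₂ : ∀ i, |(r.e₂ i : ℝ)| ≤ b)
    (hS : ∀ i j, |((((signMat (r.S i))ᵀ *ᵥ r.e₂) j : ℤ) : ℝ)| ≤ h)
    (hsk : ∀ i j, |(sk i j : ℝ)| ≤ c)
    (h1 : ∀ j, |(((tk.1 *ᵥ fun a => sk (Sum.inr (Sum.inr a)) j) ⬝ᵥ
              Sum.elim r.e₁ ((signPred r.R x)ᵀ *ᵥ r.e₁) : ℤ) : ℝ)| ≤ T)
    (h2 : ∀ j, |(((tk.2 *ᵥ fun a => sk (Sum.inr (Sum.inr a)) j) ⬝ᵥ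
              Sum.elim r.e₁ ((signMat r.Rbar)ᵀ *ᵥ r.e₁) : ℤ) : ℝ)| ≤ T) (j : Fin p.κ) :
    |(errorTerm x sk tk r j : ℝ)| ≤
      b + p.m * (c * b) + p.m * (c * (p.ℓ * Nat.clog 2 p.q * h)) + 2 * T := by
  rw [errorTerm_apply]
  have h3 := abs_dotProduct_le c0 (fun a => hsk (Sum.inl a) j) he₂
  have h4 := abs_dotProduct_le c0 (fun a => hsk (Sum.inr (Sum.inl a)) j)
    (fun a => signPred_abs_le h0 hS x a)
  have h5 := h1 j
  have h6 := h2 j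
  have h7 := he j
  push_cast at h3 h4 h5 h6 h7 ⊢
  rw [abs_le] at *
  constructor <;> linarith

end Error

/-! ## The complete subtree method -/

section Tree

variable {p : Params}

theorem mem_path {d : ℕ} {ν : Fin d → Bool} {θ : Node} : θ ∈ path ν ↔ θ <+: List.ofFn ν := by
  simp [path]

theorem mem_kuX {st : State p} {RL : RevList p} {t : p.Time} {θ : Node} :
    θ ∈ kuX st RL t ↔ ∃ e ∈ RL, e.2 ≤ t ∧ ∃ ν, st.leaf e.1 = some ν ∧ θ ∈ path ν := by
  classical
  simp only [kuX, Finset.mem_biUnion, Finset.mem_filter]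
  constructor
  · rintro ⟨e, ⟨he, het⟩, hθ⟩
    cases hl : st.leaf e.1 with
    | none => simp [hl] at hθ
    | some ν => exact ⟨e, he, het, ν, hl, by simpa [hl] using hθ⟩
  · rintro ⟨e, he, het, ν, hl, hθ⟩
    exact ⟨e, ⟨he, het⟩, by simpa [hl] using hθ⟩

theorem kuX_of_prefix {st : State p} {RL : RevList p} {t : p.Time} {θ θ' : Node}
    (h : θ' ∈ kuX st RL t) (hp : θ <+: θ') : θ ∈ kuX st RL t := by
  obtain ⟨e, he, het, ν, hl, hθ⟩ := mem_kuX.1 h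
  exact mem_kuX.2 ⟨e, he, het, ν, hl, mem_path.2 (hp.trans (mem_path.1 hθ))⟩

theorem leaf_notMem_kuX {st : State p} {RL : RevList p} {t : p.Time} {id : p.Ident} {ν : p.Leaf}
    (hl : st.leaf id = some ν) (hr : ¬ Revoked RL id t) : List.ofFn ν ∉ kuX st RL t := by
  intro h
  obtain ⟨e, he, het, ν', hl', hθ⟩ := mem_kuX.1 h
  have h1 : List.ofFn ν = List.ofFn ν' := (mem_path.1 hθ).eq_of_length (by simp)
  have h2 : ν = ν' := List.ofFn_injective h1
  subst h2
  have h3 : id = e.1 := st.leaf_inj _ _ _ hl hl'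
  exact hr ⟨e.2, by rw [h3]; exact he, het⟩

theorem mem_kuY {st : State p} {RL : RevList p} {t : p.Time} {θ : Node} :
    θ ∈ kuY st RL t ↔ θ ∉ kuX st RL t ∧
      ∃ θ' ∈ kuX st RL t, θ'.length < p.depth ∧ ∃ b, θ = θ' ++ [b] := by
  simp only [kuY, Finset.mem_filter, Finset.mem_biUnion, Finset.mem_insert, Finset.mem_singleton]
  constructor
  · rintro ⟨⟨θ', ⟨h1, h2⟩, h3 | h3⟩, h4⟩
    · exact ⟨h4, θ', h1, h2, false, h3⟩
    · exact ⟨h4, θ', h1, h2, true, h3⟩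
  · rintro ⟨h4, θ', h1, h2, b, h3⟩
    refine ⟨⟨θ', ⟨h1, h2⟩, ?_⟩, h4⟩
    cases b
    · exact Or.inl h3
    · exact Or.inr h3

/-- A proper prefix of a node of `kuY` is a prefix of its parent. The parent is marked, and marked
nodes are closed under prefixes. -/
theorem kuY_eq_of_prefix {st : State p} {RL : RevList p} {t : p.Time} {θ₁ θ₂ : Node}
    (h₁ : θ₁ ∈ kuY st RL t) (h₂ : θ₂ ∈ kuY st RL t) (h : θ₁ <+: θ₂) : θ₁ = θ₂ := by
  by_contra hne
  obtain ⟨-, θ', hθ', -, b, rfl⟩ := mem_kuY.1 h₂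
  rcases List.prefix_concat_iff.1 h with h3 | h3
  · exact hne h3
  · exact (mem_kuY.1 h₁).1 (kuX_of_prefix hθ' h3)

/-- A user that is not revoked has exactly one node in common with `KUNodes`. -/
theorem exists_common_node {st : State p} {RL : RevList p} {t : p.Time} {id : p.Ident} {ν : p.Leaf}
    (hl : st.leaf id = some ν) (hr : ¬ Revoked RL id t) :
    ∃ θ₀ ∈ path ν, θ₀ ∈ kuNodes st RL t ∧ ∀ θ ∈ path ν, θ ∈ kuNodes st RL t → θ = θ₀ := by
  by_cases hY : kuY st RL t = ∅
  · refine ⟨[], mem_path.2 List.nil_prefix, ?_, fun θ _ hθ => ?_⟩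
    · rw [kuNodes, if_pos hY]
      exact Finset.mem_singleton_self _
    · rw [kuNodes, if_pos hY] at hθ
      exact Finset.mem_singleton.1 hθ
  · have hku : kuNodes st RL t = kuY st RL t := if_neg hY
    rw [hku]
    obtain ⟨θ₁, hθ₁⟩ := Finset.nonempty_iff_ne_empty.2 hY
    obtain ⟨-, θ₂, hθ₂, -⟩ := mem_kuY.1 hθ₁
    have hroot : [] ∈ kuX st RL t := kuX_of_prefix hθ₂ List.nil_prefix
    -- The first unmarked node on the way from the root to the leaf has a marked parent, so it
    -- belongs to `kuY`. It exists because the leaf is unmarked, and it is not the root because the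
    -- root is marked.
    have hex : ∃ i, (List.ofFn ν).take i ∉ kuX st RL t :=
      ⟨p.depth, by
        rw [List.take_of_length_le (by simp)]
        exact leaf_notMem_kuX hl hr⟩
    classical
    have h1 := Nat.find_spec hex
    have h2 := fun i => Nat.find_min hex (m := i)
    set i := Nat.find hex
    have hi0 : i ≠ 0 := by
      intro h0
      rw [h0] at h1
      exact h1 (by simpa using hroot)
    obtain ⟨j, hj⟩ := Nat.exists_eq_succ_of_ne_zero hi0
    have h3 : (List.ofFn ν).take j ∈ kuX st RL t := not_not.1 (h2 j (by omega))
    have hjd : j < p.depth := by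
      by_contra hge
      rw [List.take_of_length_le (by simp; omega)] at h3
      exact leaf_notMem_kuX hl hr h3
    refine ⟨(List.ofFn ν).take i, mem_path.2 (List.take_prefix _ _), mem_kuY.2 ⟨h1, _, h3, ?_,
      (List.ofFn ν)[j]'(by simpa using hjd), ?_⟩, ?_⟩
    · rw [List.length_take]
      omega
    · rw [hj, Nat.succ_eq_add_one, List.take_succ_eq_append_getElem (by simpa using hjd)]
    · intro θ hθ hθY
      have hY' : (List.ofFn ν).take i ∈ kuY st RL t := mem_kuY.2 ⟨h1, _, h3, by
        rw [List.length_take]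
        omega, (List.ofFn ν)[j]'(by simpa using hjd), by
          rw [hj, Nat.succ_eq_add_one, List.take_succ_eq_append_getElem (by simpa using hjd)]⟩
      rcases List.prefix_or_prefix_of_prefix (mem_path.1 hθ) (List.take_prefix i (List.ofFn ν))
        with h | h
      · exact kuY_eq_of_prefix hθY hY' h
      · exact (kuY_eq_of_prefix hY' hθY h).symm

/-- The unspecified choice in `tranKG` is harmless when only one node can carry both keys. -/
theorem tranKG_eq {τ uk : NodeKeys p} {θ₀ : Node}
    (h : ∀ θ z₁ z₂, τ θ = some z₁ → uk θ = some z₂ → θ = θ₀) :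
    tranKG τ uk = (τ θ₀).bind fun z₁ => (uk θ₀).map fun z₂ => (z₁, z₂) := by
  by_cases hex : ∃ tk : TransKey p, ∃ θ, τ θ = some tk.1 ∧ uk θ = some tk.2
  · rw [tranKG, dif_pos hex]
    obtain ⟨θ, h1, h2⟩ := hex.choose_spec
    have h3 := h θ _ _ h1 h2
    subst h3
    rw [h1, h2]
    rfl
  · rw [tranKG, dif_neg hex]
    cases h1 : τ θ₀ with
    | none => rfl
    | some z₁ =>
      cases h2 : uk θ₀ with
      | none => rfl
      | some z₂ => exact absurd ⟨(z₁, z₂), θ₀, h1, h2⟩ hex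

theorem indep_map_eval {ι : Type} [Fintype ι] {α : ι → Type} (q : ∀ i, PMF (α i)) (i : ι) :
    (indep q).map (fun f => f i) = q i := by
  refine PMF.toOuterMeasure_injective (MeasureTheory.OuterMeasure.ext fun S => ?_)
  rw [← ofReal_prob, ← ofReal_prob, prob_map, ← prob_indep_eval q i S]
  rfl

/-- The law of the transformation key. -/
def tranDist (sub : Subroutines p) (pp : PublicParams p) (msk : MasterKey p) (st : State p)
    (RL : RevList p) (id : p.Ident) (ν : p.Leaf) (x : Fin p.ℓ → ZMod p.q) (t : p.Time) :
    PMF (Option (TransKey p)) :=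
  (token sub pp msk id ν x st).bind fun tok => (updKG sub pp msk t RL tok.2).map (tranKG tok.1)

/-- The law of the transformation key that belongs to a node with matrix `U`. -/
def keyPair (sub : Subroutines p) (pp : PublicParams p) (msk : MasterKey p) (id : p.Ident)
    (x : Fin p.ℓ → ZMod p.q) (t : p.Time) (U : p.Mat) : PMF (TransKey p) :=
  (sampleMatrix sub.sampleLeft₁ pp.A (predMat pp.As x) msk.TA (idMat pp id - U)).bind fun Z₁ =>
    (sampleMatrix sub.sampleLeft₁ pp.A (timeMat pp t) msk.TA U).map fun Z₂ => (Z₁, Z₂)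

/-- The common node is determined by the tree before any key is sampled. Its two keys are marginals
of independent families, with the same matrix `U`. The bound is uniform in `U`, so it does not
matter whether `U` comes from the state or is fresh. -/
theorem prob_tranDist_le (sub : Subroutines p) (pp : PublicParams p) (msk : MasterKey p)
    {st : State p} {RL : RevList p} {id : p.Ident} {ν : p.Leaf} (x : Fin p.ℓ → ZMod p.q)
    {t : p.Time} (hl : st.leaf id = some ν) (hr : ¬ Revoked RL id t)
    (E : Set (Option (TransKey p))) {b : ℝ}
    (h : ∀ U, prob (keyPair sub pp msk id x t U) {tk | some tk ∈ E} ≤ b) :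
    prob (tranDist sub pp msk st RL id ν x t) E ≤ b := by
  obtain ⟨θ₀, hθ₁, hθ₂, huniq⟩ := exists_common_node hl hr
  set pz : (path ν → p.Mat) → ∀ θ : path ν, PMF (Matrix p.I2 (Fin p.m) ℤ) := fun fresh θ =>
    sampleMatrix sub.sampleLeft₁ pp.A (predMat pp.As x) msk.TA
      (idMat pp id - (st.U θ.1).getD (fresh θ)) with hpz
  set st' : (path ν → p.Mat) → State p := fun fresh => { st with
    U := fun θ => if h : θ ∈ path ν then some ((st.U θ).getD (fresh ⟨θ, h⟩)) else st.U θ } with hst'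
  set pz' : (path ν → p.Mat) → ∀ _θ : kuNodes st RL t, PMF (Option (Matrix p.I2 (Fin p.m) ℤ)) :=
    fun fresh θ =>
      match (st' fresh).U θ.1 with
      | some U => (sampleMatrix sub.sampleLeft₁ pp.A (timeMat pp t) msk.TA U).map some
      | none => PMF.pure none with hpz'
  have hdist : tranDist sub pp msk st RL id ν x t =
      (PMF.uniformOfFintype (path ν → p.Mat)).bind fun fresh =>
        (indep (pz fresh)).bind fun Z => (indep (pz' fresh)).map fun Z' =>
          tranKG (fun θ => if h : θ ∈ path ν then some (Z ⟨θ, h⟩) else none)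
            (fun θ => if h : θ ∈ kuNodes st RL t then Z' ⟨θ, h⟩ else none) := by
    change (PMF.bind _ fun fresh => PMF.bind _ fun Z => PMF.pure _).bind _ = _
    rw [PMF.bind_bind]
    congr 1
    funext fresh
    rw [PMF.bind_bind]
    congr 1
    funext Z
    rw [PMF.pure_bind]
    change PMF.map _ (PMF.bind _ fun Z' => PMF.pure _) = _
    rw [PMF.map_bind]
    simp only [PMF.pure_map]
    rfl
  rw [hdist]
  refine prob_bind_le_of_forall fun fresh => ?_
  set U₀ := (st.U θ₀).getD (fresh ⟨θ₀, hθ₁⟩) with hU₀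
  refine le_trans (le_of_eq ?_) (h U₀)
  set H : Matrix p.I2 (Fin p.m) ℤ → Option (Matrix p.I2 (Fin p.m) ℤ) → Option (TransKey p) :=
    fun z o => o.map fun z₂ => (z, z₂) with hH
  have h1 : ∀ (Z : path ν → Matrix p.I2 (Fin p.m) ℤ)
      (Z' : kuNodes st RL t → Option (Matrix p.I2 (Fin p.m) ℤ)), tranKG (fun θ => if h : θ ∈ path ν then some (Z ⟨θ, h⟩) else none)
      (fun θ => if h : θ ∈ kuNodes st RL t then Z' ⟨θ, h⟩ else none) =
      H (Z ⟨θ₀, hθ₁⟩) (Z' ⟨θ₀, hθ₂⟩) := by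
    intro Z Z'
    rw [tranKG_eq (θ₀ := θ₀), dif_pos hθ₁, dif_pos hθ₂]
    · rfl
    · intro θ z₁ z₂ h1 h2
      by_cases h3 : θ ∈ path ν
      · by_cases h4 : θ ∈ kuNodes st RL t
        · exact huniq θ h3 h4
        · rw [dif_neg h4] at h2
          exact absurd h2 (by simp)
      · rw [dif_neg h3] at h1
        exact absurd h1 (by simp)
  have h2 : pz' fresh ⟨θ₀, hθ₂⟩ =
      (sampleMatrix sub.sampleLeft₁ pp.A (timeMat pp t) msk.TA U₀).map some := by
    simp only [hpz', hst', dif_pos hθ₁]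
    rfl
  have h3 : ((indep (pz fresh)).bind fun Z => (indep (pz' fresh)).map fun Z' =>
      H (Z ⟨θ₀, hθ₁⟩) (Z' ⟨θ₀, hθ₂⟩)) = (keyPair sub pp msk id x t U₀).map some := by
    have h4 : ∀ z, ((indep (pz' fresh)).map fun Z' => H z (Z' ⟨θ₀, hθ₂⟩)) =
        (sampleMatrix sub.sampleLeft₁ pp.A (timeMat pp t) msk.TA U₀).map
          fun z₂ => some (z, z₂) := by
      intro z
      have := indep_map_eval (pz' fresh) ⟨θ₀, hθ₂⟩
      rw [h2] at this
      rw [show (fun Z' : ∀ _θ : kuNodes st RL t, Option (Matrix p.I2 (Fin p.m) ℤ) =>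
        H z (Z' ⟨θ₀, hθ₂⟩)) = H z ∘ fun Z' => Z' ⟨θ₀, hθ₂⟩ from rfl, ← PMF.map_comp, this,
        PMF.map_comp]
      rfl
    simp only [h4]
    have h5 := indep_map_eval (pz fresh) ⟨θ₀, hθ₁⟩
    rw [keyPair, PMF.map_bind]
    simp only [PMF.map_comp]
    rw [← show pz fresh ⟨θ₀, hθ₁⟩ = sampleMatrix sub.sampleLeft₁ pp.A (predMat pp.As x) msk.TA
      (idMat pp id - U₀) from rfl, ← h5, PMF.bind_map]
    rfl
  simp only [h1]
  rw [h3, prob_map]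
  rfl

/-- It exhibits the conditional independence, given the setup, of private key, transformation key
and encryption randomness. Each later bound moves the sample it concerns to the last place. -/
theorem honestRun_eq (sub : Subroutines p) (st : State p) (RL : RevList p) (id : p.Ident)
    (ν : p.Leaf) (x : Fin p.ℓ → ZMod p.q) (t : p.Time) :
    honestRun sub st RL id ν x t = (setup sub).bind fun keys =>
      (userKG sub keys.1 keys.2 id x).bind fun sk =>
        (tranDist sub keys.1 keys.2 st RL id ν x t).bind fun tk =>
          (encRand p).map fun r => ⟨keys.1, sk, tk, r⟩ := by
  change PMF.bind _ _ = _
  congr 1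
  funext keys
  change PMF.bind _ _ = _
  congr 1
  funext sk
  rw [tranDist, PMF.bind_bind]
  change PMF.bind _ _ = _
  congr 1
  funext tok
  rw [PMF.bind_map]
  rfl

end Tree

/-! ## Samples that are close to discrete Gaussians -/

section NearGauss

variable {q n : ℕ} {ι : Type} [Fintype ι]

/-- `P` has statistical distance at most `ε` from a discrete Gaussian on a coset of a lattice
that is smooth up to the factor `R`. -/
def NearGauss (P : PMF (ι → ℤ)) (F : Matrix (Fin n) ι (ZMod q)) (u : Fin n → ZMod q)
    (s R ε : ℝ) : Prop :=
  IsSmooth F s (ENNReal.ofReal R) ∧ cosetSum F u s 0 ≠ 0 ∧ cosetSum F u s 0 ≠ ∞ ∧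
    ∃ g : PMF (ι → ℤ), ⇑g = gaussMass F u s ∧ statDist P g ≤ ε

theorem NearGauss.prob_notMem_le {P : PMF (ι → ℤ)} {F : Matrix (Fin n) ι (ZMod q)}
    {u : Fin n → ZMod q} {s R ε : ℝ} (h : NearGauss P F u s R ε) :
    prob P (latCoset F u)ᶜ ≤ 2 * ε := by
  obtain ⟨-, -, -, g, hg, hP⟩ := h
  have := prob_le_of_statDist_le hP (latCoset F u)ᶜ
  rwa [prob_gauss_notMem hg, zero_add] at this

theorem prob_indep_abs_le {c : Type} [Fintype c] {α : c → Type} (p : ∀ j, PMF (α j))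
    (X : ∀ j, α j → ℝ) (a : c → ℝ) {R N τ : ℝ}
    (hX : ∀ i l, ∑' x, p i x * ENNReal.ofReal (Real.exp (l * X i x)) ≤
      ENNReal.ofReal (R * Real.exp (l ^ 2 * a i)))
    (hR : 0 ≤ R) (hN : 0 < N) (hτ : 0 ≤ τ) (ha : ∑ i, a i ≤ N ^ 2) :
    prob (indep p) {f | 2 * τ * N < |∑ i, X i (f i)|} ≤
      2 * (R ^ Fintype.card c * Real.exp (-τ ^ 2)) := by
  have h1 := prob_indep_sum_gt_le p X a hX hR hN hτ ha
  have h2 := prob_indep_sum_gt_le p (fun i x => -X i x) a (fun i l => by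
    have := hX i (-l)
    simpa only [neg_sq, neg_mul, mul_neg] using this) hR hN hτ ha
  refine (prob_le_add (fun f hf => ?_) h1 h2).trans (two_mul _).ge
  rcases lt_abs.1 (show 2 * τ * N < |∑ i, X i (f i)| from hf) with h | h
  · exact Or.inl h
  · refine Or.inr ?_
    change 2 * τ * N < ∑ i, -X i (f i)
    rwa [Finset.sum_neg_distrib]

/-- A Chernoff bound for linear forms in the columns of a matrix of preimages. -/
theorem NearGauss.prob_bilinear_le {c : Type} [Fintype c] {P : c → PMF (ι → ℤ)}
    {F : Matrix (Fin n) ι (ZMod q)} {u : c → Fin n → ZMod q} {s R ε : ℝ} (hs : 0 < s) (hR : 0 ≤ R)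
    (hε : 0 ≤ ε)
    (h : ∀ j, NearGauss (P j) F (u j) s R ε) (y : c → ℝ) (v : ι → ℝ) {N τ : ℝ} (hN : 0 < N)
    (hτ : 0 ≤ τ) (hNy : s ^ 2 * ((∑ j, y j ^ 2) * ∑ i, v i ^ 2) ≤ N ^ 2) :
    prob (indep P) {f | 2 * τ * N < |∑ j, y j * ∑ i, f j i * v i|} ≤
      2 * (R ^ Fintype.card c * Real.exp (-τ ^ 2)) + ((1 + 2 * ε) ^ Fintype.card c - 1) := by
  choose hF hne hnt g hg hPg using h
  refine (prob_indep_le_of_statDist_le P g hPg _ hε).trans ?_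
  refine add_le_add ?_ le_rfl
  refine prob_indep_abs_le g (fun j z => y j * ∑ i, z i * v i)
    (fun j => s ^ 2 * ∑ i, (y j * v i) ^ 2) (fun j l => ?_) hR hN hτ ?_
  · have := tsum_gauss_mul_exp_le (hF j) hs hR (hne j) (hnt j) (hg j) (fun i => y j * v i) l
    simpa only [Finset.mul_sum, mul_left_comm] using this
  · refine le_trans (le_of_eq ?_) hNy
    rw [← Finset.mul_sum, Finset.sum_mul_sum]
    simp only [mul_pow]

theorem NearGauss.prob_coord_le {P : PMF (ι → ℤ)} {F : Matrix (Fin n) ι (ZMod q)}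
    {u : Fin n → ZMod q} {s R ε : ℝ} (hs : 0 < s) (hR : 0 ≤ R) (hε : 0 ≤ ε)
    (h : NearGauss P F u s R ε) (i : ι) {τ : ℝ} (hτ : 0 ≤ τ) :
    prob P {z | 2 * τ * s < |(z i : ℝ)|} ≤ 2 * (R * Real.exp (-τ ^ 2)) + 2 * ε := by
  classical
  have h1 := NearGauss.prob_bilinear_le (c := Unit) hs hR hε (fun _ => h) (fun _ => 1)
    (Pi.single i 1) hs hτ (by simp [Pi.single_apply])
  simp only [Finset.univ_unique, Finset.sum_singleton, Pi.single_apply, one_mul, mul_ite, mul_one,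
    mul_zero, Finset.sum_ite_eq', Finset.mem_univ, if_true, Fintype.card_unit, pow_one,
    add_sub_cancel_left] at h1
  rw [← prob_indep_eval (fun _ : Unit => P) () {z | 2 * τ * s < |(z i : ℝ)|}]
  exact h1

end NearGauss

/-! ## Random signs -/

section Signs

variable {m : ℕ}

/-- The moment generating function of a random sign is a hyperbolic cosine. The sample is a whole
row of signs because an entry of `Rᵀ e` involves one sign from each row, and the rows are
independent. -/
theorem tsum_sign_mul_exp_le (c : ℝ) (b : Fin m) (l : ℝ) :
    ∑' x, PMF.uniformOfFintype (Fin m → ℤˣ) x *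
        ENNReal.ofReal (Real.exp (l * (((x b : ℤˣ) : ℤ) * c))) ≤
      ENNReal.ofReal (1 * Real.exp (l ^ 2 * c ^ 2)) := by
  classical
  set φ : ℤˣ → ℝ≥0∞ := fun v => ENNReal.ofReal (Real.exp (l * ((v : ℤ) * c))) with hφ
  have h1 : ∑' x, PMF.uniformOfFintype (Fin m → ℤˣ) x * φ (x b) =
      ∑' v, PMF.uniformOfFintype ℤˣ v * φ v := by
    have h2 : ∀ x : Fin m → ℤˣ, PMF.uniformOfFintype (Fin m → ℤˣ) x * φ (x b) =
        ∏ i, (PMF.uniformOfFintype ℤˣ (x i) * if i = b then φ (x i) else 1) := by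
      intro x
      rw [Finset.prod_mul_distrib, uniformOfFintype_pi, indep_apply, Finset.prod_ite_eq']
      simp
    rw [tsum_congr h2, tsum_pi_prod (f := fun i v =>
      PMF.uniformOfFintype ℤˣ v * if i = b then φ v else 1), Finset.prod_eq_single b]
    · simp
    · intro i _ hi
      simp only [if_neg hi, mul_one]
      exact PMF.tsum_coe _
    · simp
  change ∑' x, PMF.uniformOfFintype (Fin m → ℤˣ) x * φ (x b) ≤ _
  rw [h1, tsum_fintype]
  have h3 : (Finset.univ : Finset ℤˣ) = {1, -1} := rfl
  have h4 : ((2 : ℝ≥0∞))⁻¹ = ENNReal.ofReal (1 / 2) := by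
    rw [one_div, ENNReal.ofReal_inv_of_pos two_pos, ENNReal.ofReal_ofNat]
  rw [h3, Finset.sum_pair (by decide)]
  simp only [PMF.uniformOfFintype_apply, hφ]
  rw [Fintype.card_units_int, Nat.cast_ofNat, h4, ← ENNReal.ofReal_mul (by norm_num),
    ← ENNReal.ofReal_mul (by norm_num), ← ENNReal.ofReal_add (by positivity) (by positivity)]
  refine ENNReal.ofReal_le_ofReal ?_
  have h5 := Real.cosh_le_exp_half_sq (l * c)
  rw [Real.cosh_eq] at h5
  have h6 : Real.exp ((l * c) ^ 2 / 2) ≤ Real.exp (l ^ 2 * c ^ 2) := by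
    refine Real.exp_le_exp.2 ?_
    rw [mul_pow]
    linarith [mul_nonneg (sq_nonneg l) (sq_nonneg c)]
  have h7 : l * (((1 : ℤˣ) : ℤ) * c) = l * c := by simp
  have h8 : l * (((-1 : ℤˣ) : ℤ) * c) = -(l * c) := by simp
  rw [h7, h8]
  linarith

theorem prob_sign_mulVec_le (e : Fin m → ℤ) {b τ : ℝ} (he : ∀ i, |(e i : ℝ)| ≤ b) (hτ : 0 ≤ τ)
    (j : Fin m) :
    prob (PMF.uniformOfFintype (Matrix (Fin m) (Fin m) ℤˣ))
      {R | 2 * τ * (b * √m) < |((((signMat R)ᵀ *ᵥ e) j : ℤ) : ℝ)|} ≤ 2 * Real.exp (-τ ^ 2) := by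
  have hm : 0 < (m : ℝ) := by exact_mod_cast (Nat.zero_le _).trans_lt j.isLt
  have hX : ∀ R : Matrix (Fin m) (Fin m) ℤˣ, ((((signMat R)ᵀ *ᵥ e) j : ℤ) : ℝ) =
      ∑ i, (((R i j : ℤˣ) : ℤ) : ℝ) * e i := by
    intro R
    simp [Matrix.mulVec, dotProduct, signMat]
  have hb : 0 ≤ b := (abs_nonneg _).trans (he j)
  -- The Chernoff bound requires a positive scale; if `b = 0`, the sum vanishes identically.
  rcases hb.eq_or_lt with hb0 | hb0
  · have h0 : ∀ i, (e i : ℝ) = 0 := fun i =>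
      abs_eq_zero.1 (le_antisymm ((he i).trans hb0.ge) (abs_nonneg _))
    have : {R : Matrix (Fin m) (Fin m) ℤˣ |
        2 * τ * (b * √m) < |((((signMat R)ᵀ *ᵥ e) j : ℤ) : ℝ)|} = ∅ := by
      ext R
      simp only [Set.mem_ofPred_eq, Set.mem_empty_iff_false, iff_false, not_lt, hX, h0, ← hb0]
      simp
    rw [this]
    simp only [prob, MeasureTheory.measure_empty, ENNReal.toReal_zero]
    positivity
  · have h1 := prob_indep_abs_le (fun _ : Fin m => PMF.uniformOfFintype (Fin m → ℤˣ))
      (fun i x => (((x j : ℤˣ) : ℤ) : ℝ) * e i) (fun i => (e i : ℝ) ^ 2) (R := 1) (N := b * √m)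
      (τ := τ) (fun i l => tsum_sign_mul_exp_le (e i) j l) zero_le_one (by positivity) hτ (by
        rw [mul_pow, Real.sq_sqrt hm.le]
        calc ∑ i, (e i : ℝ) ^ 2 ≤ ∑ _i : Fin m, b ^ 2 := Finset.sum_le_sum fun i _ => by
              rw [← sq_abs]
              exact pow_le_pow_left₀ (abs_nonneg _) (he i) 2
          _ = b ^ 2 * m := by
              rw [Finset.sum_const, Finset.card_univ, Fintype.card_fin, nsmul_eq_mul, mul_comm])
    rw [one_pow, one_mul, ← uniformOfFintype_pi] at h1
    refine le_trans (le_of_eq ?_) h1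
    simp only [hX]
    rfl

end Signs

/-! ## The randomness of encryption -/

section EncRand

variable {p : Params}

/-- The encryption randomness is short. -/
structure GoodRand (p : Params) (τ : ℝ) (r : EncRand p) : Prop where
  e_le : ∀ i, |(r.e i : ℝ)| ≤ p.B
  e₁_le : ∀ i, |(r.e₁ i : ℝ)| ≤ p.B
  e₂_le : ∀ i, |(r.e₂ i : ℝ)| ≤ p.B
  Rbar_le : ∀ j, |((((signMat r.Rbar)ᵀ *ᵥ r.e₁) j : ℤ) : ℝ)| ≤ 2 * τ * (p.B * √p.m)
  R_le : ∀ i j, |((((signMat (r.R i))ᵀ *ᵥ r.e₁) j : ℤ) : ℝ)| ≤ 2 * τ * (p.B * √p.m)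
  S_le : ∀ i j, |((((signMat (r.S i))ᵀ *ᵥ r.e₂) j : ℤ) : ℝ)| ≤ 2 * τ * (p.B * √p.m)

theorem prob_noise_le {m : ℕ} {ε : ℝ} (hχ : 1 - ε ≤ prob p.χ {e | |(e : ℝ)| ≤ p.B}) :
    prob (indep fun _ : Fin m => p.χ) {e | ¬ ∀ i, |(e i : ℝ)| ≤ p.B} ≤ m * ε := by
  have h1 : {e : Fin m → ℤ | ¬ ∀ i, |(e i : ℝ)| ≤ p.B} =
      {e | ∃ i, e ∈ {e : Fin m → ℤ | e i ∈ {e : ℤ | |(e : ℝ)| ≤ p.B}ᶜ}} := by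
    ext e
    simp
  rw [h1]
  refine (prob_exists_le (b := ε) _ _ fun i => ?_).trans (by simp)
  rw [prob_indep_eval (fun _ : Fin m => p.χ) i, prob_compl]
  linarith

theorem prob_sign_family_le (e : Fin p.m → ℤ) {τ : ℝ} (he : ∀ i, |(e i : ℝ)| ≤ p.B) (hτ : 0 ≤ τ) :
    prob (PMF.uniformOfFintype (Fin p.ℓ → Matrix (Fin p.m) (Fin p.m) ℤˣ))
      {R | ¬ ∀ i j, |((((signMat (R i))ᵀ *ᵥ e) j : ℤ) : ℝ)| ≤ 2 * τ * (p.B * √p.m)} ≤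
        p.ℓ * (p.m * (2 * Real.exp (-τ ^ 2))) := by
  have h1 : {R : Fin p.ℓ → Matrix (Fin p.m) (Fin p.m) ℤˣ |
      ¬ ∀ i j, |((((signMat (R i))ᵀ *ᵥ e) j : ℤ) : ℝ)| ≤ 2 * τ * (p.B * √p.m)} =
      {R | ∃ i, R ∈ {R | ∃ j, R ∈ {R : Fin p.ℓ → Matrix (Fin p.m) (Fin p.m) ℤˣ | R i ∈
        {R | 2 * τ * (p.B * √p.m) < |((((signMat R)ᵀ *ᵥ e) j : ℤ) : ℝ)|}}}} := by
    ext R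
    simp
  rw [h1]
  refine (prob_exists_le (b := p.m * (2 * Real.exp (-τ ^ 2))) _ _ fun i => ?_).trans (by simp)
  refine (prob_exists_le (b := 2 * Real.exp (-τ ^ 2)) _ _ fun j => ?_).trans (by simp)
  rw [uniformOfFintype_pi, prob_indep_eval]
  exact prob_sign_mulVec_le e he hτ j

theorem prob_bind_le_add {α β : Type} {P : PMF α} {f : α → PMF β} {S : Set β} (T : Set α)
    {a b : ℝ} (hT : prob P T ≤ a) (hb : 0 ≤ b) (h : ∀ x ∉ T, prob (f x) S ≤ b) :
    prob (P.bind f) S ≤ a + b :=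
  (prob_bind_le T hb h).trans (add_le_add hT le_rfl)

theorem encRand_eq (p : Params) : encRand p =
    (PMF.uniformOfFintype (Fin p.n → ZMod p.q)).bind fun s =>
      (indep fun _ : Fin p.κ => p.χ).bind fun e => (indep fun _ : Fin p.m => p.χ).bind fun e₁ =>
        (indep fun _ : Fin p.m => p.χ).bind fun e₂ =>
          (PMF.uniformOfFintype (Matrix (Fin p.m) (Fin p.m) ℤˣ)).bind fun Rbar =>
            (PMF.uniformOfFintype (Fin p.ℓ → Matrix (Fin p.m) (Fin p.m) ℤˣ)).bind fun R =>
              (PMF.uniformOfFintype (Fin p.ℓ → Matrix (Fin p.m) (Fin p.m) ℤˣ)).bind fun S =>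
                PMF.pure ⟨s, e, e₁, e₂, Rbar, R, S⟩ := rfl

theorem prob_not_goodRand_le {ε τ : ℝ} (hε : 0 ≤ ε)
    (hχ : 1 - ε ≤ prob p.χ {e | |(e : ℝ)| ≤ p.B}) (hτ : 0 ≤ τ) :
    prob (encRand p) {r | ¬ GoodRand p τ r} ≤ (p.κ + 2 * p.m) * ε +
      (2 * p.ℓ + 1) * p.m * (2 * Real.exp (-τ ^ 2)) := by
  set δ := 2 * Real.exp (-τ ^ 2) with hδ
  have hδ0 : 0 ≤ δ := by positivity
  have h1 : prob (encRand p) {r | ¬ GoodRand p τ r} ≤ p.κ * ε + (p.m * ε + (p.m * ε +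
      (p.m * δ + (p.ℓ * (p.m * δ) + p.ℓ * (p.m * δ))))) := by
    rw [encRand_eq]
    have hm0 : (0 : ℝ) ≤ p.m := Nat.cast_nonneg _
    have hℓ0 : (0 : ℝ) ≤ p.ℓ := Nat.cast_nonneg _
    have hmε := mul_nonneg hm0 hε
    have hmδ := mul_nonneg hm0 hδ0
    have hℓδ := mul_nonneg hℓ0 hmδ
    refine prob_bind_le_of_forall fun s => ?_
    refine prob_bind_le_add _ (prob_noise_le (m := p.κ) hχ)
      (by linarith) fun e he => ?_
    refine prob_bind_le_add _ (prob_noise_le (m := p.m) hχ)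
      (by linarith) fun e₁ he₁ => ?_
    refine prob_bind_le_add _ (prob_noise_le (m := p.m) hχ)
      (by linarith) fun e₂ he₂ => ?_
    have he := not_not.1 he
    have he₁ := not_not.1 he₁
    have he₂ := not_not.1 he₂
    refine prob_bind_le_add {R | ∃ j, R ∈ {R : Matrix (Fin p.m) (Fin p.m) ℤˣ |
      2 * τ * (p.B * √p.m) < |((((signMat R)ᵀ *ᵥ e₁) j : ℤ) : ℝ)|}}
      ((prob_exists_le (b := δ) _ _ fun j => prob_sign_mulVec_le e₁ he₁ hτ j).trans (by simp))
      (by linarith) fun Rbar hRbar => ?_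
    refine prob_bind_le_add _ (prob_sign_family_le e₁ he₁ hτ) hℓδ fun R hR => ?_
    rw [← add_zero ((p.ℓ : ℝ) * (p.m * δ))]
    refine prob_bind_le_add _ (prob_sign_family_le e₂ he₂ hτ) le_rfl fun S hS => ?_
    have hR := not_not.1 hR
    have hS := not_not.1 hS
    have hRbar : ∀ j, |((((signMat Rbar)ᵀ *ᵥ e₁) j : ℤ) : ℝ)| ≤ 2 * τ * (p.B * √p.m) := fun j =>
      not_lt.1 fun h => hRbar ⟨j, h⟩
    rw [prob_pure, if_neg]
    exact not_not.2 ⟨he, he₁, he₂, hRbar, hR, hS⟩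
  refine h1.trans (le_of_eq ?_)
  ring

end EncRand

/-! ## Preimage matrices sampled with a good trapdoor -/

section Sampling

variable {p : Params}

/-- `T` is a basis for the full-rank matrix `A` that is short enough for sampling with the width
factor `w`. -/
structure GoodKey (p : Params) (w : ℝ) (A : p.Mat) (T : Matrix (Fin p.m) (Fin p.m) ℤ) : Prop where
  fullRank : FullRank A
  basis : IsLatticeBasis A T
  short : gsNorm T * w ≤ p.s

theorem IsSmooth.mono {q n : ℕ} {ι : Type} [Fintype ι] {F : Matrix (Fin n) ι (ZMod q)} {s : ℝ}
    {R R' : ℝ≥0∞} (h : IsSmooth F s R) (hR : R ≤ R') : IsSmooth F s R' := fun u u' c c' =>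
  (h u u' c c').trans (mul_le_mul_left hR _)

theorem ofReal_exp_pow (x : ℝ) (k : ℕ) :
    ENNReal.ofReal (Real.exp x) ^ k = ENNReal.ofReal (Real.exp (k * x)) := by
  rw [← ENNReal.ofReal_pow (Real.exp_pos _).le, ← Real.exp_nat_mul]

theorem GoodKey.isSmooth {w : ℝ} {A : p.Mat} {T : Matrix (Fin p.m) (Fin p.m) ℤ}
    (h : GoodKey p w A T) (hw : 1 ≤ w) :
    IsSmooth A p.s (ENNReal.ofReal (Real.exp (p.m * smoothErr w))) := by
  rw [← ofReal_exp_pow]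
  refine isSmooth_of_gramSchmidt h.fullRank h.basis.1 (fun a => (h.basis.2 _).2 ⟨a, rfl⟩) hw
    fun j => le_trans ?_ h.short
  exact mul_le_mul_of_nonneg_right (le_ciSup (f := fun j =>
    ‖InnerProductSpace.gramSchmidt ℝ (euclCol T) j‖) (Set.finite_range _).bddAbove j)
    (zero_le_one.trans hw)

theorem GoodKey.nearGauss {ι : Type} [Fintype ι] {w ε R : ℝ} {A : p.Mat}
    {T : Matrix (Fin p.m) (Fin p.m) ℤ} (h : GoodKey p w A T) (hw : 1 ≤ w) (hws : w ≤ p.s)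
    (hR : Real.exp (4 * p.m * smoothErr w) ≤ R) (hι : Fintype.card ι ≤ 2 * p.m)
    (M : Matrix (Fin p.n) ι (ZMod p.q)) (u : Fin p.n → ZMod p.q) {P : PMF (Fin p.m ⊕ ι → ℤ)}
    (hP : statDist P (gaussMass (Matrix.fromCols A M) u p.s) ≤ ε) :
    NearGauss P (Matrix.fromCols A M) u p.s R ε := by
  have hex := FullRank.fromCols h.fullRank M u
  refine ⟨((h.isSmooth hw).fromCols hw hws M).mono ?_, cosetSum_ne_zero hex _ _,
    cosetSum_ne_top hw hws _, ?_⟩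
  · rw [ofReal_exp_pow, ← ENNReal.ofReal_mul (Real.exp_pos _).le,
      ← ENNReal.ofReal_mul (by positivity), ← Real.exp_add, ← Real.exp_add]
    refine ENNReal.ofReal_le_ofReal (le_trans (Real.exp_le_exp.2 ?_) hR)
    -- The exponents are `m` for each of the two factors `R` and `card ι ≤ 2 m` for the extra
    -- columns, hence the constant `4`.
    have h1 : (Fintype.card ι : ℝ) ≤ 2 * p.m := by exact_mod_cast hι
    have h2 := mul_le_mul_of_nonneg_right h1 (smoothErr_nonneg w)
    linarith
  · obtain ⟨g, hg⟩ := exists_gaussPMF hw hws hex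
    exact ⟨g, hg, hg ▸ hP⟩

theorem mul_modQ_eq_iff {q n : ℕ} {ι c : Type} [Fintype ι] (F : Matrix (Fin n) ι (ZMod q))
    (Z : Matrix ι c ℤ) (U : Matrix (Fin n) c (ZMod q)) :
    F * modQ q Z = U ↔ ∀ j, (fun i => Z i j) ∈ latCoset F fun i => U i j := by
  constructor
  · rintro rfl j
    rfl
  · intro h
    ext i j
    exact congrFun (h j) i

/-! ### Matrices of preimages: syndromes, entries and bilinear forms -/

section Columns

variable {ι : Type} [Fintype ι] {c : ℕ} {sl : Sampler p ι} {A : p.Mat}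
  {M : Matrix (Fin p.n) ι (ZMod p.q)} {T : Matrix (Fin p.m) (Fin p.m) ℤ}
  {U : Matrix (Fin p.n) (Fin c) (ZMod p.q)} {R ε τ : ℝ}

theorem prob_sampleMatrix_mul_ne_le
    (h : ∀ u, NearGauss (sl A M T u) (Matrix.fromCols A M) u p.s R ε) :
    prob (sampleMatrix sl A M T U) {Z | Matrix.fromCols A M * modQ p.q Z ≠ U} ≤ c * (2 * ε) := by
  rw [sampleMatrix, prob_map]
  refine le_trans (prob_mono (T := {f | ∃ j, f ∈ {f : Fin c → Fin p.m ⊕ ι → ℤ | f j ∈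
    (latCoset (Matrix.fromCols A M) fun i => U i j)ᶜ}}) fun f hf => ?_)
    ((prob_exists_le (b := 2 * ε) _ _ fun j => ?_).trans (by simp))
  · by_contra hne
    refine hf ((mul_modQ_eq_iff _ _ _).2 fun j => ?_)
    by_contra hj
    exact hne ⟨j, hj⟩
  · rw [prob_indep_eval (fun j : Fin c => sl A M T fun i => U i j) j]
    exact (h _).prob_notMem_le

theorem prob_sampleMatrix_entry_le (hR : 0 ≤ R) (hε : 0 ≤ ε) (hτ : 0 ≤ τ)
    (h : ∀ u, NearGauss (sl A M T u) (Matrix.fromCols A M) u p.s R ε) :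
    prob (sampleMatrix sl A M T U) {Z | ¬ ∀ i j, |(Z i j : ℝ)| ≤ 2 * τ * p.s} ≤
      c * ((p.m + Fintype.card ι) * (2 * (R * Real.exp (-τ ^ 2)) + 2 * ε)) := by
  rw [sampleMatrix, prob_map]
  refine le_trans (prob_mono (T := {f | ∃ j, f ∈ {f : Fin c → Fin p.m ⊕ ι → ℤ | f j ∈
    {z | ∃ i, z ∈ {z : Fin p.m ⊕ ι → ℤ | 2 * τ * p.s < |(z i : ℝ)|}}}}) fun f hf => ?_)
    ((prob_exists_le (b := (p.m + Fintype.card ι) * (2 * (R * Real.exp (-τ ^ 2)) + 2 * ε))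
      _ _ fun j => ?_).trans (by simp))
  · by_contra hne
    refine hf fun i j => ?_
    by_contra hj
    exact hne ⟨j, i, not_le.1 hj⟩
  · rw [prob_indep_eval (fun j : Fin c => sl A M T fun i => U i j) j]
    refine (prob_exists_le _ _ fun i => (h _).prob_coord_le p.s_pos hR hε i hτ).trans
      (le_of_eq ?_)
    rw [Fintype.card_sum, Fintype.card_fin, Nat.cast_add]

/-- The columns of `Z` are independent and subgaussian, so the deviation is of order `s ‖y‖ ‖v‖`. It
grows with the square root of the number of entries of `Z`; the triangle inequality would give the
number itself, a loss of order `m` for the keys of the scheme. -/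
theorem prob_sampleMatrix_bilinear_le (hR : 0 ≤ R) (hε : 0 ≤ ε) (hτ : 0 ≤ τ)
    (h : ∀ u, NearGauss (sl A M T u) (Matrix.fromCols A M) u p.s R ε) (y : Fin c → ℤ)
    (v : Fin p.m ⊕ ι → ℤ) {a Y W : ℝ} (ha : 0 < a) (hac : c * (p.m + Fintype.card ι) ≤ a ^ 2)
    (hY0 : 0 ≤ Y) (hW0 : 0 ≤ W) (hY : ∀ j, |(y j : ℝ)| ≤ Y) (hW : ∀ i, |(v i : ℝ)| ≤ W) :
    prob (sampleMatrix sl A M T U)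
        {Z | 2 * τ * (p.s * a * (Y * W)) < |(((Z *ᵥ y) ⬝ᵥ v : ℤ) : ℝ)|} ≤
      2 * (R ^ c * Real.exp (-τ ^ 2)) + ((1 + 2 * ε) ^ c - 1) := by
  have hsum : ∀ f : Fin c → Fin p.m ⊕ ι → ℤ,
      ((((Matrix.of fun i j => f j i) *ᵥ y) ⬝ᵥ v : ℤ) : ℝ) =
        ∑ j, (y j : ℝ) * ∑ i, (f j i : ℝ) * v i := by
    intro f
    simp only [Matrix.mulVec, dotProduct, Matrix.of_apply, Int.cast_sum, Int.cast_mul,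
      Finset.sum_mul, Finset.mul_sum]
    rw [Finset.sum_comm]
    exact Finset.sum_congr rfl fun j _ => Finset.sum_congr rfl fun i _ => by ring
  have hs := p.s_pos
  rw [sampleMatrix, prob_map]
  -- If `Y * W = 0`, the form vanishes and the Chernoff bound has no positive scale.
  rcases (mul_nonneg hY0 hW0).eq_or_lt with h0 | h0
  · have h1 : (fun f : Fin c → Fin p.m ⊕ ι → ℤ => Matrix.of fun i j => f j i) ⁻¹'
        {Z | 2 * τ * (p.s * a * (Y * W)) < |(((Z *ᵥ y) ⬝ᵥ v : ℤ) : ℝ)|} = ∅ := by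
      refine Set.eq_empty_of_forall_notMem fun f hf => ?_
      change 2 * τ * (p.s * a * (Y * W)) <
        |((((Matrix.of fun i j => f j i) *ᵥ y) ⬝ᵥ v : ℤ) : ℝ)| at hf
      rw [hsum, ← h0, mul_zero, mul_zero, abs_pos] at hf
      refine hf (Finset.sum_eq_zero fun j _ => ?_)
      rcases mul_eq_zero.1 h0.symm with hz | hz
      · have hy : (y j : ℝ) = 0 := abs_eq_zero.1 (le_antisymm (hz ▸ hY j) (abs_nonneg _))
        rw [hy, zero_mul]
      · rw [Finset.sum_eq_zero fun i _ => ?_, mul_zero]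
        have hv : (v i : ℝ) = 0 := abs_eq_zero.1 (le_antisymm (hz ▸ hW i) (abs_nonneg _))
        rw [hv, mul_zero]
    rw [h1]
    simp only [prob, MeasureTheory.measure_empty, ENNReal.toReal_zero]
    have : (1 : ℝ) ≤ (1 + 2 * ε) ^ c := one_le_pow₀ (by linarith)
    have : 0 ≤ 2 * (R ^ c * Real.exp (-τ ^ 2)) := by positivity
    linarith
  · have h1 := NearGauss.prob_bilinear_le (N := p.s * a * (Y * W)) hs hR hε
      (fun j : Fin c => h fun i => U i j) (fun j => (y j : ℝ)) (fun i => (v i : ℝ)) (by positivity)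
      hτ ?_
    · rw [Fintype.card_fin] at h1
      refine le_trans (le_of_eq ?_) h1
      simp only [← hsum]
      rfl
    · have hy : ∑ j, (y j : ℝ) ^ 2 ≤ c * Y ^ 2 := by
        refine (Finset.sum_le_card_nsmul _ _ (Y ^ 2) fun j _ => ?_).trans (by simp)
        rw [← sq_abs]
        exact pow_le_pow_left₀ (abs_nonneg _) (hY j) 2
      have hv : ∑ i, (v i : ℝ) ^ 2 ≤ (p.m + Fintype.card ι) * W ^ 2 := by
        refine (Finset.sum_le_card_nsmul _ _ (W ^ 2) fun j _ => ?_).trans (by simp)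
        rw [← sq_abs]
        exact pow_le_pow_left₀ (abs_nonneg _) (hW j) 2
      calc p.s ^ 2 * ((∑ j, (y j : ℝ) ^ 2) * ∑ i, (v i : ℝ) ^ 2)
          ≤ p.s ^ 2 * ((c * Y ^ 2) * ((p.m + Fintype.card ι) * W ^ 2)) := by
            gcongr
        _ = c * (p.m + Fintype.card ι) * (p.s * (Y * W)) ^ 2 := by ring
        _ ≤ a ^ 2 * (p.s * (Y * W)) ^ 2 := by gcongr
        _ = _ := by ring

end Columns

end Sampling

/-! ## The honest execution for one value of the security parameter -/

section Concrete

/-- Quantitative form of the assumptions for one value of the security parameter: all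
statistical errors are at most `ε`, the lattices in use are smooth up to the factor `R`, and
`τ` is the deviation in the tail bounds. -/
structure Adequate (p : Params) (sub : Subroutines p) (C w ε R τ : ℝ) : Prop where
  m_pos : 0 < p.m
  one_le_w : 1 ≤ w
  gadget_le : 2 * √(Nat.clog 2 p.q : ℕ) * w ≤ p.s
  trapdoor_le : C * √(p.n * Real.logb 2 p.q) * w ≤ p.s
  ε_nonneg : 0 ≤ ε
  one_le_τ : 1 ≤ τ
  le_R : Real.exp (4 * p.m * smoothErr w) ≤ R
  R_le : R ≤ 2
  R_pow_le : R ^ p.m ≤ 2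
  pow_le : (1 + 2 * ε) ^ p.m - 1 ≤ 4 * p.m * ε
  trapGen_uniform : statDist (sub.trapGen.map Prod.fst) (PMF.uniformOfFintype p.Mat) ≤ ε
  trapGen_short : 1 - ε ≤ prob sub.trapGen {AT | IsLatticeBasis AT.1 AT.2 ∧
    gsNorm AT.2 ≤ C * √(p.n * Real.logb 2 p.q) ∧ colNorm AT.2 ≤ C * (p.n * Real.logb 2 p.q)}
  sampleLeft₁ : ∀ A M T u, FullRank A → IsLatticeBasis A T → gsNorm T * w ≤ p.s →
    statDist (sub.sampleLeft₁ A M T u) (gaussMass (Matrix.fromCols A M) u p.s) ≤ ε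
  sampleLeft₂ : ∀ A M T u, FullRank A → IsLatticeBasis A T → gsNorm T * w ≤ p.s →
    statDist (sub.sampleLeft₂ A M T u) (gaussMass (Matrix.fromCols A M) u p.s) ≤ ε
  noise : 1 - ε ≤ prob p.χ {e | |(e : ℝ)| ≤ p.B}

variable {p : Params} {sub : Subroutines p} {C w ε R τ : ℝ}

theorem Params.one_le_clog (p : Params) : 1 ≤ Nat.clog 2 p.q :=
  Nat.clog_pos one_lt_two p.one_lt_q

namespace Adequate

variable (h : Adequate p sub C w ε R τ)
include h

theorem w_le_s : w ≤ p.s := by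
  refine le_trans ?_ h.gadget_le
  have h1 : 1 ≤ √(Nat.clog 2 p.q : ℝ) := Real.one_le_sqrt.2 (by exact_mod_cast p.one_le_clog)
  have := h.one_le_w
  nlinarith

theorem one_le_R : 1 ≤ R :=
  (Real.one_le_exp (by have := smoothErr_nonneg w; positivity)).trans h.le_R

theorem nearGauss₁ {A : p.Mat} {T : Matrix (Fin p.m) (Fin p.m) ℤ} (hk : GoodKey p w A T)
    (M : p.Mat) (u : Fin p.n → ZMod p.q) :
    NearGauss (sub.sampleLeft₁ A M T u) (Matrix.fromCols A M) u p.s R ε :=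
  hk.nearGauss h.one_le_w h.w_le_s h.le_R (by rw [Fintype.card_fin]; omega) M u
    (h.sampleLeft₁ A M T u hk.fullRank hk.basis hk.short)

theorem nearGauss₂ {A : p.Mat} {T : Matrix (Fin p.m) (Fin p.m) ℤ} (hk : GoodKey p w A T)
    (M : Matrix (Fin p.n) p.I2 (ZMod p.q)) (u : Fin p.n → ZMod p.q) :
    NearGauss (sub.sampleLeft₂ A M T u) (Matrix.fromCols A M) u p.s R ε :=
  hk.nearGauss h.one_le_w h.w_le_s h.le_R (by rw [Fintype.card_sum, Fintype.card_fin]; omega) M u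
    (h.sampleLeft₂ A M T u hk.fullRank hk.basis hk.short)

theorem prob_not_goodKey_le :
    prob sub.trapGen {AT | ¬ GoodKey p w AT.1 AT.2} ≤
      (p.q : ℝ) ^ p.n * (1 / 2) ^ p.m + 2 * ε + ε := by
  refine prob_le_add (T := {AT | ¬ FullRank AT.1}) (U := {AT | IsLatticeBasis AT.1 AT.2 ∧
    gsNorm AT.2 ≤ C * √(p.n * Real.logb 2 p.q) ∧
      colNorm AT.2 ≤ C * (p.n * Real.logb 2 p.q)}ᶜ) (fun AT hAT => ?_) ?_ ?_
  · by_contra hne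
    rw [Set.mem_union, not_or] at hne
    have h1 := not_not.1 hne.1
    have h2 := not_not.1 hne.2
    exact hAT ⟨h1, h2.1, (mul_le_mul_of_nonneg_right h2.2.1
      (zero_le_one.trans h.one_le_w)).trans h.trapdoor_le⟩
  · have h1 := prob_le_of_statDist_le h.trapGen_uniform {A | ¬ FullRank A}
    rw [prob_map] at h1
    exact h1.trans (add_le_add prob_not_fullRank_le le_rfl)
  · rw [prob_compl]
    linarith [h.trapGen_short]

theorem prob_setup_bad_le :
    prob (setup sub) {keys | ¬ (GoodKey p w keys.1.A keys.2.TA ∧ GoodKey p w keys.1.B keys.2.TB)} ≤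
      2 * ((p.q : ℝ) ^ p.n * (1 / 2) ^ p.m + 3 * ε) := by
  have h0 := h.ε_nonneg
  set η := (p.q : ℝ) ^ p.n * (1 / 2) ^ p.m + 2 * ε + ε with hη
  have hη0 : 0 ≤ η := by positivity
  have h1 : prob (setup sub)
      {keys | ¬ (GoodKey p w keys.1.A keys.2.TA ∧ GoodKey p w keys.1.B keys.2.TB)} ≤
        η + (η + 0) := by
    change prob (PMF.bind _ fun AT => PMF.bind _ fun BT => PMF.bind _ fun V => PMF.bind _ fun C =>
      PMF.bind _ fun D => PMF.bind _ fun As => PMF.bind _ fun Bs => PMF.pure _) _ ≤ _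
    refine prob_bind_le_add _ h.prob_not_goodKey_le (by simpa using hη0) fun AT hAT => ?_
    refine prob_bind_le_add _ h.prob_not_goodKey_le le_rfl fun BT hBT => ?_
    refine prob_bind_le_of_forall fun V => prob_bind_le_of_forall fun C =>
      prob_bind_le_of_forall fun D => prob_bind_le_of_forall fun As =>
        prob_bind_le_of_forall fun Bs => ?_
    rw [prob_pure, if_neg]
    exact not_not.2 ⟨not_not.1 hAT, not_not.1 hBT⟩
  refine h1.trans (le_of_eq ?_)
  rw [hη]
  ring

theorem prob_userKG_bad_le {pp : PublicParams p} {msk : MasterKey p} (hk : GoodKey p w pp.B msk.TB)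
    (id : p.Ident) (x : Fin p.ℓ → ZMod p.q) :
    prob (userKG sub pp msk id x) {sk | ¬ (Matrix.fromCols pp.B
      (Matrix.fromCols (predMat pp.Bs x) (idMat pp id)) * modQ p.q sk = pp.V ∧
        ∀ i j, |(sk i j : ℝ)| ≤ 2 * τ * p.s)} ≤
      p.κ * (2 * ε) + p.κ * (3 * p.m * (4 * Real.exp (-τ ^ 2) + 2 * ε)) := by
  have hR0 := zero_le_one.trans h.one_le_R
  have hτ0 := zero_le_one.trans h.one_le_τ
  refine prob_le_add (T := {sk | Matrix.fromCols pp.B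
      (Matrix.fromCols (predMat pp.Bs x) (idMat pp id)) * modQ p.q sk ≠ pp.V})
    (U := {sk | ¬ ∀ i j, |(sk i j : ℝ)| ≤ 2 * τ * p.s}) (fun sk hsk => not_and_or.1 hsk)
    (prob_sampleMatrix_mul_ne_le fun u => h.nearGauss₂ hk _ u)
    ((prob_sampleMatrix_entry_le hR0 h.ε_nonneg hτ0 fun u => h.nearGauss₂ hk _ u).trans ?_)
  rw [Fintype.card_sum, Fintype.card_fin]
  have h1 : R * Real.exp (-τ ^ 2) ≤ 2 * Real.exp (-τ ^ 2) :=
    mul_le_mul_of_nonneg_right h.R_le (Real.exp_pos _).le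
  refine mul_le_mul_of_nonneg_left ?_ (Nat.cast_nonneg _)
  rw [show (p.m : ℝ) + ((p.m + p.m : ℕ) : ℝ) = 3 * p.m by push_cast; ring]
  refine mul_le_mul_of_nonneg_left ?_ (by positivity)
  linarith

/-- The good event for the transformation key, given vectors `y j` and `v₁`, `v₂`. -/
theorem prob_keyPair_bad_le {pp : PublicParams p} {msk : MasterKey p}
    (hk : GoodKey p w pp.A msk.TA) (id : p.Ident) (x : Fin p.ℓ → ZMod p.q) (t : p.Time) (U : p.Mat)
    {c : ℕ} (y : Fin c → Fin p.m → ℤ) (v₁ v₂ : p.I2 → ℤ) {Y W : ℝ} (hY0 : 0 ≤ Y) (hW0 : 0 ≤ W)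
    (hY : ∀ j a, |(y j a : ℝ)| ≤ Y) (hv₁ : ∀ i, |(v₁ i : ℝ)| ≤ W) (hv₂ : ∀ i, |(v₂ i : ℝ)| ≤ W) :
    prob (keyPair sub pp msk id x t U) {tk | ¬ (
      Matrix.fromCols pp.A (predMat pp.As x) * modQ p.q tk.1 = idMat pp id - U ∧
      Matrix.fromCols pp.A (timeMat pp t) * modQ p.q tk.2 = U ∧
      (∀ j, |(((tk.1 *ᵥ y j) ⬝ᵥ v₁ : ℤ) : ℝ)| ≤ 2 * τ * (p.s * (2 * p.m) * (Y * W))) ∧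
      ∀ j, |(((tk.2 *ᵥ y j) ⬝ᵥ v₂ : ℤ) : ℝ)| ≤ 2 * τ * (p.s * (2 * p.m) * (Y * W)))} ≤
      2 * (p.m * (2 * ε) + c * (4 * Real.exp (-τ ^ 2) + 4 * p.m * ε)) := by
  have hR0 := zero_le_one.trans h.one_le_R
  have hτ0 := zero_le_one.trans h.one_le_τ
  have hε0 := h.ε_nonneg
  have hm : (0 : ℝ) < p.m := by exact_mod_cast h.m_pos
  have key : ∀ (M V : p.Mat) (v : p.I2 → ℤ), (∀ i, |(v i : ℝ)| ≤ W) →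
      prob (sampleMatrix sub.sampleLeft₁ pp.A M msk.TA V)
        {Z | ¬ (Matrix.fromCols pp.A M * modQ p.q Z = V ∧
          ∀ j, |(((Z *ᵥ y j) ⬝ᵥ v : ℤ) : ℝ)| ≤ 2 * τ * (p.s * (2 * p.m) * (Y * W)))} ≤
        p.m * (2 * ε) + c * (4 * Real.exp (-τ ^ 2) + 4 * p.m * ε) := by
    intro M V v hv
    refine prob_le_add (T := {Z | Matrix.fromCols pp.A M * modQ p.q Z ≠ V})
      (U := {Z | ∃ j, Z ∈ {Z : Matrix p.I2 (Fin p.m) ℤ | 2 * τ * (p.s * (2 * p.m) * (Y * W)) <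
        |(((Z *ᵥ y j) ⬝ᵥ v : ℤ) : ℝ)|}}) (fun Z hZ => ?_)
      (prob_sampleMatrix_mul_ne_le fun u => h.nearGauss₁ hk _ u)
      ((prob_exists_le (b := 4 * Real.exp (-τ ^ 2) + 4 * p.m * ε) _ _ fun j => ?_).trans (by simp))
    · rcases not_and_or.1 hZ with h1 | h1
      · exact Or.inl h1
      · obtain ⟨j, hj⟩ := not_forall.1 h1
        exact Or.inr ⟨j, not_le.1 hj⟩
    · refine (prob_sampleMatrix_bilinear_le hR0 hε0 hτ0 (fun u => h.nearGauss₁ hk _ u) (y j) v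
        (a := 2 * p.m) (by positivity) ?_ hY0 hW0 (hY j) hv).trans
        (add_le_add ?_ h.pow_le)
      -- The matrix has `2 m` rows and `m` columns, and `m * (2 m) ≤ (2 m)²`.
      · rw [Fintype.card_fin]
        nlinarith
      · have := mul_le_mul_of_nonneg_right h.R_pow_le (Real.exp_pos (-τ ^ 2)).le
        linarith
  set δ := p.m * (2 * ε) + c * (4 * Real.exp (-τ ^ 2) + 4 * p.m * ε) with hδ
  have hδ0 : 0 ≤ δ := by positivity
  rw [two_mul δ, keyPair]
  refine prob_bind_le_add _ (key (predMat pp.As x) (idMat pp id - U) v₁ hv₁) hδ0 fun Z₁ hZ₁ => ?_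
  rw [prob_map]
  refine le_trans (prob_mono fun Z₂ hZ₂ => ?_) (key (timeMat pp t) U v₂ hv₂)
  intro hne
  have hZ₁ := not_not.1 hZ₁
  exact hZ₂ ⟨hZ₁.1, hne.1, hZ₁.2, hne.2⟩

end Adequate

/-- A deterministic bound for the decryption error. -/
theorem GoodRand.errorTerm_abs_le {r : EncRand p} (hr : GoodRand p τ r) (hm : 0 < p.m)
    (hℓ : 1 ≤ p.ℓ) (hτ : 1 ≤ τ) (hs : 1 ≤ p.s) {σ : ℝ} (hσ : 1 ≤ σ) (hsσ : p.s ≤ σ * √p.m)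
    {x : Fin p.ℓ → ZMod p.q} {sk : Matrix p.I3 (Fin p.κ) ℤ} {tk : TransKey p}
    (hsk : ∀ i j, |(sk i j : ℝ)| ≤ 2 * τ * p.s)
    (h₁ : ∀ j, |(((tk.1 *ᵥ fun a => sk (Sum.inr (Sum.inr a)) j) ⬝ᵥ
      Sum.elim r.e₁ ((signPred r.R x)ᵀ *ᵥ r.e₁) : ℤ) : ℝ)| ≤ 2 * τ * (p.s * (2 * p.m) *
        (2 * τ * p.s * (p.ℓ * Nat.clog 2 p.q * (2 * τ * (p.B * √p.m))))))
    (h₂ : ∀ j, |(((tk.2 *ᵥ fun a => sk (Sum.inr (Sum.inr a)) j) ⬝ᵥ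
      Sum.elim r.e₁ ((signMat r.Rbar)ᵀ *ᵥ r.e₁) : ℤ) : ℝ)| ≤ 2 * τ * (p.s * (2 * p.m) *
        (2 * τ * p.s * (p.ℓ * Nat.clog 2 p.q * (2 * τ * (p.B * √p.m)))))) (j : Fin p.κ) :
    |(errorTerm x sk tk r j : ℝ)| ≤
      p.s * p.ℓ * p.m ^ 2 * p.B * (40 * σ * Nat.clog 2 p.q * τ ^ 3) := by
  have hB : 0 ≤ p.B := (abs_nonneg _).trans (hr.e₁_le ⟨0, hm⟩)
  have hτ0 := zero_le_one.trans hτ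
  refine (SRPE.errorTerm_abs_le (h := 2 * τ * (p.B * √p.m)) (c := 2 * τ * p.s) (by positivity)
    (mul_nonneg (by positivity) p.s_pos.le) hr.e_le hr.e₂_le hr.S_le hsk h₁ h₂ j).trans ?_
  have hm1 : (1 : ℝ) ≤ p.m := by exact_mod_cast hm
  have hℓ1 : (1 : ℝ) ≤ p.ℓ := by exact_mod_cast hℓ
  have hK1 : (1 : ℝ) ≤ Nat.clog 2 p.q := by exact_mod_cast p.one_le_clog
  have hrs := Real.sq_sqrt (zero_le_one.trans hm1)
  have hr1 : 1 ≤ √(p.m : ℝ) := Real.one_le_sqrt.2 hm1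
  generalize (Nat.clog 2 p.q : ℝ) = K at hK1 ⊢
  generalize √(p.m : ℝ) = d at hrs hr1 hsσ ⊢
  generalize p.s = s at hs hsσ ⊢
  generalize (p.ℓ : ℝ) = l at hℓ1 ⊢
  generalize p.B = b at hB ⊢
  generalize (p.m : ℝ) = m at hm1 hrs ⊢
  have hs0 : 0 ≤ s := zero_le_one.trans hs
  have hσ0 : 0 ≤ σ := zero_le_one.trans hσ
  have hK0 : 0 ≤ K := zero_le_one.trans hK1
  have hm0 : 0 ≤ m := zero_le_one.trans hm1
  have hl0 : 0 ≤ l := zero_le_one.trans hℓ1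
  have hd0 : 0 ≤ d := zero_le_one.trans hr1
  -- Each summand is compared with `s l m² b σ K τ³`. The coefficients are `1`, `2`, `4` and `32`;
  -- the constant `40` exceeds their sum by one.
  have e1 : b * 1 ≤ b * (τ ^ 3 * σ * K * s * l * m ^ 2) := by
    refine mul_le_mul_of_nonneg_left ?_ hB
    have h3 : 1 ≤ τ ^ 3 := one_le_pow₀ hτ
    have h4 : 1 ≤ m ^ 2 := one_le_pow₀ hm1
    exact one_le_mul_of_one_le_of_one_le (one_le_mul_of_one_le_of_one_le
      (one_le_mul_of_one_le_of_one_le (one_le_mul_of_one_le_of_one_le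
        (one_le_mul_of_one_le_of_one_le h3 hσ) hK1) hs) hℓ1) h4
  have e2 : (2 * b * s * m * τ) * 1 ≤ (2 * b * s * m * τ) * (τ ^ 2 * σ * K * l * m) := by
    refine mul_le_mul_of_nonneg_left ?_ (by positivity)
    have h3 : 1 ≤ τ ^ 2 := one_le_pow₀ hτ
    exact one_le_mul_of_one_le_of_one_le (one_le_mul_of_one_le_of_one_le
      (one_le_mul_of_one_le_of_one_le (one_le_mul_of_one_le_of_one_le h3 hσ) hK1) hℓ1) hm1
  have e3 : (4 * τ ^ 2 * s * l * K * b * m) * d ≤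
      (4 * τ ^ 2 * s * l * K * b * m) * (τ * σ * m) := by
    refine mul_le_mul_of_nonneg_left ?_ (by positivity)
    calc d ≤ d ^ 2 := by nlinarith
      _ = 1 * m := by rw [hrs, one_mul]
      _ ≤ τ * σ * m := mul_le_mul_of_nonneg_right (one_le_mul_of_one_le_of_one_le hτ hσ) hm0
  -- The dominant term has two factors `s`, one from `Z` and one from the transformation key. The
  -- second is exchanged for `σ √m`, which completes the power `m²`.
  have e4 : (32 * τ ^ 3 * m * s * l * K * b) * (s * d) ≤
      (32 * τ ^ 3 * m * s * l * K * b) * (σ * m) := by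
    refine mul_le_mul_of_nonneg_left ?_ (by positivity)
    calc s * d ≤ σ * d * d := mul_le_mul_of_nonneg_right hsσ hd0
      _ = σ * m := by rw [← hrs]; ring
  have e5 : 0 ≤ s * l * m ^ 2 * b * (σ * K * τ ^ 3) := by positivity
  linarith

end Concrete

/-! ## Correctness of the honest execution -/

section Runs

variable {p : Params} {sub : Subroutines p} {C w ε R τ : ℝ}

/-- All congruences between the keys hold, and the decryption error is at most `b`. -/
def SoundRun (b : ℝ) (id : p.Ident) (x : Fin p.ℓ → ZMod p.q) (t : p.Time) (ρ : Transcript p) :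
    Prop :=
  ∃ tk U, ρ.tk = some tk ∧
    Matrix.fromCols ρ.pp.B (Matrix.fromCols (predMat ρ.pp.Bs x) (idMat ρ.pp id)) *
      modQ p.q ρ.sk = ρ.pp.V ∧
    Matrix.fromCols ρ.pp.A (predMat ρ.pp.As x) * modQ p.q tk.1 = idMat ρ.pp id - U ∧
    Matrix.fromCols ρ.pp.A (timeMat ρ.pp t) * modQ p.q tk.2 = U ∧
    ∀ i, |(errorTerm x ρ.sk tk ρ.r i : ℝ)| ≤ b

theorem GoodRand.signs_le {r : EncRand p} (hr : GoodRand p τ r) (hm : 0 < p.m) (hℓ : 1 ≤ p.ℓ)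
    (hτ : 1 ≤ τ) (x : Fin p.ℓ → ZMod p.q) :
    0 ≤ p.ℓ * Nat.clog 2 p.q * (2 * τ * (p.B * √p.m)) ∧
    (∀ i, |((Sum.elim r.e₁ ((signPred r.R x)ᵀ *ᵥ r.e₁) i : ℤ) : ℝ)| ≤
      p.ℓ * Nat.clog 2 p.q * (2 * τ * (p.B * √p.m))) ∧
    ∀ i, |((Sum.elim r.e₁ ((signMat r.Rbar)ᵀ *ᵥ r.e₁) i : ℤ) : ℝ)| ≤
      p.ℓ * Nat.clog 2 p.q * (2 * τ * (p.B * √p.m)) := by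
  have hB : 0 ≤ p.B := (abs_nonneg _).trans (hr.e₁_le ⟨0, hm⟩)
  have hm1 : 1 ≤ √(p.m : ℝ) := Real.one_le_sqrt.2 (by exact_mod_cast hm)
  have hℓ1 : (1 : ℝ) ≤ p.ℓ := by exact_mod_cast hℓ
  have hK1 : (1 : ℝ) ≤ Nat.clog 2 p.q := by exact_mod_cast p.one_le_clog
  have hh : 0 ≤ 2 * τ * (p.B * √p.m) := by positivity
  have h1 : 2 * τ * (p.B * √p.m) ≤ p.ℓ * Nat.clog 2 p.q * (2 * τ * (p.B * √p.m)) :=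
    le_mul_of_one_le_left hh (one_le_mul_of_one_le_of_one_le hℓ1 hK1)
  have h2 : p.B ≤ 2 * τ * (p.B * √p.m) := by
    have : p.B * 1 ≤ p.B * (2 * τ * √p.m) := mul_le_mul_of_nonneg_left
      (one_le_mul_of_one_le_of_one_le (by linarith) hm1) hB
    linarith
  refine ⟨by positivity, ?_, ?_⟩
  · rintro (i | i)
    · exact (hr.e₁_le i).trans (h2.trans h1)
    · exact signPred_abs_le hh hr.R_le x i
  · rintro (i | i)
    · exact (hr.e₁_le i).trans (h2.trans h1)
    · exact (hr.Rbar_le i).trans h1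

/-- The probability that an honest execution is not sound. -/
def unsoundBound (p : Params) (ε τ : ℝ) : ℝ :=
  2 * ((p.q : ℝ) ^ p.n * (1 / 2) ^ p.m + 3 * ε) +
    ((p.κ * (2 * ε) + p.κ * (3 * p.m * (4 * Real.exp (-τ ^ 2) + 2 * ε))) +
      (((p.κ + 2 * p.m) * ε + (2 * p.ℓ + 1) * p.m * (2 * Real.exp (-τ ^ 2))) +
        2 * (p.m * (2 * ε) + p.κ * (4 * Real.exp (-τ ^ 2) + 4 * p.m * ε))))

theorem Adequate.prob_not_soundRun_le (h : Adequate p sub C w ε R τ) (hℓ : 1 ≤ p.ℓ) {σ : ℝ}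
    (hσ : 1 ≤ σ) (hsσ : p.s ≤ σ * √p.m) {st : State p} {RL : RevList p} {id : p.Ident} {ν : p.Leaf}
    {t : p.Time} (hl : st.leaf id = some ν) (hr : ¬ Revoked RL id t) (x : Fin p.ℓ → ZMod p.q) :
    prob (honestRun sub st RL id ν x t) {ρ | ¬ SoundRun
      (p.s * p.ℓ * p.m ^ 2 * p.B * (40 * σ * Nat.clog 2 p.q * τ ^ 3)) id x t ρ} ≤
        unsoundBound p ε τ := by
  have hε0 := h.ε_nonneg
  have hτ0 := zero_le_one.trans h.one_le_τ
  have hs1 : 1 ≤ p.s := h.one_le_w.trans h.w_le_s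
  have hm := h.m_pos
  rw [honestRun_eq, unsoundBound]
  refine prob_bind_le_add _ h.prob_setup_bad_le (by positivity) fun keys hkeys => ?_
  have hkeys := not_not.1 hkeys
  refine prob_bind_le_add _ (h.prob_userKG_bad_le hkeys.2 id x) (by positivity) fun sk hsk => ?_
  have hsk := not_not.1 hsk
  -- The transformation key is drawn last, so that the vectors paired with it are already fixed when
  -- its tail bound is applied.
  have hcomm : ((tranDist sub keys.1 keys.2 st RL id ν x t).bind fun tk =>
      (encRand p).map fun r => (⟨keys.1, sk, tk, r⟩ : Transcript p)) =
      (encRand p).bind fun r => (tranDist sub keys.1 keys.2 st RL id ν x t).map fun tk =>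
        ⟨keys.1, sk, tk, r⟩ := PMF.bind_comm _ _ _
  rw [hcomm]
  refine prob_bind_le_add _ (prob_not_goodRand_le hε0 h.noise hτ0) (by positivity) fun r hgr => ?_
  have hgr : GoodRand p τ r := not_not.1 hgr
  rw [prob_map]
  refine prob_tranDist_le sub keys.1 keys.2 x hl hr _ fun U => ?_
  obtain ⟨hW0, hv₁, hv₂⟩ := hgr.signs_le hm hℓ h.one_le_τ x
  refine (prob_mono fun tk htk => ?_).trans (h.prob_keyPair_bad_le hkeys.1 id x t U
    (fun (j : Fin p.κ) a => sk (Sum.inr (Sum.inr a)) j) _ _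
    (by positivity : 0 ≤ 2 * τ * p.s) hW0 (fun j a => hsk.2 _ _) hv₁ hv₂)
  intro hgood
  exact htk ⟨tk, U, rfl, hsk.1, hgood.1, hgood.2.1,
    hgr.errorTerm_abs_le hm hℓ h.one_le_τ hs1 hσ hsσ hsk.2 hgood.2.2.1 hgood.2.2.2⟩

theorem SoundRun.decVec_eq {b : ℝ} {id : p.Ident} {x : Fin p.ℓ → ZMod p.q} {t : p.Time}
    {ρ : Transcript p} (hρ : SoundRun b id x t ρ) (y : Fin p.ℓ → ZMod p.q) (M : Bool) :
    ∃ tk, ρ.tk = some tk ∧ (∀ i, |(errorTerm x ρ.sk tk ρ.r i : ℝ)| ≤ b) ∧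
      decVec x (ρ.partialCt x y t M tk) ρ.sk =
        ((p.q / 2 : ℕ) : ZMod p.q) • vecModQ p.q (encode p.κ M) +
          vecModQ p.q (errorTerm x ρ.sk tk ρ.r) -
          fun j => residual ρ.sk tk j ⬝ᵥ (x ⬝ᵥ y) • ρ.r.s := by
  obtain ⟨tk, U, h0, h1, h2, h3, h4⟩ := hρ
  exact ⟨tk, h0, h4, SRPE.decVec_eq ρ.pp id t x y M ρ.r tk ρ.sk U h1 h2 h3⟩

theorem SoundRun.dec_eq_some {b : ℝ} {id : p.Ident} {x : Fin p.ℓ → ZMod p.q} {t : p.Time}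
    {ρ : Transcript p} (hρ : SoundRun b id x t ρ) {y : Fin p.ℓ → ZMod p.q} (hxy : x ⬝ᵥ y = 0)
    (hb : b < p.q / 5) (hq : 10 < p.q) (hκ : 0 < p.κ) (M : Bool) :
    ∃ tk, ρ.tk = some tk ∧
      decVec x (ρ.partialCt x y t M tk) ρ.sk =
        ((p.q / 2 : ℕ) : ZMod p.q) • vecModQ p.q (encode p.κ M) +
          vecModQ p.q (errorTerm x ρ.sk tk ρ.r) ∧
      (∀ i, |(errorTerm x ρ.sk tk ρ.r i : ℝ)| ≤ b) ∧
      dec x (ρ.partialCt x y t M tk) ρ.sk = some M := by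
  obtain ⟨tk, h0, h1, h2⟩ := hρ.decVec_eq y M
  have h3 : decVec x (ρ.partialCt x y t M tk) ρ.sk =
      ((p.q / 2 : ℕ) : ZMod p.q) • vecModQ p.q (encode p.κ M) +
        vecModQ p.q (errorTerm x ρ.sk tk ρ.r) := by
    rw [h2, hxy]
    ext j
    simp
  refine ⟨tk, h0, h3, h1, SRPE.dec_eq_some hκ ?_⟩
  funext i
  rw [h3]
  exact roundTwo_encode hq _ (encode_mem _ _) _ ((h1 i).trans_lt hb)

/-- The event that the decryption of a ciphertext for an orthogonal complement is not ruled out by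
the masking terms. -/
def UnmaskedRun (a : ZMod p.q) (ρ : Transcript p) : Prop :=
  ∃ tk, ρ.tk = some tk ∧ (a • ρ.r.s = 0 ∨ ∀ i : Fin p.κ, i.val ≠ 0 →
    -(1 / 8) ≤ (ZMod.stdAddChar (residual ρ.sk tk i ⬝ᵥ a • ρ.r.s)).re)

/-- Outside coordinate `0` the encoding is zero. If decryption succeeded, `d` would round to `0`
there, and the mask would be the difference of a small error and `d`. -/
theorem SoundRun.dec_eq_none {b : ℝ} {id : p.Ident} {x : Fin p.ℓ → ZMod p.q} {t : p.Time}
    {ρ : Transcript p} (hρ : SoundRun b id x t ρ) (y : Fin p.ℓ → ZMod p.q)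
    (hu : ¬ UnmaskedRun (x ⬝ᵥ y) ρ) (hb : b ≤ p.q / 100) (M : Bool) :
    ∃ tk, ρ.tk = some tk ∧ dec x (ρ.partialCt x y t M tk) ρ.sk = none := by
  obtain ⟨tk, h0, h1, h2⟩ := hρ.decVec_eq y M
  refine ⟨tk, h0, ?_⟩
  by_contra hne
  refine hu ⟨tk, h0, Or.inr fun i hi => stdAddChar_re_ge (roundTwo_eq_zero_of_dec hne i hi)
    ((h1 i).trans hb) ?_⟩
  rw [h2]
  simp [vecModQ, encode, hi]

theorem prob_encRand_smul_eq_zero_le {a : ZMod p.q} (ha : a ≠ 0) :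
    prob (encRand p) {r | a • r.s = 0} ≤ (1 / 2) ^ p.n := by
  rw [encRand_eq, ← add_zero ((1 / 2 : ℝ) ^ p.n)]
  refine prob_bind_le_add _ (prob_smul_eq_zero_le ha) le_rfl fun s hs => ?_
  refine prob_bind_le_of_forall fun e => prob_bind_le_of_forall fun e₁ =>
    prob_bind_le_of_forall fun e₂ => prob_bind_le_of_forall fun Rbar =>
      prob_bind_le_of_forall fun R => prob_bind_le_of_forall fun S => ?_
  rw [prob_pure, if_neg]
  exact hs

theorem card_stdAddChar_dotProduct_re_le {q n : ℕ} [NeZero q] {v : Fin n → ZMod q} (hv : v ≠ 0) :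
    ((Finset.univ.filter fun u : Fin n → ZMod q =>
      -(1 / 8) ≤ (ZMod.stdAddChar (u ⬝ᵥ v)).re).card : ℝ) ≤ 7 / 8 * (q : ℝ) ^ n := by
  set ψ : AddChar (Fin n → ZMod q) ℂ :=
    { toFun := fun u => ZMod.stdAddChar (u ⬝ᵥ v)
      map_zero_eq_one' := by simp
      map_add_eq_mul' := fun u u' => by rw [add_dotProduct, AddChar.map_add_eq_mul] } with hψ
  have h1 : ψ ≠ 1 := by
    intro h1
    refine hv (funext fun i => ?_)
    have h2 : ψ (Pi.single i 1) = 1 := by rw [h1]; rfl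
    have h3 : ZMod.stdAddChar (v i) = ZMod.stdAddChar (0 : ZMod q) := by
      rw [AddChar.map_zero_eq_one, ← h2]
      change _ = ZMod.stdAddChar (Pi.single i 1 ⬝ᵥ v)
      rw [single_one_dotProduct]
    exact ZMod.injective_stdAddChar h3
  have h2 := card_char_re_le h1
  rw [Fintype.card_fun, ZMod.card, Fintype.card_fin, Nat.cast_pow] at h2
  exact h2

end Runs

/-! ### Masking when the inner product is nonzero -/

section Masking

variable {p : Params} {sub : Subroutines p} {C w ε R τ : ℝ}

theorem gaussian_mul_card_le {x : ℝ} {q n c : ℕ} (hq : 0 < q) {R : ℝ} (hR : 0 ≤ R)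
    (hc : (c : ℝ) ≤ x * (q : ℝ) ^ n) : R * R * R * ((c : ℝ) / (q : ℝ) ^ n) ≤ x * R ^ 3 := by
  have h1 : (c : ℝ) / (q : ℝ) ^ n ≤ x := (div_le_iff₀ (by positivity)).2 hc
  calc R * R * R * ((c : ℝ) / (q : ℝ) ^ n) ≤ R * R * R * x := by gcongr
    _ = x * R ^ 3 := by ring

namespace Adequate

variable (h : Adequate p sub C w ε R τ)
include h

theorem exp_smoothErr_le : Real.exp (p.m * smoothErr w) ≤ R := by
  refine (Real.exp_le_exp.2 ?_).trans h.le_R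
  have := mul_nonneg (Nat.cast_nonneg (α := ℝ) p.m) (smoothErr_nonneg w)
  linarith

theorem isSmooth_gadget : IsSmooth p.G p.s (ENNReal.ofReal R) := by
  have h1 := SRPE.isSmooth_gadget p.one_lt_q p.block_le h.m_pos h.one_le_w h.gadget_le
  rw [ofReal_exp_pow] at h1
  exact h1.mono (ENNReal.ofReal_le_ofReal h.exp_smoothErr_le)

theorem prob_gauss_middle_le {A : p.Mat} {T : Matrix (Fin p.m) (Fin p.m) ℤ} (hk : GoodKey p w A T)
    {M : Matrix (Fin p.n) p.I2 (ZMod p.q)} {u : Fin p.n → ZMod p.q} {g : PMF (p.I3 → ℤ)}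
    (hg : ⇑g = gaussMass (Matrix.fromCols A M) u p.s)
    (f : (Fin p.m → ℤ) → Fin p.n → ZMod p.q) (S : Finset (Fin p.n → ZMod p.q)) {x : ℝ}
    (hS : (S.card : ℝ) ≤ x * (p.q : ℝ) ^ p.n) :
    prob g {z | p.G *ᵥ vecModQ p.q (fun i => z (Sum.inr (Sum.inl i))) +
      f (fun i => z (Sum.inr (Sum.inr i))) ∈ S} ≤ x * R ^ 3 := by
  have hR0 := zero_le_one.trans h.one_le_R
  exact (SRPE.prob_gauss_middle_le ((hk.isSmooth h.one_le_w).mono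
    (ENNReal.ofReal_le_ofReal h.exp_smoothErr_le)) h.isSmooth_gadget hR0 hR0 hg f S).trans
    (gaussian_mul_card_le p.q_primePow.pos hR0 hS)

/-- For a fixed transformation key, the masks of all coordinates have a large real part only with
exponentially small probability. -/
theorem prob_userKG_masks_le {pp : PublicParams p} {msk : MasterKey p}
    (hk : GoodKey p w pp.B msk.TB) (id : p.Ident) (x : Fin p.ℓ → ZMod p.q) (hκ : 0 < p.κ)
    (tk : TransKey p) {v : Fin p.n → ZMod p.q} (hv : v ≠ 0) :
    prob (userKG sub pp msk id x) {sk | ∀ i : Fin p.κ, i.val ≠ 0 →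
      -(1 / 8) ≤ (ZMod.stdAddChar (residual sk tk i ⬝ᵥ v)).re} ≤
        (7 / 8 * R ^ 3 + 2 * ε) ^ (p.κ - 1) := by
  rw [userKG, sampleMatrix, prob_map]
  refine (prob_mono (T := {f | ∀ i, f i ∈ {z : p.I3 → ℤ | i.val ≠ 0 → -(1 / 8) ≤
    (ZMod.stdAddChar ((p.G *ᵥ vecModQ p.q (fun a => z (Sum.inr (Sum.inl a))) +
      p.G *ᵥ (modQ p.q (tk.1.submatrix Sum.inr fun b => b) *ᵥ
        vecModQ p.q fun a => z (Sum.inr (Sum.inr a)))) ⬝ᵥ v)).re}}) ?_).trans ?_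
  · intro f hf i hi
    exact hf i hi
  -- Coordinate `0` carries the message and is dropped, which leaves `κ - 1` independent columns.
  rw [prob_indep_pi, ← Finset.mul_prod_erase _ _ (Finset.mem_univ (⟨0, hκ⟩ : Fin p.κ))]
  have hR0 := zero_le_one.trans h.one_le_R
  have hε0 := h.ε_nonneg
  have hcard : (Finset.univ.erase (⟨0, hκ⟩ : Fin p.κ)).card = p.κ - 1 := by
    rw [Finset.card_erase_of_mem (Finset.mem_univ _), Finset.card_univ, Fintype.card_fin]
  rw [← hcard, ← one_mul ((7 / 8 * R ^ 3 + 2 * ε) ^ _)]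
  refine mul_le_mul (prob_le_one _ _) ?_ (Finset.prod_nonneg fun i _ => prob_nonneg _ _)
    zero_le_one
  rw [← Finset.prod_const]
  refine Finset.prod_le_prod (fun i _ => prob_nonneg _ _) fun i hi => ?_
  have hi0 : i.val ≠ 0 := fun h0 => (Finset.mem_erase.1 hi).1 (Fin.ext h0)
  obtain ⟨-, -, -, g, hg, hd⟩ := h.nearGauss₂ hk
    (Matrix.fromCols (predMat pp.Bs x) (idMat pp id)) fun a => pp.V a i
  refine (prob_le_of_statDist_le hd _).trans (add_le_add ?_ le_rfl)
  refine le_trans (prob_mono fun z hz => ?_) (h.prob_gauss_middle_le hk hg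
    (fun z₃ => p.G *ᵥ (modQ p.q (tk.1.submatrix Sum.inr fun b => b) *ᵥ vecModQ p.q z₃)) _
    (card_stdAddChar_dotProduct_re_le hv))
  exact Finset.mem_filter.2 ⟨Finset.mem_univ _, hz hi0⟩

theorem prob_unmaskedRun_le (hκ : 0 < p.κ) {a : ZMod p.q} (ha : a ≠ 0) (st : State p)
    (RL : RevList p) (id : p.Ident) (ν : p.Leaf) (x : Fin p.ℓ → ZMod p.q) (t : p.Time) :
    prob (honestRun sub st RL id ν x t) {ρ | UnmaskedRun a ρ} ≤
      2 * ((p.q : ℝ) ^ p.n * (1 / 2) ^ p.m + 3 * ε) +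
        ((1 / 2) ^ p.n + (7 / 8 * R ^ 3 + 2 * ε) ^ (p.κ - 1)) := by
  have hR0 := zero_le_one.trans h.one_le_R
  have hε0 := h.ε_nonneg
  rw [honestRun_eq]
  refine prob_bind_le_add _ h.prob_setup_bad_le (by positivity) fun keys hkeys => ?_
  have hkeys := not_not.1 hkeys
  -- Here the private key is drawn last: the masks are random in `Z` for a fixed transformation key
  -- and a fixed encryption secret.
  have hcomm : ((userKG sub keys.1 keys.2 id x).bind fun sk =>
      (tranDist sub keys.1 keys.2 st RL id ν x t).bind fun tk =>
        (encRand p).map fun r => (⟨keys.1, sk, tk, r⟩ : Transcript p)) =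
      (tranDist sub keys.1 keys.2 st RL id ν x t).bind fun tk => (encRand p).bind fun r =>
        (userKG sub keys.1 keys.2 id x).map fun sk => ⟨keys.1, sk, tk, r⟩ := by
    rw [PMF.bind_comm]
    congr 1
    funext tk
    exact PMF.bind_comm _ _ _
  rw [hcomm]
  refine prob_bind_le_of_forall fun tk => ?_
  refine prob_bind_le_add _ (prob_encRand_smul_eq_zero_le ha) (by positivity) fun r hr => ?_
  rw [prob_map]
  cases tk with
  | none =>
    refine le_trans (le_of_eq ?_) (by positivity : (0 : ℝ) ≤ _)
    rw [show (fun sk => (⟨keys.1, sk, none, r⟩ : Transcript p)) ⁻¹' {ρ | UnmaskedRun a ρ} = ∅ from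
      Set.eq_empty_of_forall_notMem fun sk ⟨tk, htk, _⟩ => by simp at htk]
    simp [prob]
  | some tk =>
    refine le_trans (prob_mono fun sk hsk => ?_) (h.prob_userKG_masks_le hkeys.2 id x hκ tk hr)
    obtain ⟨tk', htk, h1 | h1⟩ := hsk
    · exact absurd h1 hr
    · obtain rfl : tk = tk' := Option.some.inj htk
      exact h1

/-- `G Z²` is almost uniform. -/
theorem prob_middle_le (hκ : (1 + 2 * ε) ^ p.κ - 1 ≤ 4 * p.κ * ε) (st : State p)
    (RL : RevList p) (id : p.Ident) (ν : p.Leaf) (x : Fin p.ℓ → ZMod p.q) (t : p.Time)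
    (S : Set (Matrix (Fin p.n) (Fin p.κ) (ZMod p.q))) :
    prob ((honestRun sub st RL id ν x t).map fun ρ => p.G * modQ p.q (middle ρ.sk)) S ≤
      prob (PMF.uniformOfFintype (Matrix (Fin p.n) (Fin p.κ) (ZMod p.q))) S +
        (2 * ((p.q : ℝ) ^ p.n * (1 / 2) ^ p.m + 3 * ε) + 4 * p.κ * ε +
          ((R ^ 3) ^ p.κ - 1)) := by
  classical
  have hR1 := h.one_le_R
  have hε0 := h.ε_nonneg
  have hR3 : 1 ≤ (R ^ 3) ^ p.κ := one_le_pow₀ (one_le_pow₀ hR1)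
  set u := prob (PMF.uniformOfFintype (Matrix (Fin p.n) (Fin p.κ) (ZMod p.q))) S with hu
  have hu0 : 0 ≤ u := prob_nonneg _ _
  have hu1 : u ≤ 1 := prob_le_one _ _
  have hb0 : 0 ≤ (R ^ 3) ^ p.κ * u + 4 * p.κ * ε := by positivity
  have key : prob ((honestRun sub st RL id ν x t).map fun ρ => p.G * modQ p.q (middle ρ.sk)) S ≤
      2 * ((p.q : ℝ) ^ p.n * (1 / 2) ^ p.m + 3 * ε) + ((R ^ 3) ^ p.κ * u + 4 * p.κ * ε) := by
    rw [prob_map, honestRun_eq]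
    refine prob_bind_le_add _ h.prob_setup_bad_le hb0 fun keys hkeys => ?_
    have hkeys := not_not.1 hkeys
    have hcomm : ((userKG sub keys.1 keys.2 id x).bind fun sk =>
        (tranDist sub keys.1 keys.2 st RL id ν x t).bind fun tk =>
          (encRand p).map fun r => (⟨keys.1, sk, tk, r⟩ : Transcript p)) =
        (tranDist sub keys.1 keys.2 st RL id ν x t).bind fun tk => (encRand p).bind fun r =>
          (userKG sub keys.1 keys.2 id x).map fun sk => ⟨keys.1, sk, tk, r⟩ := by
      rw [PMF.bind_comm]
      congr 1
      funext tk
      exact PMF.bind_comm _ _ _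
    rw [hcomm]
    refine prob_bind_le_of_forall fun tk => prob_bind_le_of_forall fun r => ?_
    rw [prob_map, userKG, sampleMatrix, prob_map]
    have hng := fun i : Fin p.κ => h.nearGauss₂ hkeys.2
      (Matrix.fromCols (predMat keys.1.Bs x) (idMat keys.1 id)) fun a => keys.1.V a i
    choose _ _ _ g hg hd using hng
    refine (prob_indep_le_of_statDist_le _ g hd _ hε0).trans (add_le_add ?_ ?_)
    · set Gz : (Fin p.κ → p.I3 → ℤ) → Matrix (Fin p.n) (Fin p.κ) (ZMod p.q) := fun f =>
        Matrix.of fun a i => (p.G *ᵥ vecModQ p.q fun b => f i (Sum.inr (Sum.inl b))) a with hGz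
      -- Every value has at most `R^(3κ)` times its uniform mass. Summation over `S` gives a
      -- one-sided comparison of probabilities, which bounds the statistical distance.
      have h1 : ∀ W : Matrix (Fin p.n) (Fin p.κ) (ZMod p.q),
          prob (indep g) {f | Gz f = W} ≤ (1 / (p.q : ℝ) ^ p.n * R ^ 3) ^ p.κ := by
        intro W
        have h2 : {f | Gz f = W} ⊆ {f | ∀ i, f i ∈ {z : p.I3 → ℤ |
            p.G *ᵥ vecModQ p.q (fun b => z (Sum.inr (Sum.inl b))) + 0 ∈
              ({fun a => W a i} : Finset (Fin p.n → ZMod p.q))}} := by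
          rintro f rfl i
          simp [hGz]
        refine (prob_mono h2).trans ?_
        rw [prob_indep_pi]
        refine (Finset.prod_le_prod (g := fun _ => 1 / (p.q : ℝ) ^ p.n * R ^ 3)
          (fun i _ => prob_nonneg _ _) fun i _ => ?_).trans (by simp)
        refine h.prob_gauss_middle_le hkeys.2 (hg i) (fun _ => 0) _ ?_
        rw [Finset.card_singleton, Nat.cast_one, one_div, inv_mul_cancel₀]
        have := p.q_primePow.pos
        positivity
      have h3 := prob_exists_le (ι := S) (indep g) (fun W => {f | Gz f = W.1}) fun W => h1 W.1
      refine le_trans (prob_mono (T := {f | ∃ W : S, f ∈ {f | Gz f = W.1}})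
        (fun f hf => ⟨⟨Gz f, hf⟩, rfl⟩)) (h3.trans (le_of_eq ?_))
      rw [hu, prob_uniform, Nat.card_eq_fintype_card]
      have h4 : (Fintype.card (Matrix (Fin p.n) (Fin p.κ) (ZMod p.q)) : ℝ) =
          ((p.q : ℝ) ^ p.n) ^ p.κ := by
        rw [show Fintype.card (Matrix (Fin p.n) (Fin p.κ) (ZMod p.q)) =
          Fintype.card (Fin p.n → Fin p.κ → ZMod p.q) from rfl]
        simp only [Fintype.card_fun, ZMod.card, Fintype.card_fin]
        push_cast
        rw [← pow_mul, ← pow_mul, mul_comm]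
      rw [h4, mul_pow, one_div, inv_pow]
      ring
    · rwa [Fintype.card_fin]
  refine key.trans ?_
  have : ((R ^ 3) ^ p.κ - 1) * u ≤ ((R ^ 3) ^ p.κ - 1) * 1 :=
    mul_le_mul_of_nonneg_left hu1 (by linarith)
  linarith

end Adequate

end Masking

/-! ## Asymptotic calculus -/

section Asymptotic

open Topology

variable {f g e : ℕ → ℝ}

theorem Negligible.of_isBigO (he : Negligible e) (h : f =O[atTop] e) : Negligible f := by
  obtain ⟨c, hc⟩ := h.bound
  refine SuperpolynomialDecay.trans_eventually_abs_le (SuperpolynomialDecay.const_mul he c) ?_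
  filter_upwards [hc] with k hk
  simp only [Function.comp, abs_mul]
  simp only [Real.norm_eq_abs] at hk
  exact hk.trans (mul_le_mul_of_nonneg_right (le_abs_self c) (abs_nonneg _))

theorem Negligible.of_le (he : Negligible e) (h : ∀ᶠ k in atTop, |f k| ≤ |e k|) :
    Negligible f :=
  SuperpolynomialDecay.trans_eventually_abs_le he h

theorem Negligible.congr (he : Negligible e) (h : ∀ᶠ k in atTop, e k = f k) : Negligible f :=
  SuperpolynomialDecay.congr' he h

theorem Negligible.abs (he : Negligible e) : Negligible fun k => |e k| :=
  he.of_le (Eventually.of_forall fun _ => (abs_abs _).le)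

theorem Negligible.add (hf : Negligible f) (hg : Negligible g) : Negligible fun k => f k + g k :=
  SuperpolynomialDecay.add hf hg

theorem Negligible.const_mul (hf : Negligible f) (c : ℝ) : Negligible fun k => c * f k :=
  SuperpolynomialDecay.const_mul hf c

theorem Negligible.tendsto (hf : Negligible f) : Tendsto f atTop (𝓝 0) := by
  simpa using hf 0

theorem PolyBounded.mul_negligible (hf : PolyBounded f) (he : Negligible e) :
    Negligible fun k => f k * e k := by
  obtain ⟨c, hc⟩ := hf
  exact Negligible.of_isBigO (SuperpolynomialDecay.param_pow_mul he c)
    (hc.mul (isBigO_refl e atTop))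

theorem PolyBounded.mul (hf : PolyBounded f) (hg : PolyBounded g) :
    PolyBounded fun k => f k * g k := by
  obtain ⟨c, hc⟩ := hf
  obtain ⟨d, hd⟩ := hg
  exact ⟨c + d, by simpa only [pow_add] using hc.mul hd⟩

theorem PolyBounded.of_isBigO (hg : PolyBounded g) (h : f =O[atTop] g) : PolyBounded f := by
  obtain ⟨c, hc⟩ := hg
  exact ⟨c, h.trans hc⟩

theorem polyBounded_const (c : ℝ) : PolyBounded fun _ => c :=
  ⟨0, by simpa using isBigO_const_const c (one_ne_zero (α := ℝ)) (atTop : Filter ℕ)⟩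

theorem PolyBounded.pow (hf : PolyBounded f) (d : ℕ) : PolyBounded fun k => f k ^ d := by
  obtain ⟨c, hc⟩ := hf
  exact ⟨c * d, by simpa only [pow_mul] using hc.pow d⟩

theorem eventually_one_le_log : ∀ᶠ k : ℕ in atTop, 1 ≤ Real.log k :=
  (Real.tendsto_log_atTop.comp tendsto_natCast_atTop_atTop).eventually_ge_atTop 1

theorem isLittleO_log_pow (c : ℕ) :
    (fun k : ℕ => Real.log k ^ c) =o[atTop] fun k : ℕ => (k : ℝ) :=
  Real.isLittleO_pow_log_id_atTop.comp_tendsto tendsto_natCast_atTop_atTop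

/-- The logarithm of a polynomially bounded function. -/
theorem PolyBounded.log_isBigO (hf : PolyBounded f) (h1 : ∀ᶠ k in atTop, 1 ≤ f k) :
    (fun k => Real.log (f k)) =O[atTop] fun k : ℕ => Real.log (k : ℝ) := by
  obtain ⟨d, hd⟩ := hf
  obtain ⟨C, hC⟩ := hd.bound
  refine IsBigO.of_bound (|Real.log (max C 1)| + d) ?_
  filter_upwards [hC, h1, eventually_one_le_log, eventually_ge_atTop 1] with k hk h1 hl hk1
  have hk0 : (0 : ℝ) < k := by exact_mod_cast hk1
  rw [Real.norm_of_nonneg (Real.log_nonneg h1), Real.norm_of_nonneg (zero_le_one.trans hl)]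
  rw [Real.norm_of_nonneg (zero_le_one.trans h1), Real.norm_of_nonneg (by positivity)] at hk
  have hC1 : (0 : ℝ) < max C 1 := lt_max_of_lt_right one_pos
  calc Real.log (f k) ≤ Real.log (max C 1 * (k : ℝ) ^ d) :=
        Real.log_le_log (zero_lt_one.trans_le h1)
          (hk.trans (mul_le_mul_of_nonneg_right (le_max_left _ _) (by positivity)))
    _ = Real.log (max C 1) + d * Real.log k := by
        rw [Real.log_mul hC1.ne' (by positivity), Real.log_pow]
    _ ≤ |Real.log (max C 1)| * Real.log k + d * Real.log k := by
        have := le_abs_self (Real.log (max C 1))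
        nlinarith [abs_nonneg (Real.log (max C 1))]
    _ = _ := by ring

/-- Powers of the single function `log k` replace logarithms of various polynomially bounded
quantities, so that polylogarithmic factors can be multiplied. -/
theorem SoftO.exists_isBigO (h : SoftO f g) (hg : PolyBounded g) (h1 : ∀ᶠ k in atTop, 1 ≤ g k) :
    ∃ c : ℕ, f =O[atTop] fun k => g k * Real.log k ^ c := by
  obtain ⟨c, hc⟩ := h
  exact ⟨c, hc.trans ((isBigO_refl g atTop).mul ((hg.log_isBigO h1).pow c))⟩

theorem polyBounded_log_pow (c : ℕ) : PolyBounded fun k : ℕ => Real.log k ^ c :=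
  ⟨1, by simpa using (isLittleO_log_pow c).isBigO⟩

theorem SoftO.polyBounded (h : SoftO f g) (hg : PolyBounded g) (h1 : ∀ᶠ k in atTop, 1 ≤ g k) :
    PolyBounded f := by
  obtain ⟨c, hc⟩ := h.exists_isBigO hg h1
  exact (hg.mul (polyBounded_log_pow c)).of_isBigO hc

theorem negligible_exp_neg (h : ∀ a : ℕ, ∀ᶠ k : ℕ in atTop, a * Real.log k ≤ f k) :
    Negligible fun k => Real.exp (-f k) := by
  intro a
  refine squeeze_zero' (Eventually.of_forall fun k => by positivity) ?_
    (tendsto_inv_atTop_zero.comp (tendsto_natCast_atTop_atTop (R := ℝ)))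
  filter_upwards [h (a + 1), eventually_ge_atTop 1] with k hk hk1
  have hk0 : (0 : ℝ) < k := by exact_mod_cast hk1
  have h1 : (k : ℝ) ^ a = Real.exp (a * Real.log k) := by
    rw [mul_comm, Real.exp_mul, Real.exp_log hk0, Real.rpow_natCast]
  change (k : ℝ) ^ a * Real.exp (-f k) ≤ (k : ℝ)⁻¹
  rw [h1, ← Real.exp_add, ← Real.exp_log hk0, ← Real.exp_neg, Real.log_exp]
  refine Real.exp_le_exp.2 ?_
  push_cast at hk
  linarith

theorem IsLittleO.eventually_mul_le {f g : ℕ → ℝ} (h : f =o[atTop] g)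
    (hg : ∀ᶠ k in atTop, 0 ≤ g k) {a : ℝ} (ha : 0 ≤ a) : ∀ᶠ k in atTop, a * f k ≤ g k := by
  have h1 := h.bound (show 0 < 1 / (a + 1) by positivity)
  filter_upwards [h1, hg] with k hk hgk
  rw [Real.norm_of_nonneg hgk, Real.norm_eq_abs] at hk
  have h2 : f k ≤ 1 / (a + 1) * g k := (le_abs_self _).trans hk
  calc a * f k ≤ a * (1 / (a + 1) * g k) := mul_le_mul_of_nonneg_left h2 ha
    _ = a / (a + 1) * g k := by ring
    _ ≤ 1 * g k := mul_le_mul_of_nonneg_right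
        ((div_le_one (by positivity)).2 (by linarith)) hgk
    _ = g k := one_mul _

theorem exp_sub_one_le {x : ℝ} (h0 : 0 ≤ x) (h1 : x ≤ 1) : Real.exp x - 1 ≤ 2 * x := by
  have := Real.abs_exp_sub_one_le (abs_le.2 ⟨by linarith, h1⟩)
  rw [abs_of_nonneg h0] at this
  exact (le_abs_self _).trans this

theorem one_add_pow_sub_one_le {ε : ℝ} (h0 : 0 ≤ ε) (m : ℕ) (h : m * (2 * ε) ≤ 1) :
    (1 + 2 * ε) ^ m - 1 ≤ 4 * m * ε := by
  have h1 : (1 + 2 * ε) ^ m ≤ Real.exp (m * (2 * ε)) := by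
    rw [Real.exp_nat_mul]
    exact pow_le_pow_left₀ (by linarith) (by linarith [Real.add_one_le_exp (2 * ε)]) m
  have h2 := exp_sub_one_le (by positivity : 0 ≤ (m : ℝ) * (2 * ε)) h
  linarith

end Asymptotic

/-! ## Growth of the parameters -/

theorem Params.clog_le (p : Params) : (Nat.clog 2 p.q : ℝ) ≤ 2 * Real.logb 2 p.q := by
  have hq := p.one_lt_q
  have h1 : 1 ≤ Nat.clog 2 p.q := p.one_le_clog
  have h2 : 2 ^ (Nat.clog 2 p.q).pred < p.q := Nat.pow_pred_clog_lt_self one_lt_two hq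
  have h3 : ((Nat.clog 2 p.q : ℝ) - 1) ≤ Real.logb 2 p.q := by
    rw [Real.le_logb_iff_rpow_le one_lt_two (by exact_mod_cast p.q_primePow.pos)]
    have h4 : ((Nat.clog 2 p.q : ℝ) - 1) = ((Nat.clog 2 p.q).pred : ℕ) := by
      rw [Nat.pred_eq_sub_one, Nat.cast_sub h1, Nat.cast_one]
    rw [h4, Real.rpow_natCast]
    exact_mod_cast h2.le
  have h5 : 1 ≤ Real.logb 2 p.q := by
    rw [Real.le_logb_iff_rpow_le one_lt_two (by exact_mod_cast p.q_primePow.pos), Real.rpow_one]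
    exact_mod_cast hq
  linarith

theorem Params.one_le_q (p : Params) : (1 : ℝ) ≤ p.q := by exact_mod_cast p.one_lt_q.le

theorem Params.m_eq (p : Params) : (p.m : ℝ) = 2 * p.n * Nat.clog 2 p.q := by
  rw [Params.m]
  push_cast
  rfl

theorem Params.n_le_m (p : Params) : p.n ≤ p.m := by
  have := p.one_le_clog
  rw [Params.m]
  nlinarith

/-- `q^n 2^{-m} ≤ 2^{-n}`. -/
theorem Params.q_pow_mul_le (p : Params) : (p.q : ℝ) ^ p.n * (1 / 2) ^ p.m ≤ (1 / 2) ^ p.n := by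
  have h1 : p.q ≤ 2 ^ Nat.clog 2 p.q := Nat.le_pow_clog one_lt_two _
  have h2 : (p.q : ℝ) * (1 / 2) ^ Nat.clog 2 p.q ≤ 1 := by
    rw [one_div, inv_pow, ← div_eq_mul_inv, div_le_one (by positivity)]
    exact_mod_cast h1
  have h3 : (p.q : ℝ) ^ p.n * (1 / 2) ^ p.m =
      ((p.q : ℝ) * (1 / 2) ^ Nat.clog 2 p.q) ^ p.n * ((1 / 2) ^ Nat.clog 2 p.q) ^ p.n := by
    rw [Params.m, mul_pow, ← pow_mul, mul_assoc ((p.q : ℝ) ^ p.n), ← pow_add]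
    congr 2
    ring
  rw [h3]
  have h4 : ((1 / 2 : ℝ) ^ Nat.clog 2 p.q) ≤ 1 / 2 := by
    calc ((1 / 2 : ℝ) ^ Nat.clog 2 p.q) ≤ (1 / 2) ^ 1 :=
          pow_le_pow_of_le_one (by norm_num) (by norm_num) p.one_le_clog
      _ = 1 / 2 := pow_one _
  calc _ ≤ 1 * (1 / 2 : ℝ) ^ p.n := mul_le_mul (pow_le_one₀ (by positivity) h2)
        (pow_le_pow_left₀ (by positivity) h4 _) (by positivity) zero_le_one
    _ = _ := one_mul _

theorem PolyBounded.sqrt {f : ℕ → ℝ} (hf : PolyBounded f) (h1 : ∀ᶠ k in atTop, 1 ≤ f k) :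
    PolyBounded fun k => √(f k) := by
  refine hf.of_isBigO (IsBigO.of_bound 1 ?_)
  filter_upwards [h1] with k hk
  rw [one_mul, Real.norm_of_nonneg (Real.sqrt_nonneg _), Real.norm_of_nonneg (by linarith)]
  exact Real.sqrt_le_iff.2 ⟨by linarith, by nlinarith⟩

namespace ParamSetting

variable {P : ℕ → Params} {C : ℝ} {w : ℕ → ℝ} (h : ParamSetting P C w)
include h

theorem n_poly : PolyBounded fun k => ((P k).n : ℝ) :=
  ⟨1, by simpa using h.n_linear.1⟩

theorem tendsto_n : Tendsto (fun k => ((P k).n : ℝ)) atTop atTop := by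
  obtain ⟨c, hc⟩ := h.n_linear.2.bound
  refine tendsto_atTop_mono' _ ?_
    ((tendsto_natCast_atTop_atTop (R := ℝ)).atTop_div_const (by positivity : 0 < |c| + 1))
  filter_upwards [hc] with k hk
  rw [Real.norm_of_nonneg (Nat.cast_nonneg _), Real.norm_of_nonneg (Nat.cast_nonneg _)] at hk
  rw [div_le_iff₀ (by positivity)]
  have := mul_le_mul_of_nonneg_right (le_abs_self c) (Nat.cast_nonneg (α := ℝ) (P k).n)
  have hn := Nat.cast_nonneg (α := ℝ) (P k).n
  linarith

theorem eventually_one_le_n : ∀ᶠ k in atTop, (1 : ℝ) ≤ (P k).n := h.tendsto_n.eventually_ge_atTop 1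

theorem modulus_poly : PolyBounded fun k => ((P k).ℓ : ℝ) ^ 2 * ((P k).n : ℝ) ^ 4 :=
  (h.ℓ_poly.pow 2).mul (h.n_poly.pow 4)

theorem eventually_one_le_modulus :
    ∀ᶠ k in atTop, 1 ≤ ((P k).ℓ : ℝ) ^ 2 * ((P k).n : ℝ) ^ 4 := by
  filter_upwards [h.eventually_one_le_n] with k hk
  have hl : (1 : ℝ) ≤ (P k).ℓ := by exact_mod_cast h.ℓ_pos k
  exact one_le_mul_of_one_le_of_one_le (one_le_pow₀ hl) (one_le_pow₀ hk)

theorem q_poly : PolyBounded fun k => ((P k).q : ℝ) :=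
  h.q_le.polyBounded h.modulus_poly h.eventually_one_le_modulus

theorem log_q : (fun k => Real.log (P k).q) =O[atTop] fun k : ℕ => Real.log k :=
  h.q_poly.log_isBigO (Eventually.of_forall fun k => (P k).one_le_q)

theorem clog_q : (fun k => (Nat.clog 2 (P k).q : ℝ)) =O[atTop] fun k : ℕ => Real.log k := by
  refine IsBigO.trans (IsBigO.of_bound (2 / Real.log 2) (Eventually.of_forall fun k => ?_)) h.log_q
  rw [Real.norm_of_nonneg (Nat.cast_nonneg _),
    Real.norm_of_nonneg (Real.log_nonneg (P k).one_le_q)]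
  refine (P k).clog_le.trans (le_of_eq ?_)
  rw [Real.logb]
  ring

theorem m_isBigO : (fun k => ((P k).m : ℝ)) =O[atTop] fun k : ℕ =>
    ((P k).n : ℝ) * Real.log k := by
  simp only [Params.m_eq]
  simpa only [mul_assoc] using
    ((isBigO_refl (fun k => ((P k).n : ℝ)) atTop).const_mul_left 2).mul h.clog_q

theorem m_poly : PolyBounded fun k => ((P k).m : ℝ) := by
  have := polyBounded_log_pow 1
  simp only [pow_one] at this
  exact (h.n_poly.mul this).of_isBigO h.m_isBigO

theorem tendsto_m : Tendsto (fun k => ((P k).m : ℝ)) atTop atTop :=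
  tendsto_atTop_mono (fun k => by exact_mod_cast (P k).n_le_m) h.tendsto_n

theorem eventually_one_le_m : ∀ᶠ k in atTop, (1 : ℝ) ≤ (P k).m := h.tendsto_m.eventually_ge_atTop 1

/-- `log k = O(log n)`, in an explicit form. -/
theorem eventually_log_le : ∀ᶠ k : ℕ in atTop, Real.log k ≤ 2 * Real.log (P k).n := by
  obtain ⟨c, hc⟩ := h.n_linear.2.bound
  filter_upwards [hc, h.tendsto_n.eventually_ge_atTop c, h.eventually_one_le_n,
    eventually_ge_atTop 1] with k hk hn hn1 hk1
  have hk0 : (0 : ℝ) < k := by exact_mod_cast hk1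
  rw [Real.norm_of_nonneg hk0.le, Real.norm_of_nonneg (Nat.cast_nonneg _)] at hk
  calc Real.log k ≤ Real.log ((P k).n ^ 2) := by
        refine Real.log_le_log hk0 (hk.trans ?_)
        rw [pow_two]
        exact mul_le_mul_of_nonneg_right hn (Nat.cast_nonneg _)
    _ = 2 * Real.log (P k).n := by rw [Real.log_pow]; norm_num

theorem log_n : (fun k => Real.log (P k).n) =O[atTop] fun k : ℕ => Real.log k :=
  h.n_poly.log_isBigO h.eventually_one_le_n

theorem sqrt_m_isBigO : (fun k => √((P k).m : ℝ)) =O[atTop] fun k : ℕ =>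
    √((P k).n : ℝ) * Real.log k := by
  have h1 : ∀ k, √((P k).m : ℝ) ≤ √2 * √((P k).n : ℝ) * Nat.clog 2 (P k).q := by
    intro k
    have hK : (1 : ℝ) ≤ Nat.clog 2 (P k).q := by exact_mod_cast (P k).one_le_clog
    rw [Params.m_eq, Real.sqrt_mul (by positivity), Real.sqrt_mul (by positivity)]
    refine mul_le_mul_of_nonneg_left ?_ (by positivity)
    exact Real.sqrt_le_iff.2 ⟨by positivity, by nlinarith⟩
  refine IsBigO.trans (IsBigO.of_bound 1 (Eventually.of_forall fun k => ?_))
    (((isBigO_refl (fun k => √((P k).n : ℝ)) atTop).const_mul_left (√2)).mul h.clog_q)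
  rw [one_mul, Real.norm_of_nonneg (Real.sqrt_nonneg _), Real.norm_of_nonneg (by positivity)]
  exact h1 k

/-- The factor by which `s` exceeds `√m`. -/
def _root_.SRPE.widthRatio (P : ℕ → Params) (k : ℕ) : ℝ := max 1 ((P k).s / √((P k).m : ℝ))

theorem s_isBigO : ∃ c : ℕ, (fun k => (P k).s) =O[atTop] fun k : ℕ =>
    √((P k).m : ℝ) * Real.log k ^ c := by
  have h1 : ∀ᶠ k in atTop, 1 ≤ √((P k).m : ℝ) := by
    filter_upwards [h.eventually_one_le_m] with k hk using Real.one_le_sqrt.2 hk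
  exact h.s_le.exists_isBigO (h.m_poly.sqrt h.eventually_one_le_m) h1

theorem widthRatio_isBigO : ∃ c : ℕ, widthRatio P =O[atTop] fun k : ℕ => Real.log k ^ c := by
  obtain ⟨c, hc⟩ := h.s_isBigO
  obtain ⟨a, ha⟩ := hc.bound
  refine ⟨c, IsBigO.of_bound (1 + |a|) ?_⟩
  filter_upwards [ha, h.eventually_one_le_m, eventually_one_le_log] with k hk hm hl
  have hm0 : 0 < √((P k).m : ℝ) := Real.sqrt_pos.2 (by linarith)
  have hlc : 1 ≤ Real.log k ^ c := one_le_pow₀ hl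
  have hs := (P k).s_pos
  rw [Real.norm_of_nonneg hs.le, Real.norm_of_nonneg (by positivity)] at hk
  rw [widthRatio, Real.norm_of_nonneg (zero_le_one.trans (le_max_left _ _)),
    Real.norm_of_nonneg (by positivity)]
  refine max_le ?_ ?_
  · nlinarith [abs_nonneg a]
  · rw [div_le_iff₀ hm0]
    have h3 : a * (√((P k).m : ℝ) * Real.log k ^ c) ≤ |a| * (√((P k).m : ℝ) * Real.log k ^ c) :=
      mul_le_mul_of_nonneg_right (le_abs_self a) (by positivity)
    nlinarith [mul_pos hm0 (zero_lt_one.trans_le hlc)]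

theorem B_isBigO : ∃ c : ℕ, (fun k => (P k).B) =O[atTop] fun k : ℕ =>
    √((P k).n : ℝ) * Real.log k ^ c := by
  have h1 : ∀ᶠ k in atTop, 1 ≤ √((P k).n : ℝ) := by
    filter_upwards [h.eventually_one_le_n] with k hk using Real.one_le_sqrt.2 hk
  exact h.B_le.exists_isBigO (h.n_poly.sqrt h.eventually_one_le_n) h1

end ParamSetting

/-- The deviation in the tail bounds. -/
def deviation (k : ℕ) : ℝ := 1 + Real.log (k + 1)

theorem one_le_deviation (k : ℕ) : 1 ≤ deviation k := by
  have : 0 ≤ Real.log (k + 1) := Real.log_nonneg (by linarith [Nat.cast_nonneg (α := ℝ) k])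
  rw [deviation]
  linarith

theorem log_le_deviation {k : ℕ} (hk : 1 ≤ k) : Real.log k ≤ deviation k := by
  have : Real.log k ≤ Real.log (k + 1) :=
    Real.log_le_log (by exact_mod_cast hk) (by linarith)
  rw [deviation]
  linarith

theorem deviation_isBigO : deviation =O[atTop] fun k : ℕ => Real.log k := by
  refine IsBigO.of_bound 3 ?_
  filter_upwards [eventually_one_le_log, eventually_ge_atTop 2] with k hk hk2
  have hk2 : (2 : ℝ) ≤ k := by exact_mod_cast hk2
  rw [Real.norm_of_nonneg (zero_le_one.trans (one_le_deviation k)),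
    Real.norm_of_nonneg (zero_le_one.trans hk), deviation]
  have h1 : Real.log (k + 1) ≤ Real.log ((k : ℝ) ^ 2) :=
    Real.log_le_log (by linarith) (by nlinarith)
  rw [Real.log_pow] at h1
  push_cast at h1
  linarith

/-- The slack factor `g` in the bound for the decryption error. -/
def slack (P : ℕ → Params) (k : ℕ) : ℝ :=
  40 * widthRatio P k * Nat.clog 2 (P k).q * deviation k ^ 3

theorem slack_nonneg (P : ℕ → Params) (k : ℕ) : 0 ≤ slack P k := by
  have h1 : 0 ≤ widthRatio P k := zero_le_one.trans (le_max_left _ _)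
  have h2 := zero_le_one.trans (one_le_deviation k)
  rw [slack]
  positivity

theorem deviation_pow_le_slack (P : ℕ → Params) (k : ℕ) : deviation k ^ 3 ≤ slack P k := by
  have h1 : 1 ≤ widthRatio P k := le_max_left _ _
  have hK : (1 : ℝ) ≤ Nat.clog 2 (P k).q := by exact_mod_cast (P k).one_le_clog
  have h2 := zero_le_one.trans (one_le_deviation k)
  rw [slack]
  refine le_mul_of_one_le_left (by positivity) ?_
  exact one_le_mul_of_one_le_of_one_le (by linarith) hK

namespace ParamSetting

variable {P : ℕ → Params} {C : ℝ} {w : ℕ → ℝ} (h : ParamSetting P C w)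
include h

theorem slack_isBigO : ∃ c : ℕ, slack P =O[atTop] fun k : ℕ => Real.log k ^ c := by
  obtain ⟨c, hc⟩ := h.widthRatio_isBigO
  refine ⟨c + 1 + 3, ?_⟩
  have := ((hc.const_mul_left 40).mul h.clog_q).mul (deviation_isBigO.pow 3)
  simp only [pow_add, pow_one]
  exact this

theorem log_n_isLittleO_slack : (fun k => Real.log (P k).n) =o[atTop] slack P := by
  have h1 : (fun k => Real.log (P k).n) =O[atTop] deviation := by
    refine h.log_n.trans (IsBigO.of_bound 1 ?_)
    filter_upwards [eventually_ge_atTop 1, eventually_one_le_log] with k hk hl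
    rw [one_mul, Real.norm_of_nonneg (zero_le_one.trans hl),
      Real.norm_of_nonneg (zero_le_one.trans (one_le_deviation k))]
    exact log_le_deviation hk
  have ht : Tendsto deviation atTop atTop := by
    refine tendsto_atTop_mono' _ ?_ (Real.tendsto_log_atTop.comp tendsto_natCast_atTop_atTop)
    filter_upwards [eventually_ge_atTop 1] with k hk using log_le_deviation hk
  have h2 : deviation =o[atTop] fun k => deviation k ^ 3 := by
    have := (isLittleO_pow_pow_atTop_of_lt (𝕜 := ℝ) (by norm_num : 1 < 3)).comp_tendsto ht
    simpa only [Function.comp_def, pow_one] using this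
  refine (h1.trans_isLittleO h2).trans_isBigO (IsBigO.of_bound 1 (Eventually.of_forall fun k => ?_))
  rw [one_mul, Real.norm_of_nonneg (slack_nonneg P k),
    Real.norm_of_nonneg (pow_nonneg (zero_le_one.trans (one_le_deviation k)) 3)]
  exact deviation_pow_le_slack P k

/-- Up to powers of `log k`, the factors `s` and `B` contribute `√n` each and `m²` contributes `n²`,
which makes `ℓ n³`. -/
theorem errorBound_isBigO : ∃ c : ℕ, errorBound P (slack P) =O[atTop] fun k : ℕ =>
    (((P k).ℓ : ℝ) * ((P k).n : ℝ) ^ 3) * Real.log k ^ c := by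
  obtain ⟨a, ha⟩ := h.s_isBigO
  obtain ⟨b, hb⟩ := h.B_isBigO
  obtain ⟨d, hd⟩ := h.slack_isBigO
  have hs := ha.trans ((h.sqrt_m_isBigO).mul (isBigO_refl (fun k : ℕ => Real.log k ^ a) atTop))
  have h1 := (((hs.mul (isBigO_refl (fun k => ((P k).ℓ : ℝ)) atTop)).mul (h.m_isBigO.pow 2)).mul
    hb).mul hd
  refine ⟨1 + a + 2 + b + d, h1.congr_right fun k => ?_⟩
  have hn := Real.mul_self_sqrt (Nat.cast_nonneg (α := ℝ) (P k).n)
  simp only [pow_add]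
  calc _ = (√((P k).n : ℝ) * √((P k).n : ℝ)) * ((P k).ℓ * (P k).n ^ 2 * (Real.log k *
        Real.log k ^ a * Real.log k ^ 2 * Real.log k ^ b * Real.log k ^ d)) := by ring
    _ = _ := by
      rw [hn]
      ring

theorem errorBound_softO :
    SoftO (errorBound P (slack P)) (fun k => (P k).ℓ ^ 2 * (P k).n ^ 3) := by
  obtain ⟨c, hc⟩ := h.errorBound_isBigO
  refine ⟨c, hc.trans (IsBigO.of_bound (2 ^ c) ?_)⟩
  filter_upwards [h.eventually_log_le, h.eventually_one_le_n, eventually_one_le_log] with k hk hn hl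
  have hℓ : (1 : ℝ) ≤ (P k).ℓ := by exact_mod_cast h.ℓ_pos k
  -- `SoftO` measures by the logarithm of the comparison function itself; `log k ≤ 2 log n` leads
  -- back to it.
  have h1 : Real.log (P k).n ≤ Real.log ((P k).ℓ ^ 2 * (P k).n ^ 3) := by
    refine Real.log_le_log (by linarith) ?_
    have h2 : (1 : ℝ) ≤ ((P k).ℓ : ℝ) ^ 2 * ((P k).n : ℝ) ^ 2 :=
      one_le_mul_of_one_le_of_one_le (one_le_pow₀ hℓ) (one_le_pow₀ hn)
    nlinarith
  have h3 : Real.log k ≤ 2 * Real.log ((P k).ℓ ^ 2 * (P k).n ^ 3) := by linarith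
  have h4 : 0 ≤ Real.log ((P k).ℓ ^ 2 * (P k).n ^ 3) := by linarith
  rw [Real.norm_of_nonneg (by positivity), Real.norm_of_nonneg (by positivity)]
  calc ((P k).ℓ : ℝ) * (P k).n ^ 3 * Real.log k ^ c
      ≤ (P k).ℓ ^ 2 * (P k).n ^ 3 * (2 * Real.log ((P k).ℓ ^ 2 * (P k).n ^ 3)) ^ c := by
        gcongr
        nlinarith
    _ = _ := by rw [mul_pow]; ring

/-- The modulus dominates `ℓ² n³` up to polylogarithmic factors. -/
theorem isLittleO_q (c : ℕ) : (fun k : ℕ => ((P k).ℓ : ℝ) ^ 2 * ((P k).n : ℝ) ^ 3 *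
    Real.log k ^ c) =o[atTop] fun k => ((P k).q : ℝ) := by
  obtain ⟨d, hd⟩ := h.q_ge
  have h1 : (fun k : ℕ => ((P k).ℓ : ℝ) ^ 2 * ((P k).n : ℝ) ^ 4) =O[atTop] fun k : ℕ =>
      ((P k).q : ℝ) * Real.log k ^ d :=
    hd.trans ((isBigO_refl _ _).mul (h.log_q.pow d))
  have h2 : (fun k : ℕ => Real.log k ^ (d + c)) =o[atTop] fun k => ((P k).n : ℝ) :=
    (isLittleO_log_pow (d + c)).trans_isBigO h.n_linear.2
  -- The margin between `ℓ² n³` and the modulus is one factor `n`, which absorbs every power of `log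
  -- k`.
  have h3 : (fun k : ℕ => ((P k).ℓ : ℝ) ^ 2 * ((P k).n : ℝ) ^ 3 * Real.log k ^ c) =O[atTop]
      fun k => ((P k).q : ℝ) * (Real.log k ^ (d + c) / (P k).n) := by
    have h4 := h1.mul (isBigO_refl (fun k : ℕ => Real.log k ^ c / ((P k).n : ℝ)) atTop)
    refine (h4.congr' ?_ ?_)
    · filter_upwards [h.eventually_one_le_n] with k hk
      have : ((P k).n : ℝ) ≠ 0 := by linarith
      field_simp
    · refine Eventually.of_forall fun k => ?_
      simp only [pow_add]
      ring
  refine h3.trans_isLittleO ?_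
  have h5 : (fun k : ℕ => Real.log k ^ (d + c) / ((P k).n : ℝ)) =o[atTop] fun _ => (1 : ℝ) := by
    rw [isLittleO_one_iff]
    exact h2.tendsto_div_nhds_zero
  simpa using (isBigO_refl (fun k => ((P k).q : ℝ)) atTop).mul_isLittleO h5

theorem errorBound_isLittleO : errorBound P (slack P) =o[atTop] fun k => ((P k).q : ℝ) := by
  obtain ⟨c, hc⟩ := h.errorBound_isBigO
  refine (hc.trans (IsBigO.of_bound 1 ?_)).trans_isLittleO (h.isLittleO_q c)
  filter_upwards [eventually_one_le_log] with k hl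
  have hℓ : (1 : ℝ) ≤ (P k).ℓ := by exact_mod_cast h.ℓ_pos k
  rw [one_mul, Real.norm_of_nonneg (by positivity), Real.norm_of_nonneg (by positivity)]
  gcongr
  nlinarith

theorem eventually_errorBound_le : ∀ᶠ k in atTop, errorBound P (slack P) k ≤ (P k).q / 100 := by
  filter_upwards [IsLittleO.eventually_mul_le h.errorBound_isLittleO
    (Eventually.of_forall fun k => Nat.cast_nonneg _) (by norm_num : (0 : ℝ) ≤ 100)] with k hk
  linarith

theorem eventually_ten_lt_q : ∀ᶠ k in atTop, 10 < (P k).q := by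
  filter_upwards [IsLittleO.eventually_mul_le (h.isLittleO_q 0)
    (Eventually.of_forall fun k => Nat.cast_nonneg _) (by norm_num : (0 : ℝ) ≤ 20),
    h.eventually_one_le_n] with k hk hn
  have hℓ : (1 : ℝ) ≤ (P k).ℓ := by exact_mod_cast h.ℓ_pos k
  have h1 : 1 ≤ ((P k).ℓ : ℝ) ^ 2 * ((P k).n : ℝ) ^ 3 :=
    one_le_mul_of_one_le_of_one_le (one_le_pow₀ hℓ) (one_le_pow₀ hn)
  rw [pow_zero, mul_one] at hk
  have h2 : (10 : ℝ) < (P k).q := by linarith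
  exact_mod_cast h2

end ParamSetting

/-! ### Negligible failure terms and adequacy for large parameters -/

section Eventually

open Topology

theorem negligible_pow {b : ℝ} (h0 : 0 < b) (h1 : b < 1) {f : ℕ → ℕ}
    (hf : (fun k : ℕ => Real.log k) =o[atTop] fun k => (f k : ℝ)) : Negligible fun k => b ^ f k := by
  have hb : 0 < -Real.log b := neg_pos.2 (Real.log_neg h0 h1)
  refine Negligible.congr (e := fun k => Real.exp (-(f k * -Real.log b))) (negligible_exp_neg
    fun a => ?_) (Eventually.of_forall fun k => ?_)
  · filter_upwards [IsLittleO.eventually_mul_le hf (Eventually.of_forall fun k => Nat.cast_nonneg _)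
      (by positivity : 0 ≤ a / -Real.log b)] with k hk
    rwa [div_mul_eq_mul_div, div_le_iff₀ hb] at hk
  · rw [mul_neg, neg_neg, Real.exp_nat_mul, Real.exp_log h0]

/-- The square of a deviation of size at least `log k` eventually exceeds every constant multiple of
`log k`, while the deviation itself costs only a logarithmic factor in the error bound. -/
theorem exp_deviation_negligible : Negligible fun k => Real.exp (-deviation k ^ 2) := by
  refine negligible_exp_neg fun a => ?_
  filter_upwards [(Real.tendsto_log_atTop.comp
    tendsto_natCast_atTop_atTop).eventually_ge_atTop (a : ℝ), eventually_one_le_log,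
    eventually_ge_atTop 1] with k h1 h2 h3
  have h4 := log_le_deviation h3
  calc (a : ℝ) * Real.log k ≤ Real.log k * Real.log k :=
        mul_le_mul_of_nonneg_right h1 (by linarith)
    _ ≤ deviation k ^ 2 := by nlinarith

theorem PolyBounded.eventually_mul_le {f e : ℕ → ℝ} (hf : PolyBounded f) (he : Negligible e) {b : ℝ}
    (hb : 0 < b) : ∀ᶠ k in atTop, f k * e k ≤ b :=
  (hf.mul_negligible he).tendsto.eventually_le_const hb

theorem gsNorm_pos {m : ℕ} (hm : 0 < m) {T : Matrix (Fin m) (Fin m) ℤ} (hT : T.det ≠ 0) :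
    0 < gsNorm T := by
  have h1 : InnerProductSpace.gramSchmidt ℝ (euclCol T) (⟨0, hm⟩ : Fin m) = euclCol T ⟨0, hm⟩ := by
    rw [InnerProductSpace.gramSchmidt_def, Finset.sum_eq_zero, sub_zero]
    intro i hi
    have h2 := Finset.mem_Iio.1 hi
    exact absurd h2 (by simp [Fin.lt_def])
  have h2 : euclCol T ⟨0, hm⟩ ≠ 0 := by
    intro h0
    refine hT (Matrix.det_eq_zero_of_column_eq_zero ⟨0, hm⟩ fun i => ?_)
    have h3 : (euclCol T ⟨0, hm⟩) i = 0 := by rw [h0]; rfl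
    exact_mod_cast (show (T i ⟨0, hm⟩ : ℝ) = 0 from h3)
  refine lt_of_lt_of_le (norm_pos_iff.2 h2) ?_
  rw [← h1]
  exact le_ciSup (f := fun j => ‖InnerProductSpace.gramSchmidt ℝ (euclCol T) j‖)
    (Set.finite_range _).bddAbove ⟨0, hm⟩

namespace ParamSetting

variable {P : ℕ → Params} {C : ℝ} {w : ℕ → ℝ} (h : ParamSetting P C w)
include h

/-- The constant of `TrapGen` is positive, because bases have nonzero Gram-Schmidt vectors. -/
theorem C_pos {tg : ∀ k, PMF ((P k).Mat × Matrix (Fin (P k).m) (Fin (P k).m) ℤ)}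
    (htg : IsTrapGen P C tg) : 0 < C := by
  obtain ⟨ε, hε, hk⟩ := htg
  have h1 : ∀ᶠ k in atTop, ε k < 1 := hε.tendsto.eventually_lt_const one_pos
  obtain ⟨k, hk1, hm⟩ := (h1.and h.eventually_one_le_m).exists
  have hm0 : 0 < (P k).m := by exact_mod_cast zero_lt_one.trans_le hm
  by_contra hC
  have h2 : prob (tg k) {AT | IsLatticeBasis AT.1 AT.2 ∧
      gsNorm AT.2 ≤ C * √((P k).n * Real.logb 2 (P k).q) ∧
      colNorm AT.2 ≤ C * ((P k).n * Real.logb 2 (P k).q)} = 0 := by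
    refine le_antisymm ?_ (prob_nonneg _ _)
    refine (prob_mono (T := ∅) fun AT hAT => ?_).trans (by simp [prob])
    have h3 := gsNorm_pos hm0 hAT.1.1
    have h4 := mul_nonneg (neg_nonneg.2 (not_lt.1 hC))
      (Real.sqrt_nonneg ((P k).n * Real.logb 2 (P k).q))
    linarith [hAT.2.1]
  have h3 := (hk k).2
  rw [h2] at h3
  linarith

theorem eventually_log_m {c : ℝ} (hc : 0 ≤ c) :
    ∀ᶠ k in atTop, c * √(Real.log (2 * (P k).m)) ≤ w k :=
  IsLittleO.eventually_mul_le h.w_large (Eventually.of_forall h.w_nonneg) hc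

theorem eventually_log_le_log_m :
    ∀ᶠ k : ℕ in atTop, Real.log k ≤ 2 * Real.log (2 * (P k).m) := by
  filter_upwards [h.eventually_log_le, h.eventually_one_le_n] with k hk hn
  refine hk.trans (mul_le_mul_of_nonneg_left (Real.log_le_log (by linarith) ?_) zero_le_two)
  have : ((P k).n : ℝ) ≤ (P k).m := by exact_mod_cast (P k).n_le_m
  linarith

theorem eventually_one_le_w : ∀ᶠ k in atTop, 1 ≤ w k := by
  filter_upwards [h.eventually_log_m zero_le_two, h.eventually_log_le_log_m,
    eventually_one_le_log] with k hk h1 h2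
  have h3 : 1 / 2 ≤ √(Real.log (2 * (P k).m)) :=
    Real.le_sqrt_of_sq_le (by linarith)
  linarith

theorem smoothErr_negligible : Negligible fun k => smoothErr (w k) := by
  refine Negligible.const_mul (negligible_exp_neg fun a => ?_) 16
  -- The coefficient `2 a + 1` is chosen so that its square is at least `2 a`; the factor `2` pays
  -- for `log k ≤ 2 log (2 m)`.
  filter_upwards [h.eventually_log_m (by positivity : (0 : ℝ) ≤ 2 * a + 1),
    h.eventually_log_le_log_m, eventually_one_le_log] with k hk h1 h2
  have hL : 0 ≤ Real.log (2 * (P k).m) := by linarith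
  have h3 := pow_le_pow_left₀ (by positivity) hk 2
  rw [mul_pow, Real.sq_sqrt hL] at h3
  have h4 : (a : ℝ) * Real.log k ≤ a * (2 * Real.log (2 * (P k).m)) :=
    mul_le_mul_of_nonneg_left h1 (Nat.cast_nonneg _)
  have h5 : 1 * w k ^ 2 ≤ Real.pi * w k ^ 2 :=
    mul_le_mul_of_nonneg_right (by linarith [Real.pi_gt_three]) (sq_nonneg _)
  have h6 : (2 * (a : ℝ)) * Real.log (2 * (P k).m) ≤
      (2 * a + 1) ^ 2 * Real.log (2 * (P k).m) := by
    refine mul_le_mul_of_nonneg_right ?_ hL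
    nlinarith [Nat.cast_nonneg (α := ℝ) a]
  linarith

theorem eventually_gadget_le (hC : 0 < C) :
    ∀ᶠ k in atTop, 2 * √(Nat.clog 2 (P k).q : ℕ) * w k ≤ (P k).s := by
  -- The threshold `8 / C²` comes from `4 ⌈log₂ q⌉ ≤ 8 log₂ q ≤ C² n log₂ q`: the gadget vectors are
  -- shorter than the trapdoor bound by a factor of order `√n`.
  filter_upwards [h.s_ge, h.tendsto_n.eventually_ge_atTop (8 / C ^ 2)] with k hk hn
  refine le_trans (mul_le_mul_of_nonneg_right ?_ (h.w_nonneg k)) hk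
  rw [div_le_iff₀ (by positivity)] at hn
  have hl : 0 ≤ Real.logb 2 (P k).q := Real.logb_nonneg one_lt_two (P k).one_le_q
  have h1 := (P k).clog_le
  refine (pow_le_pow_iff_left₀ (by positivity) (by positivity) two_ne_zero).1 ?_
  have h2 := mul_le_mul_of_nonneg_right hn hl
  rw [mul_pow, mul_pow, Real.sq_sqrt (Nat.cast_nonneg _), Real.sq_sqrt (by positivity)]
  calc (2 : ℝ) ^ 2 * Nat.clog 2 (P k).q ≤ 8 * Real.logb 2 (P k).q := by linarith
    _ ≤ (P k).n * C ^ 2 * Real.logb 2 (P k).q := h2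
    _ = _ := by ring

end ParamSetting

/-- The smoothness factor of the lattices in use. -/
def smoothFactor (P : ℕ → Params) (w : ℕ → ℝ) (k : ℕ) : ℝ :=
  Real.exp (4 * (P k).m * smoothErr (w k))

namespace ParamSetting

variable {P : ℕ → Params} {C : ℝ} {w : ℕ → ℝ} (h : ParamSetting P C w)
include h

theorem eventually_adequate {sub : ∀ k, Subroutines (P k)}
    (hTrapGen : IsTrapGen P C fun k => (sub k).trapGen)
    (hSampleLeft₁ : IsSampleLeft P w fun k => (sub k).sampleLeft₁)
    (hSampleLeft₂ : IsSampleLeft P w fun k => (sub k).sampleLeft₂) :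
    ∃ ε : ℕ → ℝ, Negligible ε ∧ ∀ᶠ k in atTop,
      Adequate (P k) (sub k) C (w k) (ε k) (smoothFactor P w k) (deviation k) := by
  have hC := h.C_pos hTrapGen
  obtain ⟨ε₁, hε₁, h₁⟩ := hTrapGen
  obtain ⟨ε₂, hε₂, h₂⟩ := hSampleLeft₁
  obtain ⟨ε₃, hε₃, h₃⟩ := hSampleLeft₂
  obtain ⟨ε₄, hε₄, h₄⟩ := h.χ_bounded
  -- Negligible functions may take negative values; the sum of the absolute values is one
  -- nonnegative bound for all four assumptions.
  have hε := ((hε₁.abs.add hε₂.abs).add hε₃.abs).add hε₄.abs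
  refine ⟨_, hε, ?_⟩
  have hmm := h.m_poly.mul h.m_poly
  have e1 := PolyBounded.eventually_mul_le ((polyBounded_const 4).mul h.m_poly)
    h.smoothErr_negligible (Real.log_pos one_lt_two)
  -- The second factor `m` is needed for `R ^ m ≤ 2`, since Chernoff bounds over `m` columns lose
  -- one factor `R` per column.
  have e2 := PolyBounded.eventually_mul_le (h.m_poly.mul ((polyBounded_const 4).mul h.m_poly))
    h.smoothErr_negligible (Real.log_pos one_lt_two)
  have e3 := h.m_poly.eventually_mul_le (hε.const_mul 2) one_pos
  filter_upwards [e1, e2, e3, h.eventually_one_le_m, h.eventually_one_le_w,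
    h.eventually_gadget_le hC, h.s_ge] with k e1 e2 e3 hm hw hg hs
  have a1 := abs_nonneg (ε₁ k)
  have a2 := abs_nonneg (ε₂ k)
  have a3 := abs_nonneg (ε₃ k)
  have a4 := abs_nonneg (ε₄ k)
  have b1 := le_abs_self (ε₁ k)
  have b2 := le_abs_self (ε₂ k)
  have b3 := le_abs_self (ε₃ k)
  have b4 := le_abs_self (ε₄ k)
  exact
    { m_pos := by exact_mod_cast zero_lt_one.trans_le hm
      one_le_w := hw
      gadget_le := hg
      trapdoor_le := hs
      ε_nonneg := by positivity
      one_le_τ := one_le_deviation k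
      le_R := le_rfl
      R_le := by
        rw [smoothFactor, ← Real.le_log_iff_exp_le two_pos]
        exact e1
      R_pow_le := by
        rw [smoothFactor, ← Real.exp_nat_mul, ← Real.le_log_iff_exp_le two_pos, ← mul_assoc]
        exact e2
      pow_le := one_add_pow_sub_one_le (by positivity) _ e3
      trapGen_uniform := (h₁ k).1.trans (by linarith)
      trapGen_short := le_trans (by linarith) (h₁ k).2
      sampleLeft₁ := fun A M T u hA hT hs => (h₂ k A M T u hA hT hs).trans (by linarith)
      sampleLeft₂ := fun A M T u hA hT hs => (h₃ k A M T u hA hT hs).trans (by linarith)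
      noise := le_trans (by linarith) (h₄ k) }

theorem eventually_κ_pos : ∀ᶠ k in atTop, 0 < (P k).κ := by
  filter_upwards [IsLittleO.eventually_mul_le h.κ_large
    (Eventually.of_forall fun k => Nat.cast_nonneg _) zero_le_one, eventually_one_le_log] with k h1 h2
  have : (0 : ℝ) < (P k).κ := by linarith
  exact_mod_cast this

theorem log_isLittleO_n : (fun k : ℕ => Real.log k) =o[atTop] fun k => ((P k).n : ℝ) := by
  have := isLittleO_log_pow 1
  simp only [pow_one] at this
  exact this.trans_isBigO h.n_linear.2

theorem two_pow_negligible : Negligible fun k => (1 / 2 : ℝ) ^ (P k).n :=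
  negligible_pow (by norm_num) (by norm_num) h.log_isLittleO_n

theorem setup_negligible {ε : ℕ → ℝ} (hε : Negligible ε) : Negligible fun k =>
    2 * (((P k).q : ℝ) ^ (P k).n * (1 / 2) ^ (P k).m + 3 * ε k) := by
  refine Negligible.const_mul (Negligible.add (h.two_pow_negligible.of_le
    (Eventually.of_forall fun k => ?_)) (hε.const_mul 3)) 2
  rw [abs_of_nonneg (by positivity), abs_of_nonneg (by positivity)]
  exact (P k).q_pow_mul_le

theorem unsoundBound_negligible {ε : ℕ → ℝ} (hε : Negligible ε) :
    Negligible fun k => unsoundBound (P k) (ε k) (deviation k) := by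
  have hδ := exp_deviation_negligible
  have hm := h.m_poly
  have hκ := h.κ_poly
  have hc := polyBounded_const
  refine (h.setup_negligible hε).add (Negligible.add (Negligible.add ?_ ?_)
    (Negligible.add (Negligible.add ?_ ?_) (Negligible.const_mul (Negligible.add ?_ ?_) 2)))
  · exact hκ.mul_negligible (hε.const_mul 2)
  · exact hκ.mul_negligible (((hc 3).mul hm).mul_negligible ((hδ.const_mul 4).add (hε.const_mul 2)))
  · exact Negligible.congr ((hκ.mul_negligible hε).add (((hc 2).mul hm).mul_negligible hε))
      (Eventually.of_forall fun k => by ring)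
  · exact Negligible.congr (((((hc 2).mul h.ℓ_poly).mul hm).mul_negligible (hδ.const_mul 2)).add
      (hm.mul_negligible (hδ.const_mul 2))) (Eventually.of_forall fun k => by ring)
  · exact hm.mul_negligible (hε.const_mul 2)
  · exact hκ.mul_negligible ((hδ.const_mul 4).add (((hc 4).mul hm).mul_negligible hε))

theorem mask_negligible {ε : ℕ → ℝ} (hε : Negligible ε) (hε0 : ∀ᶠ k in atTop, 0 ≤ ε k) :
    Negligible fun k =>
      (7 / 8 * smoothFactor P w k ^ 3 + 2 * ε k) ^ ((P k).κ - 1) := by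
  have h1 : Negligible fun k => (31 / 32 : ℝ) ^ (P k).κ :=
    negligible_pow (by norm_num) (by norm_num) h.κ_large
  -- The constant `32 / 31` makes up for the dropped coordinate in the exponent `κ - 1`.
  refine (h1.const_mul (32 / 31)).of_le ?_
  have e1 := PolyBounded.eventually_mul_le ((polyBounded_const 12).mul h.m_poly)
    h.smoothErr_negligible (by norm_num : (0 : ℝ) < 1 / 32)
  have e2 := PolyBounded.eventually_mul_le (polyBounded_const 2) hε
    (by norm_num : (0 : ℝ) < 1 / 32)
  filter_upwards [e1, e2, hε0, h.eventually_κ_pos] with k e1 e2 e3 hκ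
  have hρ := smoothErr_nonneg (w k)
  have hR : smoothFactor P w k ^ 3 = Real.exp (12 * (P k).m * smoothErr (w k)) := by
    rw [smoothFactor, ← Real.exp_nat_mul]
    congr 1
    push_cast
    ring
  have h2 := exp_sub_one_le (by positivity) (e1.trans (by norm_num))
  -- Numerically, `7/8 · (1 + 1/16) + 1/32 = 123/128`, which is below `31/32`.
  have h3 : 7 / 8 * smoothFactor P w k ^ 3 + 2 * ε k ≤ 31 / 32 := by
    rw [hR]
    linarith
  have h0 : 0 ≤ 7 / 8 * smoothFactor P w k ^ 3 + 2 * ε k := by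
    rw [hR]
    positivity
  rw [abs_of_nonneg (by positivity), abs_of_nonneg (by positivity)]
  refine (pow_le_pow_left₀ h0 h3 _).trans (le_of_eq ?_)
  obtain ⟨j, hj⟩ := Nat.exists_eq_succ_of_ne_zero hκ.ne'
  rw [hj, Nat.succ_sub_one, Nat.succ_eq_add_one, pow_succ]
  ring

theorem smoothFactor_pow_negligible :
    Negligible fun k => (smoothFactor P w k ^ 3) ^ (P k).κ - 1 := by
  have h1 := ((h.κ_poly.mul ((polyBounded_const 12).mul h.m_poly)).mul_negligible
    h.smoothErr_negligible)
  refine (h1.const_mul 2).of_le ?_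
  filter_upwards [h1.tendsto.eventually_le_const one_pos] with k hk
  have hρ := smoothErr_nonneg (w k)
  have hR : (smoothFactor P w k ^ 3) ^ (P k).κ =
      Real.exp ((P k).κ * (12 * (P k).m) * smoothErr (w k)) := by
    rw [smoothFactor, ← Real.exp_nat_mul, ← Real.exp_nat_mul]
    congr 1
    push_cast
    ring
  have h0 : 0 ≤ (P k).κ * (12 * (P k).m) * smoothErr (w k) := by positivity
  have h2 := exp_sub_one_le h0 hk
  rw [hR, abs_of_nonneg (by linarith [Real.one_le_exp h0]), abs_of_nonneg (by linarith)]
  exact h2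

end ParamSetting

end Eventually

end SRPE

end

/-! ### The correctness theorem -/

open SRPE in
theorem mainTheorem2 (P : ℕ → Params) (C : ℝ) (w : ℕ → ℝ) (sub : ∀ k, Subroutines (P k))
    (hP : ParamSetting P C w)
    (hTrapGen : IsTrapGen P C fun k => (sub k).trapGen)
    (hSampleLeft₁ : IsSampleLeft P w fun k => (sub k).sampleLeft₁)
    (hSampleLeft₂ : IsSampleLeft P w fun k => (sub k).sampleLeft₂) :
    ∃ g : ℕ → ℝ,
      (∀ k, 0 ≤ g k) ∧ (fun k => Real.log (P k).n) =o[atTop] g ∧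
      SoftO (errorBound P g) (fun k => (P k).ℓ ^ 2 * (P k).n ^ 3) ∧
      (∀ᶠ k in atTop, errorBound P g k < (P k).q / 5) ∧
      ∃ ε : ℕ → ℝ, Negligible ε ∧
        ∀ (k : ℕ) (st : State (P k)) (RL : RevList (P k)) (id : (P k).Ident) (ν : (P k).Leaf)
          (x y : Fin (P k).ℓ → ZMod (P k).q) (t : (P k).Time) (M : Bool),
          st.leaf id = some ν → ¬ Revoked RL id t →
            (x ⬝ᵥ y = 0 →
              1 - ε k ≤ prob (honestRun (sub k) st RL id ν x t)
                {τ | ∃ tk, τ.tk = some tk ∧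
                  decVec x (τ.partialCt x y t M tk) τ.sk =
                    (((P k).q / 2 : ℕ) : ZMod (P k).q) • vecModQ (P k).q (encode (P k).κ M) +
                      vecModQ (P k).q (errorTerm x τ.sk tk τ.r) ∧
                  (∀ i, |(errorTerm x τ.sk tk τ.r i : ℝ)| ≤ errorBound P g k) ∧
                  dec x (τ.partialCt x y t M tk) τ.sk = some M}) ∧
            (x ⬝ᵥ y ≠ 0 →
              statDist ((honestRun (sub k) st RL id ν x t).map
                  fun τ => (P k).G * modQ (P k).q (middle τ.sk))
                (PMF.uniformOfFintype (Matrix (Fin (P k).n) (Fin (P k).κ) (ZMod (P k).q))) ≤ ε k ∧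
              1 - ε k ≤ prob (honestRun (sub k) st RL id ν x t)
                {τ | ∃ tk, τ.tk = some tk ∧
                  dec x (τ.partialCt x y t M tk) τ.sk = none}) := by
  obtain ⟨ε, hε, hA⟩ := hP.eventually_adequate hTrapGen hSampleLeft₁ hSampleLeft₂
  have hAq := hP.eventually_errorBound_le
  have hq5 : ∀ᶠ k in atTop, errorBound P (slack P) k < (P k).q / 5 := by
    filter_upwards [hAq] with k hk
    linarith [(P k).one_le_q]
  refine ⟨slack P, slack_nonneg P, hP.log_n_isLittleO_slack, hP.errorBound_softO, hq5, ?_⟩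
  have hκε : ∀ᶠ k in atTop, (1 + 2 * ε k) ^ (P k).κ - 1 ≤ 4 * (P k).κ * ε k := by
    filter_upwards [hA, hP.κ_poly.eventually_mul_le (hε.const_mul 2) one_pos]
      with k hk h1 using one_add_pow_sub_one_le hk.ε_nonneg _ h1
  have hall := hA.and (hκε.and (hAq.and (hq5.and (hP.eventually_ten_lt_q.and hP.eventually_κ_pos))))
  set δ₀ : ℕ → ℝ := fun k => 2 * (((P k).q : ℝ) ^ (P k).n * (1 / 2) ^ (P k).m + 3 * ε k) with hδ₀
  set δ₁ : ℕ → ℝ := fun k => unsoundBound (P k) (ε k) (deviation k) with hδ₁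
  set δ₂ : ℕ → ℝ := fun k => δ₀ k + ((1 / 2) ^ (P k).n +
    (7 / 8 * smoothFactor P w k ^ 3 + 2 * ε k) ^ ((P k).κ - 1)) with hδ₂
  set δ₃ : ℕ → ℝ := fun k => δ₀ k + 4 * (P k).κ * ε k +
    ((smoothFactor P w k ^ 3) ^ (P k).κ - 1) with hδ₃
  have n₀ : Negligible δ₀ := hP.setup_negligible hε
  have n₁ : Negligible δ₁ := hP.unsoundBound_negligible hε
  have n₂ : Negligible δ₂ := n₀.add (hP.two_pow_negligible.add (hP.mask_negligible hε
    (hA.mono fun k hk => hk.ε_nonneg)))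
  have n₃ : Negligible δ₃ := (n₀.add (((polyBounded_const 4).mul hP.κ_poly).mul_negligible hε)).add
    hP.smoothFactor_pow_negligible
  obtain ⟨k₀, hk₀⟩ := eventually_atTop.1 hall
  -- The estimates hold from some `k₀` on. Below it the value `1` makes all claims trivial, and
  -- finitely many values do not affect negligibility.
  refine ⟨fun k => if k₀ ≤ k then |δ₁ k| + |δ₂ k| + |δ₃ k| else 1,
    ((n₁.abs.add n₂.abs).add n₃.abs).congr ?_, ?_⟩
  · filter_upwards [eventually_ge_atTop k₀] with k hk
    rw [if_pos hk]
  intro k st RL id ν x y t M hl hr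
  by_cases hk : k₀ ≤ k
  swap
  · simp only [if_neg hk, sub_self]
    exact ⟨fun _ => prob_nonneg _ _, fun _ => ⟨statDist_le_one _ _, prob_nonneg _ _⟩⟩
  obtain ⟨hA, hκ, hq100, hq5, hq10, hκ0⟩ := hk₀ k hk
  simp only [if_pos hk]
  have a1 := abs_nonneg (δ₁ k)
  have a2 := abs_nonneg (δ₂ k)
  have a3 := abs_nonneg (δ₃ k)
  have hm0 : 0 < √((P k).m : ℝ) := Real.sqrt_pos.2 (by exact_mod_cast hA.m_pos)
  have hsound : prob (honestRun (sub k) st RL id ν x t)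
      {ρ | ¬ SoundRun (errorBound P (slack P) k) id x t ρ} ≤ |δ₁ k| :=
    (hA.prob_not_soundRun_le (hP.ℓ_pos k) (le_max_left _ _ : 1 ≤ widthRatio P k)
      ((div_le_iff₀ hm0).1 (le_max_right _ _)) hl hr x).trans (le_abs_self _)
  refine ⟨fun hxy => ?_, fun hxy => ⟨?_, ?_⟩⟩
  · refine one_sub_le_prob ((prob_mono fun ρ hρ => ?_).trans (hsound.trans (by linarith)))
    intro hs
    exact hρ (hs.dec_eq_some hxy hq5 hq10 hκ0 M)
  · refine (statDist_le_of_prob_le _ _ (d := δ₃ k) fun S =>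
      hA.prob_middle_le hκ st RL id ν x t S).trans ?_
    linarith [le_abs_self (δ₃ k)]
  -- Decryption can avoid `⊥` only if the run is unsound or the masks fail to rule it out. The masks
  -- tolerate an error of `q / 100`, stricter than the `q / 5` used for orthogonal vectors.
  · refine one_sub_le_prob ((prob_le_add (fun ρ hρ => ?_) hsound
      ((hA.prob_unmaskedRun_le hκ0 hxy st RL id ν x t).trans (le_abs_self (δ₂ k)))).trans
      (by linarith))
    by_contra hne
    rw [Set.mem_union, not_or] at hne
    exact hρ ((not_not.1 hne.1).dec_eq_none y hne.2 hq100 M)
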